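/- Let $\Omega\subset\mathbb R^2$ be a simply connected polygonal domain, i.e. a simply connected open set with $\Omega=\operatorname{int}\overline\Omega$ whose closure has a finite conforming triangulation $\tau_h^M$ (the macro-mesh) such that, for every vertex $z$, any two triangles with vertex $z$ can be joined by a chain of triangles with vertex $z$ in which consecutive ones share an edge emanating from $z$. Let $V^M$ be the set of vertices of $\tau_h^M$. Vertices, edges or triangles in the following are those of $\tau_h^M$ unless said otherwise; an edge is exterior if it lies on $\partial\Omega$. The Powell–Sabin mesh $\tau_h$ divides each triangle $T^M$ of $\tau_h^M$ into the six triangles whose vertices are the incenter of $T^M$, a vertex $a$ of $T^M$, and the split point of an edge of $T^M$ with endpoint $a$. The split point of an exterior edge is its midpoint; the split point of any other edge is its intersection with the segment joining the incenters of the two triangles that share it. Let $X_h$ be the space of continuous fields $v:\overline\Omega\to\mathbb R^2$ that are polynomials of degree at most $1$ on every triangle of $\tau_h$, and let $$V_h=\{v\in X_h:\ v\in H^1(\Omega)^2,\ \nabla\cdot v=0\text{ on }\Omega\},\qquad V_h^0=\{v\in V_h:\ v=0\text{ on }\partial\Omega\}.$$ For every $z\in V^M$ and $i\in\{1,2,3\}$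 there is exactly one $\Phi_i=\Phi_i^{z}\in V_h$ that vanishes on every closed triangle not containing $z$ and on every edge not containing $z$, and satisfies $$\Phi_i(z)=(\alpha_i,\beta_i),\qquad \int_e\Phi_i\cdot n_e\,ds=\delta_i\quad\text{for every edge } e \text{ with endpoint } z,$$ where $n_e$ is the unit normal on $e$ pointing in the direction of counter-clockwise rotation around $z$, and $(\alpha_i,\beta_i,\delta_i)=(1,0,0),(0,1,0),(0,0,1)$ for $i=1,2,3$. Index $V^M=\{z_0,\dots,z_{|V^M|-1}\}$ so that $z_0\in\partial\Omega$, and write $\Phi_i^{(k)}=\Phi_i^{z_k}$. Then the functions $\Phi_i^{(k)}$, $1\le i\le 3$, $0\le k\le|V^M|-1$, with the single function $\Phi_3^{(0)}$ removed, form a basis of $V_h$; in particular $\dim V_h=3|V^M|-1$. The functions $\Phi_i^{(k)}$, $1\le i\le 3$, attached to the interior vertices $z_k\in\Omega$ form a basis of $V_h^0$. -/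

import Mathlib

open MeasureTheory Set
open scoped ContDiff

noncomputable section

namespace PowellSabin

/-- The Euclidean plane. -/
abbrev Plane : Type := EuclideanSpace ℝ (Fin 2)

/-! ### The macro-mesh -/

/-- The triangles of a simplicial complex in the plane, each given by its set of vertices. -/
def triangles (K : Geometry.SimplicialComplex ℝ Plane) : Set (Finset Plane) :=
  {t | t ∈ K.faces ∧ t.card = 3}

/-- `K` is a conforming triangulation of (the closure of) `Ω`. Conformity, i.e. that two simplices
meet in a common face or not at all, is part of `Geometry.SimplicialComplex`. -/
structure IsMacroMesh (Ω : Set Plane) (K : Geometry.SimplicialComplex ℝ Plane) : Prop where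
  /-- there are finitely many vertices, edges and triangles -/
  finite : K.faces.Finite
  /-- every vertex and every edge belongs to a triangle -/
  pure : ∀ s ∈ K.faces, ∃ t ∈ triangles K, s ⊆ t
  /-- the triangles cover exactly the closure of `Ω` -/
  space_eq : K.space = closure Ω
  /-- one can go from any triangle at a vertex `z` to any other triangle at `z`, passing through
  triangles at `z`, each of which shares with the next one an edge that emanates from `z` -/
  star_connected : ∀ z ∈ K.vertices, ∀ s ∈ triangles K, ∀ t ∈ triangles K, z ∈ s → z ∈ t →
    Relation.ReflTransGen
      (fun a b : Finset Plane => a ∈ triangles K ∧ b ∈ triangles K ∧ z ∈ a ∧ z ∈ b ∧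
        ∃ w, w ≠ z ∧ w ∈ a ∧ w ∈ b) s t

/-! ### The Powell-Sabin split -/

open Classical in
/-- The incenter of the triangle with vertex set `t`: the mean of the vertices, each vertex weighted
by the length of the opposite side (which is the diameter of the set of the other two vertices). -/
def incenter (t : Finset Plane) : Plane :=
  t.centerMass (fun a => Metric.diam ((t.erase a : Finset Plane) : Set Plane)) id

/-- `p` is the point at which the edge of the macro-mesh with endpoints `a` and `b` is split: the
midpoint if the edge is exterior (lies on the boundary of `Ω`); otherwise the point at which the
edge is met by the segment between the incenters of the two adjacent triangles. -/
def IsSplitPoint (Ω : Set Plane) (K : Geometry.SimplicialComplex ℝ Plane) (a b p : Plane) : Prop :=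
  (segment ℝ a b ⊆ frontier Ω ∧ p = midpoint ℝ a b) ∨
  (¬ segment ℝ a b ⊆ frontier Ω ∧ ∃ s ∈ triangles K, ∃ t ∈ triangles K, s ≠ t ∧
    a ∈ s ∧ b ∈ s ∧ a ∈ t ∧ b ∈ t ∧
    p ∈ segment ℝ a b ∧ p ∈ segment ℝ (incenter s) (incenter t))

/-- The (closed) triangles of the Powell-Sabin mesh: every triangle `t` of the macro-mesh is divided
into the six triangles whose vertices are the incenter of `t`, a vertex `a` of `t`, and the split
point of an edge of `t` that has `a` as one endpoint. -/
def fineTriangles (Ω : Set Plane) (K : Geometry.SimplicialComplex ℝ Plane) : Set (Set Plane) :=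
  {T | ∃ t ∈ triangles K, ∃ a ∈ t, ∃ b ∈ t, a ≠ b ∧ ∃ p, IsSplitPoint Ω K a b p ∧
    T = convexHull ℝ {incenter t, a, p}}

/-! ### Solenoidal fields in `H¹` -/

/-- Smooth functions with compact support in `Ω`. -/
structure IsTestFunction (Ω : Set Plane) (φ : Plane → ℝ) : Prop where
  smooth : ContDiff ℝ ∞ φ
  compact : HasCompactSupport φ
  support : tsupport φ ⊆ Ω

/-- The `j`-th partial derivative. -/
def partialDeriv (j : Fin 2) (φ : Plane → ℝ) (x : Plane) : ℝ :=
  fderiv ℝ φ x (EuclideanSpace.single j 1)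

/-- `g` is a weak `j`-th partial derivative of `f` on `Ω`. -/
def HasWeakPartial (Ω : Set Plane) (j : Fin 2) (f g : Plane → ℝ) : Prop :=
  ∀ φ : Plane → ℝ, IsTestFunction Ω φ →
    ∫ x in Ω, f x * partialDeriv j φ x = - ∫ x in Ω, g x * φ x

/-- `v` is in `H¹(Ω)²`, with weak partial derivatives `∂ⱼ vᵢ = G i j`. -/
structure HasH1Gradient (Ω : Set Plane) (v : Plane → Plane) (G : Fin 2 → Fin 2 → Plane → ℝ) :
    Prop where
  memLp : ∀ i, MemLp (fun x => v x i) 2 (volume.restrict Ω)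
  memLp_grad : ∀ i j, MemLp (G i j) 2 (volume.restrict Ω)
  weak : ∀ i j, HasWeakPartial Ω j (fun x => v x i) (G i j)

/-- `v` is in `H¹(Ω)²` and its divergence vanishes on `Ω`. -/
def IsSolenoidal (Ω : Set Plane) (v : Plane → Plane) : Prop :=
  ∃ G, HasH1Gradient Ω v G ∧ ∀ᵐ x ∂(volume.restrict Ω), ∑ i, G i i x = 0

lemma IsTestFunction.memLp {Ω : Set Plane} {φ : Plane → ℝ} (h : IsTestFunction Ω φ) :
    MemLp φ 2 (volume.restrict Ω) :=
  (h.smooth.continuous.memLp_of_hasCompactSupport h.compact).restrict Ω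

lemma IsTestFunction.memLp_partialDeriv {Ω : Set Plane} {φ : Plane → ℝ} (h : IsTestFunction Ω φ)
    (j : Fin 2) : MemLp (partialDeriv j φ) 2 (volume.restrict Ω) := by
  refine (Continuous.memLp_of_hasCompactSupport ?_ ?_).restrict Ω
  · exact (h.smooth.continuous_fderiv (by simp)).clm_apply continuous_const
  · exact h.compact.fderiv_apply ℝ _

lemma HasWeakPartial.add {Ω : Set Plane} {j : Fin 2} {f₁ f₂ g₁ g₂ : Plane → ℝ}
    (h₁ : HasWeakPartial Ω j f₁ g₁) (h₂ : HasWeakPartial Ω j f₂ g₂)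
    (hf₁ : MemLp f₁ 2 (volume.restrict Ω)) (hf₂ : MemLp f₂ 2 (volume.restrict Ω))
    (hg₁ : MemLp g₁ 2 (volume.restrict Ω)) (hg₂ : MemLp g₂ 2 (volume.restrict Ω)) :
    HasWeakPartial Ω j (f₁ + f₂) (g₁ + g₂) := by
  intro φ hφ
  have hd := hφ.memLp_partialDeriv j
  simp only [Pi.add_apply, add_mul]
  have e₁ : Integrable (fun x => f₁ x * partialDeriv j φ x) (volume.restrict Ω) :=
    hf₁.integrable_mul hd
  have e₂ : Integrable (fun x => f₂ x * partialDeriv j φ x) (volume.restrict Ω) :=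
    hf₂.integrable_mul hd
  have e₃ : Integrable (fun x => g₁ x * φ x) (volume.restrict Ω) := hg₁.integrable_mul hφ.memLp
  have e₄ : Integrable (fun x => g₂ x * φ x) (volume.restrict Ω) := hg₂.integrable_mul hφ.memLp
  rw [integral_add e₁ e₂, integral_add e₃ e₄, h₁ φ hφ, h₂ φ hφ]
  ring

lemma HasWeakPartial.smul {Ω : Set Plane} {j : Fin 2} {f g : Plane → ℝ} (c : ℝ)
    (h : HasWeakPartial Ω j f g) : HasWeakPartial Ω j (c • f) (c • g) := by
  intro φ hφ
  simp only [Pi.smul_apply, smul_eq_mul, mul_assoc]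
  rw [integral_const_mul, integral_const_mul, h φ hφ]
  ring

/-- The space of divergence-free fields in `H¹(Ω)²`. -/
def solenoidal (Ω : Set Plane) : Submodule ℝ (Plane → Plane) where
  carrier := {v | IsSolenoidal Ω v}
  zero_mem' := by
    refine ⟨0, ⟨fun i => ?_, fun i j => ?_, fun i j φ hφ => ?_⟩, ?_⟩
    · simp
    · exact MemLp.zero
    · simp
    · simp
  add_mem' := by
    rintro v w ⟨G, hG, hG0⟩ ⟨H, hH, hH0⟩
    refine ⟨G + H, ⟨fun i => ?_, fun i j => ?_, fun i j => ?_⟩, ?_⟩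
    · exact (hG.memLp i).add (hH.memLp i)
    · exact (hG.memLp_grad i j).add (hH.memLp_grad i j)
    · exact (hG.weak i j).add (hH.weak i j) (hG.memLp i) (hH.memLp i) (hG.memLp_grad i j)
        (hH.memLp_grad i j)
    · filter_upwards [hG0, hH0] with x h₁ h₂
      simp only [Pi.add_apply, Finset.sum_add_distrib, h₁, h₂, add_zero]
  smul_mem' := by
    rintro c v ⟨G, hG, hG0⟩
    refine ⟨c • G, ⟨fun i => ?_, fun i j => ?_, fun i j => ?_⟩, ?_⟩
    · exact (hG.memLp i).const_smul c
    · exact (hG.memLp_grad i j).const_smul c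
    · exact (hG.weak i j).smul c
    · filter_upwards [hG0] with x h
      simp only [Pi.smul_apply, smul_eq_mul, ← Finset.mul_sum, h, mul_zero]

/-! ### The discrete spaces

A function on the closure of `Ω` is represented by its extension by zero to the plane. -/

/-- Continuous vector fields on the closure of `Ω` that are affine (polynomial of order at most one)
on each triangle of the Powell-Sabin mesh. -/
def Xh (Ω : Set Plane) (K : Geometry.SimplicialComplex ℝ Plane) :
    Submodule ℝ (Plane → Plane) where
  carrier := {v | ContinuousOn v (closure Ω) ∧ (∀ x, x ∉ closure Ω → v x = 0) ∧
    ∀ T ∈ fineTriangles Ω K, ∃ f : Plane →ᵃ[ℝ] Plane, EqOn v f T}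
  zero_mem' := ⟨continuousOn_const, fun _ _ => rfl, fun _ _ => ⟨0, fun _ _ => rfl⟩⟩
  add_mem' := by
    rintro v w ⟨hv, hv0, hvT⟩ ⟨hw, hw0, hwT⟩
    refine ⟨hv.add hw, fun x hx => by simp [hv0 x hx, hw0 x hx], fun T hT => ?_⟩
    obtain ⟨f, hf⟩ := hvT T hT
    obtain ⟨g, hg⟩ := hwT T hT
    exact ⟨f + g, fun x hx => by simp [hf hx, hg hx]⟩
  smul_mem' := by
    rintro c v ⟨hv, hv0, hvT⟩
    refine ⟨hv.const_smul c, fun x hx => by simp [hv0 x hx], fun T hT => ?_⟩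
    obtain ⟨f, hf⟩ := hvT T hT
    exact ⟨c • f, fun x hx => by simp [hf hx]⟩

/-- The discrete solenoidal space `V_h`. -/
def Vh (Ω : Set Plane) (K : Geometry.SimplicialComplex ℝ Plane) : Submodule ℝ (Plane → Plane) :=
  Xh Ω K ⊓ solenoidal Ω

/-- The subspace `V_h^0` of the functions in `V_h` that vanish on the boundary of `Ω`. -/
def Vh0 (Ω : Set Plane) (K : Geometry.SimplicialComplex ℝ Plane) :
    Submodule ℝ (Plane → Plane) where
  carrier := {v | v ∈ Vh Ω K ∧ ∀ x ∈ frontier Ω, v x = 0}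
  zero_mem' := ⟨zero_mem _, fun _ _ => rfl⟩
  add_mem' := by
    rintro v w ⟨hv, hv0⟩ ⟨hw, hw0⟩
    exact ⟨add_mem hv hw, fun x hx => by simp [hv0 x hx, hw0 x hx]⟩
  smul_mem' := by
    rintro c v ⟨hv, hv0⟩
    exact ⟨Submodule.smul_mem _ c hv, fun x hx => by simp [hv0 x hx]⟩

/-! ### The local functions -/

/-- Counter-clockwise rotation by a right angle. -/
def rot (y : Plane) : Plane := !₂[-y 1, y 0]

/-- The integral of `v · n` with respect to arc length over the segment from `z` to `w`, where `n` is
the unit normal that points in the direction of counter-clockwise rotation around `z`. In the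
parametrization `t ↦ z + t (w - z)`, `n ds` is `rot (w - z) dt`. -/
def flux (v : Plane → Plane) (z w : Plane) : ℝ :=
  ∫ t in (0 : ℝ)..1, inner ℝ (v (AffineMap.lineMap z w t)) (rot (w - z))

/-- The functions in `V_h` that are supported in the triangles of the macro-mesh at `z`, and vanish on
the sides of these triangles opposite to `z`; that is, they vanish on every (closed) triangle, edge
and vertex of the macro-mesh that does not contain `z`. -/
def IsSupportedAt (Ω : Set Plane) (K : Geometry.SimplicialComplex ℝ Plane) (z : Plane)
    (v : Plane → Plane) : Prop :=
  v ∈ Vh Ω K ∧ ∀ s ∈ K.faces, z ∉ s → ∀ x ∈ convexHull ℝ (s : Set Plane), v x = 0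

/-- The conditions that define the three local functions at a vertex `z` (`i = 0, 1, 2`): the value at
`z` is `(1,0)`, `(0,1)`, `(0,0)`, and the flux through every edge at `z`, in the direction of
counter-clockwise rotation around `z`, is `0`, `0`, `1`, respectively. -/
structure IsLocalFunction (Ω : Set Plane) (K : Geometry.SimplicialComplex ℝ Plane) (z : Plane)
    (i : Fin 3) (v : Plane → Plane) : Prop where
  supported : IsSupportedAt Ω K z v
  value : v z = (![!₂[1, 0], !₂[0, 1], !₂[0, 0]] : Fin 3 → Plane) i
  flux_eq : ∀ e ∈ K.faces, e.card = 2 → z ∈ e → ∀ w ∈ e, w ≠ z →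
    flux v z w = (![0, 0, 1] : Fin 3 → ℝ) i

/-- The family `b` is a basis of the subspace `W`. -/
def IsBasisOf {ι : Type*} (b : ι → Plane → Plane) (W : Submodule ℝ (Plane → Plane)) : Prop :=
  LinearIndependent ℝ b ∧ Submodule.span ℝ (range b) = W

end PowellSabin

end

noncomputable section

namespace PowellSabin

/-! ### Planar linear algebra -/

/-! A field in `Vh` amounts to its values at the vertices together with a potential of its fluxes: a
function ψ on the vertices, unique up to a constant, such that the flux through the edge from a to b
is ψ a - ψ b. The first two local functions at z have the unit vectors as values at z and zero
potential; the third has zero values and the indicator of z as potential. So the coefficients of a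
combination are exactly the vertex values and the potential, and dropping the third function at z₀
is the normalization ψ z₀ = 0.

Local part. At a split point p of a triangle with incenter c, zero divergence on the two adjacent
parts is equivalent to two scalar equations (`nodalDivFree_iff`): the deviation of v p from the
interpolated end values is parallel to c - p, and the component of v c normal to the edge is
prescribed. The first equation and the flux determine v p. The three equations for v c in the plane
are compatible exactly when the fluxes around the triangle add up to zero (`sum_edgeFlux_eq`). As p
is collinear with the incenters on both sides of a shared edge, the two triangles impose the same
condition on v p (`exists_isEdgeValue`), so local solutions glue (`exists_mem_Vh`). A continuous
piecewise affine field has its piecewise gradient as weak gradient (`hasWeakPartial_of_piecewise`),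
so the glued field is solenoidal.

Global part. By the discrete divergence theorem the fluxes form a cocycle on the macro-mesh. On a
simply connected domain every cocycle is a coboundary (`exists_potential`): an integer cocycle
defines a map to the circle, which lifts to the line, and a real cocycle is a finite combination of
integer ones. Connectedness makes the potential unique up to a constant
(`IsMacroMesh.eq_of_edge_eq`).

For `Vh0`, a field that vanishes on the boundary has no flux through exterior edges, so its
potential is constant along them. The exterior edges form a connected graph
(`exterior_edges_connected`): a component would be a cycle, hence the boundary of a chain of
triangles, whose coefficients must all be equal. Thus ψ = ψ z₀ = 0 at all boundary vertices, and
only interior vertices contribute. -/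

/-- The determinant of two plane vectors. -/
def cross (x y : Plane) : ℝ := x 0 * y 1 - x 1 * y 0

lemma inner_rot (x y : Plane) : inner ℝ x (rot y) = cross y x := by
  simp [PiLp.inner_apply, rot, cross, Fin.sum_univ_two]
  ring

lemma cross_add_left (x y z : Plane) : cross (x + y) z = cross x z + cross y z := by
  simp [cross]; ring

lemma cross_add_right (x y z : Plane) : cross x (y + z) = cross x y + cross x z := by
  simp [cross]; ring

lemma cross_sub_left (x y z : Plane) : cross (x - y) z = cross x z - cross y z := by
  simp [cross]; ring

lemma cross_sub_right (x y z : Plane) : cross x (y - z) = cross x y - cross x z := by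
  simp [cross]; ring

lemma cross_smul_left (c : ℝ) (x y : Plane) : cross (c • x) y = c * cross x y := by
  simp [cross]; ring

lemma cross_smul_right (c : ℝ) (x y : Plane) : cross x (c • y) = c * cross x y := by
  simp [cross]; ring

lemma cross_self (x : Plane) : cross x x = 0 := by
  simp [cross]; ring

lemma cross_comm (x y : Plane) : cross x y = - cross y x := by
  simp [cross]; ring

@[simp] lemma cross_zero_left (x : Plane) : cross 0 x = 0 := by simp [cross]

@[simp] lemma cross_zero_right (x : Plane) : cross x 0 = 0 := by simp [cross]

lemma eq_zero_of_cross {x y z : Plane} (h : cross x y ≠ 0) (hx : cross x z = 0)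
    (hy : cross y z = 0) : z = 0 := by
  have h0 : cross x y * z 0 = 0 := by
    simp only [cross] at *
    linear_combination y 0 * hx - x 0 * hy
  have h1 : cross x y * z 1 = 0 := by
    simp only [cross] at *
    linear_combination y 1 * hx - x 1 * hy
  ext i
  fin_cases i
  · simpa [h] using h0
  · simpa [h] using h1

lemma exists_cross_eq {x y : Plane} (h : cross x y ≠ 0) (r s : ℝ) :
    ∃ z, cross x z = r ∧ cross y z = s := by
  refine ⟨(r / cross x y) • y - (s / cross x y) • x, ?_, ?_⟩
  · rw [cross_sub_right, cross_smul_right, cross_smul_right, cross_self]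
    field_simp
    ring
  · rw [cross_sub_right, cross_smul_right, cross_smul_right, cross_self, cross_comm y x]
    field_simp
    ring

/-- The divergence of an affine field. -/
def divg (g : Plane →ᵃ[ℝ] Plane) : ℝ := ∑ i, g.linear (EuclideanSpace.single i 1) i

/-- This is the derivative at t = 0 of det (1 + tA) det (x, y), with A the linear part. It expresses
the divergence through differences of nodal values along two sides of a triangle. -/
lemma divg_mul_cross (g : Plane →ᵃ[ℝ] Plane) (x y : Plane) :
    divg g * cross x y = cross (g.linear x) y + cross x (g.linear y) := by
  have key : ∀ x : Plane, g.linear x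
      = x 0 • g.linear (EuclideanSpace.single 0 1) + x 1 • g.linear (EuclideanSpace.single 1 1) := by
    intro x
    rw [← map_smul, ← map_smul, ← map_add]
    congr 1
    ext i
    fin_cases i <;> simp
  rw [key x, key y]
  simp only [divg, Fin.sum_univ_two, cross, PiLp.add_apply, PiLp.smul_apply, smul_eq_mul]
  ring

lemma divg_mul_cross_sub (g : Plane →ᵃ[ℝ] Plane) (p q r : Plane) :
    divg g * cross (q - p) (r - p) =
      cross (g q - g p) (r - p) + cross (q - p) (g r - g p) := by
  rw [divg_mul_cross]
  simp only [← vsub_eq_sub, AffineMap.linearMap_vsub]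

/-- The field `x ↦ l x • u`. -/
def affineSMul (l : Plane →ᵃ[ℝ] ℝ) (u : Plane) : Plane →ᵃ[ℝ] Plane :=
  (LinearMap.toSpanSingleton ℝ Plane u).toAffineMap.comp l

@[simp] lemma affineSMul_apply (l : Plane →ᵃ[ℝ] ℝ) (u x : Plane) :
    affineSMul l u x = l x • u := rfl

/-! ### Barycentric coordinates -/

lemma sum_coord (b : AffineBasis (Fin 3) ℝ Plane) (x : Plane) :
    b.coord 0 x + b.coord 1 x + b.coord 2 x = 1 := by
  have h := b.sum_coord_apply_eq_one x
  rwa [Fin.sum_univ_three] at h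

lemma coord_combination (b : AffineBasis (Fin 3) ℝ Plane) (x : Plane) :
    x = b.coord 0 x • b 0 + b.coord 1 x • b 1 + b.coord 2 x • b 2 := by
  have h := b.linear_combination_coord_eq_self x
  rw [Fin.sum_univ_three] at h
  exact h.symm

/-- Twice the signed area. -/
def area2 (b : AffineBasis (Fin 3) ℝ Plane) : ℝ := cross (b 1 - b 0) (b 2 - b 0)

/-- A barycentric coordinate is a ratio of signed areas. Indices wrap around in `Fin 3`, so `k + 1`,
`k + 2` are the ends of the edge opposite to `k` in cyclic order; this convention is kept
throughout. -/
lemma coord_mul_area2 (b : AffineBasis (Fin 3) ℝ Plane) (k : Fin 3) (x : Plane) :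
    b.coord k x * area2 b = cross (b (k + 2) - b (k + 1)) (x - b (k + 1)) := by
  have h := sum_coord b x
  have hx := coord_combination b x
  have h0 : x 0 = b.coord 0 x * b 0 0 + b.coord 1 x * b 1 0 + b.coord 2 x * b 2 0 := by
    conv_lhs => rw [hx]
    simp
  have h1 : x 1 = b.coord 0 x * b 0 1 + b.coord 1 x * b 1 1 + b.coord 2 x * b 2 1 := by
    conv_lhs => rw [hx]
    simp
  have h2 : b.coord 2 x = 1 - b.coord 0 x - b.coord 1 x := by linarith
  fin_cases k
  · change b.coord 0 x * area2 b = cross (b 2 - b 1) (x - b 1)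
    simp only [area2, cross, PiLp.sub_apply, h0, h1, h2]
    ring
  · change b.coord 1 x * area2 b = cross (b 0 - b 2) (x - b 2)
    simp only [area2, cross, PiLp.sub_apply, h0, h1, h2]
    ring
  · change b.coord 2 x * area2 b = cross (b 1 - b 0) (x - b 0)
    simp only [area2, cross, PiLp.sub_apply, h0, h1, h2]
    ring

lemma area2_ne_zero (b : AffineBasis (Fin 3) ℝ Plane) : area2 b ≠ 0 := by
  intro h
  have key : ∀ x, cross (b 2 - b 1) (x - b 1) = 0 := fun x => by
    have := coord_mul_area2 b 0 x
    rw [h, mul_zero] at this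
    simpa using this.symm
  have h0 := key (b 1 + EuclideanSpace.single 0 1)
  have h1 := key (b 1 + EuclideanSpace.single 1 1)
  have : b 2 = b 1 := by
    simp [cross] at h0 h1
    ext i
    fin_cases i
    · simp only [Fin.zero_eta]; linarith
    · simp only [Fin.mk_one]; linarith
  exact absurd (b.ind.injective this) (by decide)

/-! ### The split of a single triangle -/

lemma affineMap_combination {F : Type*} [AddCommGroup F] [Module ℝ F] (g : Plane →ᵃ[ℝ] F)
    {α β γ : ℝ} (h : α + β + γ = 1) (p q r : Plane) :
    g (α • p + β • q + γ • r) = α • g p + β • g q + γ • g r := by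
  obtain rfl : α = 1 - β - γ := by linarith
  have hd : ∀ x, g x = g.linear x + g 0 := fun x => congrFun g.decomp x
  rw [hd (_ + _), hd p, hd q, hd r]
  simp only [map_add, map_smul]
  module

lemma mem_convexHull_triple {p q r x : Plane} : x ∈ convexHull ℝ {p, q, r} ↔
    ∃ α β γ : ℝ, 0 ≤ α ∧ 0 ≤ β ∧ 0 ≤ γ ∧ α + β + γ = 1 ∧ x = α • p + β • q + γ • r := by
  constructor
  · intro hx
    rw [convexHull_insert (by simp), convexHull_pair] at hx
    simp only [convexJoin_singleton_left, mem_iUnion] at hx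
    obtain ⟨y, hy, hx⟩ := hx
    obtain ⟨a, b, ha, hb, hab, rfl⟩ := hy
    obtain ⟨c, d, hc, hd, hcd, rfl⟩ := hx
    refine ⟨c, d * a, d * b, hc, by positivity, by positivity, ?_, ?_⟩
    · rw [add_assoc, ← mul_add, hab, mul_one, hcd]
    · rw [smul_add, smul_smul, smul_smul, add_assoc]
  · rintro ⟨α, β, γ, hα, hβ, hγ, h, rfl⟩
    have := (convex_convexHull ℝ ({p, q, r} : Set Plane)).sum_mem (t := Finset.univ)
      (w := ![α, β, γ]) (z := ![p, q, r])
      (by intro i _; fin_cases i <;> simpa) (by simpa [Fin.sum_univ_three] using h)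
      (by intro i _; fin_cases i <;> exact subset_convexHull ℝ _ (by simp))
    simpa [Fin.sum_univ_three] using this

lemma eq_of_coord (b : AffineBasis (Fin 3) ℝ Plane) {x y : Plane}
    (h : ∀ i, b.coord i x = b.coord i y) : x = y := by
  rw [coord_combination b x, coord_combination b y, h, h, h]

lemma sum_fin_three {M : Type*} [AddCommMonoid M] (F : Fin 3 → M) {i j k : Fin 3} (hij : i ≠ j)
    (hik : i ≠ k) (hjk : j ≠ k) : ∑ l, F l = F i + F j + F k := by
  rw [Fin.sum_univ_three]
  fin_cases i <;> fin_cases j <;> fin_cases k <;> simp at hij hik hjk ⊢ <;> abel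

lemma eq_or_eq_or_eq {i j k : Fin 3} (hij : i ≠ j) (hik : i ≠ k) (hjk : j ≠ k) (l : Fin 3) :
    l = i ∨ l = j ∨ l = k := by
  revert hij hik hjk
  revert i j k l
  decide

lemma exists_ne_ne (k : Fin 3) : ∃ i j : Fin 3, i ≠ j ∧ i ≠ k ∧ j ≠ k := by
  revert k; decide

lemma exists_third {i k : Fin 3} (h : i ≠ k) : ∃ j : Fin 3, i ≠ j ∧ j ≠ k := by
  revert i k; decide

lemma succ_eq_or {i j k : Fin 3} (hij : i ≠ j) (hik : i ≠ k) (hjk : j ≠ k) :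
    (k + 1 = i ∧ k + 2 = j) ∨ (k + 1 = j ∧ k + 2 = i) := by
  revert i j k; decide

lemma eq_succ_or {k l : Fin 3} (h : l ≠ k) : l = k + 1 ∨ l = k + 2 := by
  revert k l; decide

lemma eq_zero_or (k : Fin 3) : k = 0 ∨ k = 1 ∨ k = 2 := by
  revert k; decide

/-- The part of the triangle spanned by the inner point, a vertex, and a point of an edge at this
vertex, in terms of barycentric coordinates. -/
lemma mem_micro_iff (b : AffineBasis (Fin 3) ℝ Plane) {c p : Plane} {i j k : Fin 3} (hij : i ≠ j)
    (hik : i ≠ k) (hjk : j ≠ k) (hc : ∀ l, 0 < b.coord l c) (hpk : b.coord k p = 0)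
    (hpi : 0 < b.coord i p) (hpj : 0 < b.coord j p) (x : Plane) :
    x ∈ convexHull ℝ {c, b i, p} ↔
      0 ≤ b.coord k x ∧ 0 ≤ b.coord j x * b.coord k c - b.coord j c * b.coord k x ∧
      (b.coord j x * b.coord k c - b.coord j c * b.coord k x) * b.coord i p ≤
      (b.coord i x * b.coord k c - b.coord i c * b.coord k x) * b.coord j p := by
  have hk := hc k
  have hpsum : b.coord i p + b.coord j p = 1 := by
    have := b.sum_coord_apply_eq_one p
    rw [sum_fin_three _ hij hik hjk, hpk] at this
    linarith
  have hcsum : b.coord i c + b.coord j c + b.coord k c = 1 := by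
    have := b.sum_coord_apply_eq_one c
    rwa [sum_fin_three _ hij hik hjk] at this
  have hxsum : b.coord i x + b.coord j x + b.coord k x = 1 := by
    have := b.sum_coord_apply_eq_one x
    rwa [sum_fin_three _ hij hik hjk] at this
  rw [mem_convexHull_triple]
  constructor
  · rintro ⟨α, β, γ, hα, hβ, hγ, h, rfl⟩
    simp only [affineMap_combination _ h, hpk, smul_eq_mul, AffineBasis.coord_apply_ne _ hik.symm,
      AffineBasis.coord_apply_ne _ hij.symm, AffineBasis.coord_apply_eq]
    refine ⟨by simp; positivity, ?_, ?_⟩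
    · have : 0 ≤ γ * b.coord j p * b.coord k c := by positivity
      linarith
    · have : 0 ≤ β * (b.coord k c * b.coord j p) := by positivity
      linarith
  · rintro ⟨h1, h2, h3⟩
    -- Coordinates `k` and `j` of `x = α c + β b i + γ p` determine `α` and then `γ`. Up to positive
    -- factors, the three inequalities are `0 ≤ α`, `0 ≤ γ` and `0 ≤ β`.
    set γ := (b.coord j x * b.coord k c - b.coord j c * b.coord k x) / (b.coord k c * b.coord j p)
      with hγ
    set α := b.coord k x / b.coord k c with hα
    have eα : b.coord k x = α * b.coord k c := by rw [hα]; field_simp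
    have eγ : b.coord j x = α * b.coord j c + γ * b.coord j p := by
      rw [hα, hγ]; field_simp; ring
    have hβ : 0 ≤ 1 - α - γ := by
      have e : (1 - α - γ) * (b.coord k c * b.coord j p) =
        (b.coord i x * b.coord k c - b.coord i c * b.coord k x) * b.coord j p -
        (b.coord j x * b.coord k c - b.coord j c * b.coord k x) * b.coord i p := by
        have e1 : b.coord i x = 1 - b.coord j x - b.coord k x := by linarith
        have e2 : b.coord i c = 1 - b.coord j c - b.coord k c := by linarith
        have e3 : b.coord i p = 1 - b.coord j p := by linarith
        rw [e1, e2, e3, eγ, eα]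
        ring
      have : 0 ≤ (1 - α - γ) * (b.coord k c * b.coord j p) := by linarith
      exact nonneg_of_mul_nonneg_left this (by positivity)
    refine ⟨α, 1 - α - γ, γ, by positivity, hβ, by positivity, by ring, ?_⟩
    refine eq_of_coord b fun l => ?_
    rw [affineMap_combination _ (by ring)]
    rcases eq_or_eq_or_eq hij hik hjk l with rfl | rfl | rfl
    · simp only [smul_eq_mul, AffineBasis.coord_apply_eq]
      have e1 : b.coord l x = 1 - b.coord j x - b.coord k x := by linarith
      have e2 : b.coord l c = 1 - b.coord j c - b.coord k c := by linarith
      have e3 : b.coord l p = 1 - b.coord j p := by linarith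
      rw [e1, e2, e3, eγ, eα]
      ring
    · simp only [smul_eq_mul, AffineBasis.coord_apply_ne _ hij.symm]
      rw [eγ]; ring
    · simp only [smul_eq_mul, AffineBasis.coord_apply_ne _ hik.symm, hpk]
      rw [eα]; ring

/-- The six parts cover the triangle. -/
lemma exists_mem_micro (b : AffineBasis (Fin 3) ℝ Plane) {c : Plane} {p : Fin 3 → Plane}
    (hc : ∀ l, 0 < b.coord l c) (hp0 : ∀ k, b.coord k (p k) = 0)
    (hp : ∀ k l, l ≠ k → 0 < b.coord l (p k)) {x : Plane} (hx : ∀ l, 0 ≤ b.coord l x) :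
    ∃ k i, i ≠ k ∧ x ∈ convexHull ℝ {c, b i, p k} := by
  -- A minimizer `k` of these ratios puts `x` in the triangle spanned by `c` and the edge opposite
  -- to `b k`; the line through `c` and `p k` then decides between its two halves.
  obtain ⟨k, hk⟩ := Finite.exists_min (fun l => b.coord l x / b.coord l c)
  have key : ∀ l, 0 ≤ b.coord l x * b.coord k c - b.coord l c * b.coord k x := fun l => by
    have := hk l
    rw [div_le_div_iff₀ (hc k) (hc l)] at this
    linarith
  obtain ⟨i, j, hij, hik, hjk⟩ := exists_ne_ne k
  rcases le_total ((b.coord j x * b.coord k c - b.coord j c * b.coord k x) * b.coord i (p k))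
    ((b.coord i x * b.coord k c - b.coord i c * b.coord k x) * b.coord j (p k)) with h | h
  · exact ⟨k, i, hik, (mem_micro_iff b hij hik hjk hc (hp0 k) (hp k i hik) (hp k j hjk) x).2
      ⟨hx k, key j, h⟩⟩
  · exact ⟨k, j, hjk, (mem_micro_iff b hij.symm hjk hik hc (hp0 k) (hp k j hjk) (hp k i hik) x).2
      ⟨hx k, key i, h⟩⟩

/-- The flux through an edge with direction `e` of a field that is affine on the two parts of the
edge, with end values `u`, `u'`, and the value `v` at the point that splits it in the ratio
`σ : 1 - σ`. -/
def edgeFlux (σ : ℝ) (u v u' e : Plane) : ℝ := cross e (σ • (u + v) + (1 - σ) • (v + u')) / 2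

/-! ### Piecewise affine interpolation on the split triangle -/

section Triangle

variable (b : AffineBasis (Fin 3) ℝ Plane) {c : Plane} {p : Fin 3 → Plane} {s : Fin 3 → ℝ}

lemma coord_split_self (hp : ∀ k, p k = AffineMap.lineMap (b (k + 1)) (b (k + 2)) (s k))
    (k : Fin 3) : b.coord k (p k) = 0 := by
  rw [hp, AffineMap.apply_lineMap, AffineBasis.coord_apply_ne _ (by revert k; decide),
    AffineBasis.coord_apply_ne _ (by revert k; decide)]
  simp

lemma coord_split_pos (hs : ∀ k, 0 < s k ∧ s k < 1)
    (hp : ∀ k, p k = AffineMap.lineMap (b (k + 1)) (b (k + 2)) (s k)) (k l : Fin 3) (hl : l ≠ k) :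
    0 < b.coord l (p k) := by
  rw [hp, AffineMap.apply_lineMap]
  rcases eq_succ_or hl with rfl | rfl
  · rw [AffineBasis.coord_apply_eq, AffineBasis.coord_apply_ne _ (by revert k; decide)]
    simp [AffineMap.lineMap_apply, (hs k).2]
  · rw [AffineBasis.coord_apply_eq, AffineBasis.coord_apply_ne _ (by revert k; decide)]
    simp [AffineMap.lineMap_apply, (hs k).1]

/-- A continuous field on the plane with prescribed values at all nodes of the split triangle that is
affine on each part. -/
lemma exists_piecewise_affine (hc : ∀ l, 0 < b.coord l c) (hp0 : ∀ k, b.coord k (p k) = 0)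
    (hp : ∀ k l, l ≠ k → 0 < b.coord l (p k)) (u v : Fin 3 → Plane) (m : Plane) :
    ∃ f : Plane → Plane, Continuous f ∧ ∀ k i, i ≠ k → ∃ g : Plane →ᵃ[ℝ] Plane,
      EqOn f g (convexHull ℝ {c, b i, p k}) ∧ g c = m ∧ g (b i) = u i ∧ g (p k) = v k := by
  -- `L` interpolates the vertex values; the values at the other nodes are corrected by hat
  -- functions.
  let L : Plane →ᵃ[ℝ] Plane := ∑ l, affineSMul (b.coord l) (u l)
  have hL : ∀ x, L x = ∑ l, b.coord l x • u l := fun x => by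
    simp only [L, Fin.sum_univ_three]; rfl
  -- On the part with vertices `c`, `b i`, `p k`, the barycentric coordinate of `p k` is `μ k j`
  -- with `j` the remaining index. On the triangle, the hat function `h k` of `p k` is the positive
  -- part of the smaller of its two candidates, and `h₀` is the hat function of `c`.
  let μ : Fin 3 → Fin 3 → Plane →ᵃ[ℝ] ℝ := fun k l =>
    (b.coord k c * b.coord l (p k))⁻¹ • (b.coord k c • b.coord l - b.coord l c • b.coord k)
  have hμ : ∀ k l x, μ k l x = (b.coord k c * b.coord l (p k))⁻¹ *
    (b.coord k c * b.coord l x - b.coord l c * b.coord k x) := fun k l x => by simp [μ]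
  let h : Fin 3 → Plane → ℝ := fun k x => max 0 (min (μ k (k + 1) x) (μ k (k + 2) x))
  let h₀ : Plane → ℝ := fun x => min (b.coord 0 x / b.coord 0 c)
    (min (b.coord 1 x / b.coord 1 c) (b.coord 2 x / b.coord 2 c))
  have hcont : ∀ g : Plane →ᵃ[ℝ] ℝ, Continuous g := fun g => g.continuous_of_finiteDimensional
  refine ⟨fun x => L x + ∑ k, h k x • (v k - L (p k)) + h₀ x • (m - L c), ?_, ?_⟩
  · have := hcont
    have hLc : Continuous L := L.continuous_of_finiteDimensional
    refine (hLc.add (continuous_finsetSum _ fun k _ => ?_)).add ?_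
    · exact (continuous_const.max ((hcont _).min (hcont _))).smul continuous_const
    · exact (((hcont _).div_const _).min (((hcont _).div_const _).min
        ((hcont _).div_const _))).smul continuous_const
  · intro k i hik
    obtain ⟨j, hij, hjk⟩ := exists_third hik
    have hck := hc k
    have hci := hc i
    have hcj := hc j
    have hpj := hp k j hjk
    have hpi := hp k i hik
    refine ⟨L + affineSMul (μ k j) (v k - L (p k)) +
      affineSMul ((b.coord k c)⁻¹ • b.coord k) (m - L c), ?_, ?_, ?_, ?_⟩
    · intro x hx
      obtain ⟨h1, h2, h3⟩ := (mem_micro_iff b hij hik hjk hc (hp0 k) hpi hpj x).1 hx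
      have h4 : 0 ≤ b.coord i x * b.coord k c - b.coord i c * b.coord k x := by
        have : 0 ≤ (b.coord i x * b.coord k c - b.coord i c * b.coord k x) * b.coord j (p k) :=
          le_trans (mul_nonneg h2 hpi.le) h3
        exact nonneg_of_mul_nonneg_left this hpj
      have e1 : μ k j x ≤ μ k i x := by
        rw [hμ, hμ, inv_mul_eq_div, inv_mul_eq_div, div_le_div_iff₀ (by positivity) (by positivity)]
        nlinarith
      have e2 : 0 ≤ μ k j x := by
        rw [hμ]
        exact mul_nonneg (by positivity) (by linarith)
      have e3 : h k x = μ k j x := by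
        rcases succ_eq_or hij hik hjk with ⟨rfl, rfl⟩ | ⟨rfl, rfl⟩
        · simp only [h]; rw [min_eq_right e1, max_eq_right e2]
        · simp only [h]; rw [min_eq_left e1, max_eq_right e2]
      -- On this part `k` minimizes the ratios of the coordinates of `x` and `c`, which makes `μ l
      -- k` nonpositive and switches off the other two hats.
      have e0 : ∀ l, l ≠ k → h l x = 0 := by
        intro l hl
        have hneg : μ l k x ≤ 0 := by
          rw [hμ]
          refine mul_nonpos_of_nonneg_of_nonpos ?_ ?_
          · have := hc l
            have := hp l k hl.symm
            positivity
          · have : l = i ∨ l = j := by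
              rcases eq_or_eq_or_eq hij hik hjk l with h | h | h
              · exact .inl h
              · exact .inr h
              · exact absurd h hl
            rcases this with rfl | rfl <;> linarith
        simp only [h]
        rcases eq_succ_or hl.symm with hkj | hkj
        · rw [← hkj]; exact max_eq_left ((min_le_left _ _).trans hneg)
        · rw [← hkj]; exact max_eq_left ((min_le_right _ _).trans hneg)
      have e5 : ∀ l, b.coord k x / b.coord k c ≤ b.coord l x / b.coord l c := by
        intro l
        rw [div_le_div_iff₀ hck (hc l)]
        rcases eq_or_eq_or_eq hij hik hjk l with rfl | rfl | rfl <;> linarith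
      have e6 : h₀ x = (b.coord k c)⁻¹ * b.coord k x := by
        rw [inv_mul_eq_div]
        refine le_antisymm ?_ (le_min (e5 _) (le_min (e5 _) (e5 _)))
        simp only [h₀]
        rcases eq_zero_or k with rfl | rfl | rfl
        · exact min_le_left _ _
        · exact (min_le_right _ _).trans (min_le_left _ _)
        · exact (min_le_right _ _).trans (min_le_right _ _)
      simp only [sum_fin_three _ hij hik hjk, e0 i hik, e0 j hjk, e3, e6]
      simp
    · simp [hμ, inv_mul_cancel₀ hck.ne', mul_comm (b.coord k c)]
    · simp [hμ, AffineBasis.coord_apply_ne _ hik.symm, AffineBasis.coord_apply_ne _ hij.symm, hL,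
        AffineBasis.coord_apply]
    · have : (b.coord k c * b.coord j (p k))⁻¹ * (b.coord k c * b.coord j (p k)) = 1 :=
        inv_mul_cancel₀ (by positivity)
      simp only [AffineMap.coe_add, Pi.add_apply, affineSMul_apply, hμ, hp0 k, mul_zero, sub_zero,
        this]
      simp [hp0 k]

end Triangle

/-! ### Divergence-free conditions on nodal values -/

section NodalValues

variable (b : AffineBasis (Fin 3) ℝ Plane) {c : Plane} {p : Fin 3 → Plane} {s : Fin 3 → ℝ}

/-- The condition on the nodal values of a field that is affine on the part with vertices `c`, `b i`,
`p k` for this field to be divergence-free there. -/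
def NodalDivFree (c : Plane) (p u v : Fin 3 → Plane) (m : Plane) (k i : Fin 3) : Prop :=
  cross (u i - v k) (c - p k) + cross (b i - p k) (m - v k) = 0

variable {b}

lemma cross_edge_ne_zero (hc : ∀ l, 0 < b.coord l c)
    (hp : ∀ k, p k = AffineMap.lineMap (b (k + 1)) (b (k + 2)) (s k)) (k : Fin 3) :
    cross (b (k + 2) - b (k + 1)) (c - p k) ≠ 0 := by
  have h1 := coord_mul_area2 b k c
  have h2 := coord_mul_area2 b k (p k)
  rw [coord_split_self b hp, zero_mul] at h2
  have : cross (b (k + 2) - b (k + 1)) (c - p k) = b.coord k c * area2 b := by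
    rw [h1]
    simp only [cross_sub_right] at h2 ⊢
    linarith
  rw [this]
  exact mul_ne_zero (hc k).ne' (area2_ne_zero b)

lemma vertex_succ_sub_split (hp : ∀ k, p k = AffineMap.lineMap (b (k + 1)) (b (k + 2)) (s k))
    (k : Fin 3) : b (k + 1) - p k = (- s k) • (b (k + 2) - b (k + 1)) := by
  rw [hp, AffineMap.lineMap_apply, vsub_eq_sub, vadd_eq_add]
  module

lemma vertex_succ_succ_sub_split
    (hp : ∀ k, p k = AffineMap.lineMap (b (k + 1)) (b (k + 2)) (s k))
    (k : Fin 3) : b (k + 2) - p k = (1 - s k) • (b (k + 2) - b (k + 1)) := by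
  rw [hp, AffineMap.lineMap_apply, vsub_eq_sub, vadd_eq_add]
  module

/-- `divg_mul_cross_sub` is applied with base point `p k`; the determinant multiplying the
divergence is nonzero because the part is nondegenerate. -/
lemma divg_eq_zero_iff (hc : ∀ l, 0 < b.coord l c) (hs : ∀ k, 0 < s k ∧ s k < 1)
    (hp : ∀ k, p k = AffineMap.lineMap (b (k + 1)) (b (k + 2)) (s k)) {k i : Fin 3} (hik : i ≠ k)
    {u v : Fin 3 → Plane} {m : Plane} {g : Plane →ᵃ[ℝ] Plane} (hgc : g c = m) (hgi : g (b i) = u i)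
    (hgk : g (p k) = v k) : divg g = 0 ↔ NodalDivFree b c p u v m k i := by
  have h := divg_mul_cross_sub g (p k) (b i) c
  rw [hgc, hgi, hgk] at h
  have hne : cross (b i - p k) (c - p k) ≠ 0 := by
    have h0 := cross_edge_ne_zero hc hp k
    have h1 : -s k ≠ 0 := (neg_neg_of_pos (hs k).1).ne
    have h2 : 1 - s k ≠ 0 := (sub_pos.2 (hs k).2).ne'
    rcases eq_succ_or hik with rfl | rfl
    · rw [vertex_succ_sub_split hp, cross_smul_left]
      exact mul_ne_zero h1 h0
    · rw [vertex_succ_succ_sub_split hp, cross_smul_left]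
      exact mul_ne_zero h2 h0
  rw [NodalDivFree, ← h]
  simp [hne]

lemma nodalDivFree_succ_iff (hp : ∀ k, p k = AffineMap.lineMap (b (k + 1)) (b (k + 2)) (s k))
    {u v : Fin 3 → Plane} {m : Plane} {k : Fin 3} : NodalDivFree b c p u v m k (k + 1) ↔
      cross (u (k + 1) - v k) (c - p k) - s k * cross (b (k + 2) - b (k + 1)) (m - v k) = 0 := by
  rw [NodalDivFree, vertex_succ_sub_split hp, cross_smul_left, neg_mul, ← sub_eq_add_neg]

lemma nodalDivFree_succ_succ_iff
    (hp : ∀ k, p k = AffineMap.lineMap (b (k + 1)) (b (k + 2)) (s k))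
    {u v : Fin 3 → Plane} {m : Plane} {k : Fin 3} : NodalDivFree b c p u v m k (k + 2) ↔
      cross (u (k + 2) - v k) (c - p k) + (1 - s k) * cross (b (k + 2) - b (k + 1)) (m - v k) = 0 := by
  rw [NodalDivFree, vertex_succ_succ_sub_split hp, cross_smul_left]

lemma succ_ne (k : Fin 3) : k + 1 ≠ k := by revert k; decide

lemma succ_succ_ne (k : Fin 3) : k + 2 ≠ k := by revert k; decide

/-- The two conditions at a split point are equivalent to a condition on the value at the split
point, and one on the value at the inner point. -/
lemma nodalDivFree_iff (hp : ∀ k, p k = AffineMap.lineMap (b (k + 1)) (b (k + 2)) (s k))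
    {u v : Fin 3 → Plane} {m : Plane} {k : Fin 3} :
    (∀ i, i ≠ k → NodalDivFree b c p u v m k i) ↔
      cross (v k - AffineMap.lineMap (u (k + 1)) (u (k + 2)) (s k)) (c - p k) = 0 ∧
      cross (b (k + 2) - b (k + 1)) (m - v k) + cross (u (k + 2) - u (k + 1)) (c - p k) = 0 := by
  have e : (∀ i, i ≠ k → NodalDivFree b c p u v m k i) ↔
      NodalDivFree b c p u v m k (k + 1) ∧ NodalDivFree b c p u v m k (k + 2) := by
    constructor
    · exact fun h => ⟨h _ (succ_ne k), h _ (succ_succ_ne k)⟩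
    · rintro ⟨h1, h2⟩ i hi
      rcases eq_succ_or hi with rfl | rfl
      · exact h1
      · exact h2
  rw [e, nodalDivFree_succ_iff hp, nodalDivFree_succ_succ_iff hp, AffineMap.lineMap_apply,
    vsub_eq_sub, vadd_eq_add]
  simp only [cross_sub_left, cross_add_left, cross_smul_left]
  -- Adding the two equations with weights `1 - s k` and `s k` eliminates `m`; subtracting them
  -- leaves `m` with coefficient one. This change of equations is invertible.
  constructor
  · rintro ⟨h1, h2⟩
    constructor
    · linear_combination (s k - 1) * h1 - s k * h2
    · linear_combination h2 - h1
  · rintro ⟨h1, h2⟩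
    constructor
    · linear_combination - s k * h2 - h1
    · linear_combination (1 - s k) * h2 - h1

/-- The sum of the conditions on the value at the inner point is a condition on the fluxes. -/
lemma sum_edgeFlux_eq (hp : ∀ k, p k = AffineMap.lineMap (b (k + 1)) (b (k + 2)) (s k))
    (u v : Fin 3 → Plane) :
    2 * ∑ k : Fin 3, edgeFlux (s k) (u (k + 1)) (v k) (u (k + 2)) (b (k + 2) - b (k + 1)) =
      ∑ k : Fin 3, (cross (b (k + 2) - b (k + 1)) (v k) - cross (u (k + 2) - u (k + 1)) (c - p k)) := by
  -- The point `c` drops out, since the increments of `u` around the triangle add up to zero; the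
  -- identity therefore holds for every `c`.
  simp only [Fin.sum_univ_three, hp, edgeFlux, AffineMap.lineMap_apply, vsub_eq_sub, vadd_eq_add,
    show (1 + 1 : Fin 3) = 2 from rfl, show (1 + 2 : Fin 3) = 0 from rfl,
    show (2 + 1 : Fin 3) = 0 from rfl, show (2 + 2 : Fin 3) = 1 from rfl, zero_add]
  simp only [cross, PiLp.sub_apply, PiLp.add_apply, PiLp.smul_apply, smul_eq_mul]
  ring

/-- The divergence theorem on a triangle: the conditions prescribe the determinants of `m` with the
three edge vectors, and these vectors add up to zero. -/
lemma sum_edgeFlux_eq_zero (hp : ∀ k, p k = AffineMap.lineMap (b (k + 1)) (b (k + 2)) (s k))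
    {u v : Fin 3 → Plane} {m : Plane} (h : ∀ k i, i ≠ k → NodalDivFree b c p u v m k i) :
    ∑ k : Fin 3, edgeFlux (s k) (u (k + 1)) (v k) (u (k + 2)) (b (k + 2) - b (k + 1)) = 0 := by
  have h' := fun k => ((nodalDivFree_iff hp).1 (h k)).2
  have e := sum_edgeFlux_eq (c := c) hp u v
  have e' : ∑ k : Fin 3, (cross (b (k + 2) - b (k + 1)) (v k)
      - cross (u (k + 2) - u (k + 1)) (c - p k)) = ∑ k : Fin 3, cross (b (k + 2) - b (k + 1)) m := by
    refine Finset.sum_congr rfl fun k _ => ?_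
    have := h' k
    rw [cross_sub_right] at this
    linarith
  have e'' : ∑ k : Fin 3, cross (b (k + 2) - b (k + 1)) m = 0 := by
    simp only [Fin.sum_univ_three,
      show (1 + 1 : Fin 3) = 2 from rfl, show (1 + 2 : Fin 3) = 0 from rfl,
      show (2 + 1 : Fin 3) = 0 from rfl, show (2 + 2 : Fin 3) = 1 from rfl, zero_add,
      cross_sub_left]
    ring
  linarith

lemma cross_edges_ne_zero (b : AffineBasis (Fin 3) ℝ Plane) : cross (b 2 - b 1) (b 0 - b 2) ≠ 0 := by
  have : cross (b 2 - b 1) (b 0 - b 2) = area2 b := by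
    simp only [area2, cross, PiLp.sub_apply]; ring
  rw [this]
  exact area2_ne_zero b

/-- Converse of the divergence theorem. Two of the three equations determine `m`, as two edge
vectors are independent; the third follows because the right-hand sides add up to zero when the
fluxes do. -/
lemma exists_inner_value (hp : ∀ k, p k = AffineMap.lineMap (b (k + 1)) (b (k + 2)) (s k))
    {u v : Fin 3 → Plane}
    (hdir : ∀ k, cross (v k - AffineMap.lineMap (u (k + 1)) (u (k + 2)) (s k)) (c - p k) = 0)
    (hflux : ∑ k : Fin 3, edgeFlux (s k) (u (k + 1)) (v k) (u (k + 2)) (b (k + 2) - b (k + 1)) = 0) :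
    ∃ m, ∀ k i, i ≠ k → NodalDivFree b c p u v m k i := by
  have e := sum_edgeFlux_eq (c := c) hp u v
  rw [hflux, mul_zero] at e
  set R : Fin 3 → ℝ := fun k => cross (b (k + 2) - b (k + 1)) (v k)
      - cross (u (k + 2) - u (k + 1)) (c - p k) with hR
  have e' : R 0 + R 1 + R 2 = 0 := by rw [e, Fin.sum_univ_three]
  obtain ⟨m, h0, h1⟩ := exists_cross_eq (cross_edges_ne_zero b) (R 0) (R 1)
  have key : ∀ k : Fin 3, cross (b (k + 2) - b (k + 1)) m = R k := by
    intro k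
    rcases eq_zero_or k with rfl | rfl | rfl
    · exact h0
    · exact h1
    · change cross (b 1 - b 0) m = R 2
      simp only [cross_sub_left] at h0 h1 ⊢
      linarith
  refine ⟨m, fun k => (nodalDivFree_iff hp).2 ⟨hdir k, ?_⟩⟩
  have := key k
  rw [cross_sub_right, this]
  simp [hR]

/-- The homogeneous case, for uniqueness: `m` has zero determinant with two independent edge
vectors. -/
lemma inner_value_eq_zero (hp : ∀ k, p k = AffineMap.lineMap (b (k + 1)) (b (k + 2)) (s k))
    {m : Plane} (h : ∀ k i, i ≠ k → NodalDivFree b c p 0 0 m k i) : m = 0 := by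
  have h' := fun k => ((nodalDivFree_iff hp).1 (h k)).2
  simp only [Pi.zero_apply, sub_zero, cross_zero_left, add_zero] at h'
  exact eq_zero_of_cross (cross_edges_ne_zero b) (h' 0) (h' 1)

/-- The local interpolation problem. -/
lemma exists_local_field (hc : ∀ l, 0 < b.coord l c) (hs : ∀ k, 0 < s k ∧ s k < 1)
    (hp : ∀ k, p k = AffineMap.lineMap (b (k + 1)) (b (k + 2)) (s k)) {u v : Fin 3 → Plane}
    (hdir : ∀ k, cross (v k - AffineMap.lineMap (u (k + 1)) (u (k + 2)) (s k)) (c - p k) = 0)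
    (hflux : ∑ k : Fin 3, edgeFlux (s k) (u (k + 1)) (v k) (u (k + 2)) (b (k + 2) - b (k + 1)) = 0) :
    ∃ f : Plane → Plane, Continuous f ∧ ∀ k i, i ≠ k → ∃ g : Plane →ᵃ[ℝ] Plane,
      EqOn f g (convexHull ℝ {c, b i, p k}) ∧ divg g = 0 ∧ g (b i) = u i ∧ g (p k) = v k := by
  obtain ⟨m, hm⟩ := exists_inner_value hp hdir hflux
  obtain ⟨f, hf, hg⟩ := exists_piecewise_affine b hc (coord_split_self b hp)
    (coord_split_pos b hs hp) u v m
  refine ⟨f, hf, fun k i hik => ?_⟩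
  obtain ⟨g, h1, h2, h3, h4⟩ := hg k i hik
  exact ⟨g, h1, (divg_eq_zero_iff hc hs hp hik h2 h3 h4).2 (hm k i hik), h3, h4⟩

end NodalValues

/-! ### Geometry of the macro-mesh -/

section Complex

variable {K : Geometry.SimplicialComplex ℝ Plane}

/-- Numbering the ends 1 and 2 makes the edge the one opposite to index 0, in agreement with the
cyclic convention for split points. -/
lemma exists_affineBasis {t : Finset Plane} (ht : t ∈ triangles K) {a b : Plane} (ha : a ∈ t)
    (hb : b ∈ t) (hab : a ≠ b) : ∃ B : AffineBasis (Fin 3) ℝ Plane,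
      range B = (t : Set Plane) ∧ B 1 = a ∧ B 2 = b := by
  classical
  obtain ⟨ht, hcard⟩ := ht
  obtain ⟨c, hc⟩ : ∃ c, c ∈ (t.erase a).erase b := by
    rw [← Finset.Nonempty, ← Finset.card_pos, Finset.card_erase_of_mem, Finset.card_erase_of_mem ha]
    · omega
    · exact Finset.mem_erase.2 ⟨hab.symm, hb⟩
  simp only [Finset.mem_erase] at hc
  obtain ⟨hcb, hca, hc⟩ := hc
  let f : Fin 3 ↪ t := ⟨![⟨c, hc⟩, ⟨a, ha⟩, ⟨b, hb⟩], by
    intro i j hij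
    fin_cases i <;> fin_cases j <;> simp_all [eq_comm]⟩
  have hind : AffineIndependent ℝ (fun i => (f i : Plane)) := (K.indep ht).comp_embedding f
  refine ⟨⟨fun i => f i, hind, ?_⟩, ?_, rfl, rfl⟩
  · rw [hind.affineSpan_eq_top_iff_card_eq_finrank_add_one]
    simp
  · have : (t : Set Plane) = (Finset.univ.image (fun i => (f i : Plane)) : Finset Plane) := by
      rw [Finset.coe_inj]
      symm
      refine Finset.eq_of_subset_of_card_le ?_ ?_
      · intro x hx
        simp only [Finset.mem_image, Finset.mem_univ, true_and] at hx
        obtain ⟨i, rfl⟩ := hx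
        exact (f i).2
      · have hinj : Function.Injective fun i => (f i : Plane) :=
          Subtype.val_injective.comp f.injective
        rw [Finset.card_image_of_injective _ hinj]
        simp [hcard]
    rw [this]
    ext x
    simp only [Finset.coe_image, Finset.coe_univ, image_univ]
    rfl

lemma exists_affineBasis' {t : Finset Plane} (ht : t ∈ triangles K) :
    ∃ B : AffineBasis (Fin 3) ℝ Plane, range B = (t : Set Plane) := by
  obtain ⟨a, ha, b, hb, hab⟩ := Finset.one_lt_card.1 (by rw [ht.2]; norm_num : 1 < t.card)
  obtain ⟨B, hB, -⟩ := exists_affineBasis ht ha hb hab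
  exact ⟨B, hB⟩

/-! ### Faces of a triangle in barycentric coordinates -/

section Basis

variable {t : Finset Plane} {B : AffineBasis (Fin 3) ℝ Plane}

lemma basis_mem (hB : range B = (t : Set Plane)) (i : Fin 3) : B i ∈ t := by
  rw [← Finset.mem_coe, ← hB]; exact mem_range_self i

lemma exists_basis_eq (hB : range B = (t : Set Plane)) {a : Plane} (ha : a ∈ t) : ∃ i, B i = a := by
  rwa [← Finset.mem_coe, ← hB] at ha

lemma basis_ne (B : AffineBasis (Fin 3) ℝ Plane) {i j : Fin 3} (h : i ≠ j) : B i ≠ B j :=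
  fun e => h (B.ind.injective e)

lemma mem_convexHull_iff_coord (hB : range B = (t : Set Plane)) {x : Plane} :
    x ∈ convexHull ℝ (t : Set Plane) ↔ ∀ i, 0 ≤ B.coord i x := by
  rw [← hB, AffineBasis.convexHull_eq_nonneg_coord]; rfl

lemma mem_interior_iff_coord (hB : range B = (t : Set Plane)) {x : Plane} :
    x ∈ interior (convexHull ℝ (t : Set Plane)) ↔ ∀ i, 0 < B.coord i x := by
  rw [← hB, AffineBasis.interior_convexHull]; rfl

lemma coord_eq_zero_of_mem {s : Set Plane} (hs : s ⊆ range B) {i : Fin 3}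
    (hi : B i ∉ s) {x : Plane} (hx : x ∈ convexHull ℝ s) : B.coord i x = 0 := by
  have hconv : Convex ℝ {y : Plane | B.coord i y = 0} :=
    (convex_singleton (0 : ℝ)).affine_preimage (B.coord i)
  refine convexHull_min (fun y hy => ?_) hconv hx
  obtain ⟨j, rfl⟩ := hs hy
  exact AffineBasis.coord_apply_ne _ (fun h => hi (h ▸ hy))

/-- This is how conformity enters: the point lies in the hull of the common vertices, so a vertex
with a positive coordinate must be common. -/
lemma mem_of_coord_pos (ht : t ∈ K.faces) (hB : range B = (t : Set Plane)) {s : Finset Plane}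
    (hs : s ∈ K.faces) {x : Plane} (hx : x ∈ convexHull ℝ (s : Set Plane))
    (hxt : x ∈ convexHull ℝ (t : Set Plane)) {i : Fin 3} (hi : 0 < B.coord i x) : B i ∈ s := by
  by_contra h
  have := K.inter_subset_convexHull hs ht ⟨hx, hxt⟩
  have h0 := coord_eq_zero_of_mem (B := B) (by rw [hB]; exact inter_subset_right)
    (fun hm => h hm.1) this
  linarith

lemma mem_openSegment_of_coord {i j k : Fin 3} (hij : i ≠ j)
    (hik : i ≠ k) (hjk : j ≠ k) {x : Plane} (hi : 0 < B.coord i x) (hj : 0 < B.coord j x)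
    (hk : B.coord k x = 0) : x ∈ openSegment ℝ (B i) (B j) := by
  have h1 := B.sum_coord_apply_eq_one x
  have h2 := B.linear_combination_coord_eq_self x
  rw [sum_fin_three _ hij hik hjk, hk] at h1 h2
  refine ⟨_, _, hi, hj, by simpa using h1, by simpa using h2⟩

lemma coord_of_mem_openSegment {i j k : Fin 3} (hij : i ≠ j)
    (hik : i ≠ k) (hjk : j ≠ k) {x : Plane} (hx : x ∈ openSegment ℝ (B i) (B j)) :
    0 < B.coord i x ∧ 0 < B.coord j x ∧ B.coord k x = 0 := by
  rw [openSegment_eq_image_lineMap] at hx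
  obtain ⟨θ, ⟨h0, h1⟩, rfl⟩ := hx
  simp only [AffineMap.apply_lineMap, AffineBasis.coord_apply_ne _ hij,
    AffineBasis.coord_apply_ne _ hij.symm, AffineBasis.coord_apply_ne _ hik.symm,
    AffineBasis.coord_apply_ne _ hjk.symm, AffineBasis.coord_apply_eq]
  simp only [AffineMap.lineMap_apply, vsub_eq_sub, vadd_eq_add, smul_eq_mul]
  refine ⟨?_, ?_, ?_⟩ <;> linarith

/-- A point of a triangle is in the interior, in the interior of an edge, or a vertex. -/
lemma mem_convexHull_cases (hB : range B = (t : Set Plane)) {x : Plane}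
    (hx : x ∈ convexHull ℝ (t : Set Plane)) :
    x ∈ interior (convexHull ℝ (t : Set Plane)) ∨
    (∃ i j k : Fin 3, i ≠ j ∧ i ≠ k ∧ j ≠ k ∧ x ∈ openSegment ℝ (B i) (B j)) ∨ ∃ i, x = B i := by
  have hnn := (mem_convexHull_iff_coord hB).1 hx
  by_cases hall : ∀ i, 0 < B.coord i x
  · exact .inl ((mem_interior_iff_coord hB).2 hall)
  push Not at hall
  obtain ⟨k, hk⟩ := hall
  have hk0 : B.coord k x = 0 := le_antisymm hk (hnn k)
  obtain ⟨i, j, hij, hik, hjk⟩ := exists_ne_ne k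
  have h1 := B.sum_coord_apply_eq_one x
  have h2 := B.linear_combination_coord_eq_self x
  rw [sum_fin_three _ hij hik hjk, hk0] at h1 h2
  rcases (hnn i).eq_or_lt with hi | hi
  · rw [← hi] at h1 h2
    have : B.coord j x = 1 := by linarith
    rw [this] at h2
    exact .inr (.inr ⟨j, by simpa using h2.symm⟩)
  rcases (hnn j).eq_or_lt with hj | hj
  · rw [← hj] at h1 h2
    have : B.coord i x = 1 := by linarith
    rw [this] at h2
    exact .inr (.inr ⟨i, by simpa using h2.symm⟩)
  · exact .inr (.inl ⟨i, j, k, hij, hik, hjk, mem_openSegment_of_coord hij hik hjk hi hj hk0⟩)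

end Basis

lemma triangle_eq {t : Finset Plane} (ht : t ∈ triangles K) {a b c : Plane} (ha : a ∈ t) (hb : b ∈ t)
    (hc : c ∈ t) (hab : a ≠ b) (hac : a ≠ c) (hbc : b ≠ c) {x : Plane} :
    x ∈ t ↔ x = a ∨ x = b ∨ x = c := by
  classical
  have h1 : ({a, b, c} : Finset Plane) ⊆ t := by
    intro y hy
    simp only [Finset.mem_insert, Finset.mem_singleton] at hy
    rcases hy with rfl | rfl | rfl <;> assumption
  have h2 := Finset.eq_of_subset_of_card_le h1
    (by rw [ht.2, Finset.card_eq_three.2 ⟨a, b, c, hab, hac, hbc, rfl⟩])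
  rw [← h2]; simp

lemma edge_mem {t : Finset Plane} (ht : t ∈ triangles K) {a b : Plane} (ha : a ∈ t) (hb : b ∈ t) :
    ({a, b} : Finset Plane) ∈ K.faces :=
  K.down_closed ht.1 (by
    intro x hx
    simp only [Finset.mem_insert, Finset.mem_singleton] at hx
    rcases hx with rfl | rfl <;> assumption) (by simp)

lemma vertex_mem {t : Finset Plane} (ht : t ∈ triangles K) {a : Plane} (ha : a ∈ t) :
    a ∈ K.vertices :=
  K.down_closed ht.1 (by simpa using ha) (by simp)

/-- The left side refers only to the edge from `B 1` to `B 2`. Hence the coordinates with index 0 in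
two triangles that share this edge can be compared by sign. -/
lemma cross_coord {B : AffineBasis (Fin 3) ℝ Plane} (x : Plane) :
    cross (B 2 - B 1) (x - B 1) = B.coord 0 x * cross (B 2 - B 1) (B 0 - B 1) := by
  have h1 := coord_mul_area2 B 0 x
  have h2 := coord_mul_area2 B 0 (B 0)
  rw [AffineBasis.coord_apply_eq, one_mul] at h2
  rw [h2] at h1
  exact h1.symm

lemma cross_vertices_ne_zero (B : AffineBasis (Fin 3) ℝ Plane) :
    cross (B 2 - B 1) (B 0 - B 1) ≠ 0 := by
  have h2 := coord_mul_area2 B 0 (B 0)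
  rw [AffineBasis.coord_apply_eq, one_mul] at h2
  exact fun h => area2_ne_zero B (h2.trans h)

lemma cross_ne_zero {t : Finset Plane} (ht : t ∈ triangles K) {a b c : Plane} (ha : a ∈ t)
    (hb : b ∈ t) (hc : c ∈ t) (hab : a ≠ b) (hac : a ≠ c) (hbc : b ≠ c) :
    cross (b - a) (c - a) ≠ 0 := by
  obtain ⟨B, hB, rfl, rfl⟩ := exists_affineBasis ht ha hb hab
  obtain ⟨i, rfl⟩ := exists_basis_eq hB hc
  have : i = 0 := by
    rcases eq_zero_or i with rfl | rfl | rfl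
    · rfl
    · exact absurd rfl hac
    · exact absurd rfl hbc
  subst this
  exact cross_vertices_ne_zero B

/-- Two triangles with a common edge lie on different sides of it. -/
lemma cross_mul_cross_neg {s t : Finset Plane} (hs : s ∈ triangles K) (ht : t ∈ triangles K)
    (hst : s ≠ t) {a b c d : Plane} (hab : a ≠ b) (has : a ∈ s) (hbs : b ∈ s) (hcs : c ∈ s)
    (hac : a ≠ c) (hbc : b ≠ c) (hat : a ∈ t) (hbt : b ∈ t) (hdt : d ∈ t) (had : a ≠ d)
    (hbd : b ≠ d) : cross (b - a) (c - a) * cross (b - a) (d - a) < 0 := by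
  by_contra hneg
  have hc0 := cross_ne_zero hs has hbs hcs hab hac hbc
  have hd0 := cross_ne_zero ht hat hbt hdt hab had hbd
  have hpos : 0 < cross (b - a) (c - a) * cross (b - a) (d - a) :=
    lt_of_le_of_ne (not_lt.1 hneg) (mul_ne_zero hc0 hd0).symm
  obtain ⟨B, hB, rfl, rfl⟩ := exists_affineBasis hs has hbs hab
  have hc : c = B 0 := by
    obtain ⟨i, rfl⟩ := exists_basis_eq hB hcs
    rcases eq_zero_or i with rfl | rfl | rfl
    · rfl
    · exact absurd rfl hac
    · exact absurd rfl hbc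
  subst hc
  have hd : 0 < B.coord 0 d := by
    rw [cross_coord d, ← mul_assoc, mul_comm _ (B.coord 0 d), mul_assoc] at hpos
    exact pos_of_mul_pos_left hpos (mul_self_nonneg _)
  have hev : ∀ l : ℝ, ∀ᶠ ε in nhdsWithin (0 : ℝ) (Ioi 0), 0 < (1 - ε) * (1 / 2) + ε * l := by
    intro l
    have : Continuous fun ε : ℝ => (1 - ε) * (1 / 2) + ε * l := by fun_prop
    refine (this.tendsto 0).mono_left nhdsWithin_le_nhds |>.eventually ?_
    refine Ioi_mem_nhds ?_
    norm_num
  obtain ⟨ε, ⟨h1, h2⟩, h3⟩ := (((hev (B.coord 1 d)).and (hev (B.coord 2 d))).and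
    (Ioo_mem_nhdsGT (show (0 : ℝ) < 1 by norm_num))).exists
  -- The midpoint of the edge, moved slightly towards `d`. It lies in `t`, and also in `s` if `d` is
  -- on the same side of the edge as the third vertex of `s`.
  set x : Plane := ((1 - ε) * (1 / 2)) • B 1 + ((1 - ε) * (1 / 2)) • B 2 + ε • d with hx
  have hsum : (1 - ε) * (1 / 2) + (1 - ε) * (1 / 2) + ε = 1 := by ring
  have hcoord : ∀ i, B.coord i x = ((1 - ε) * (1 / 2)) * B.coord i (B 1) +
      ((1 - ε) * (1 / 2)) * B.coord i (B 2) + ε * B.coord i d := fun i => by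
    rw [hx, affineMap_combination _ hsum]; rfl
  have hx0 : 0 < B.coord 0 x := by
    rw [hcoord, AffineBasis.coord_apply_ne _ (by decide), AffineBasis.coord_apply_ne _ (by decide)]
    have := mul_pos h3.1 hd
    linarith
  have hxs : x ∈ convexHull ℝ (s : Set Plane) := by
    rw [mem_convexHull_iff_coord hB]
    intro i
    rcases eq_zero_or i with rfl | rfl | rfl
    · exact hx0.le
    · rw [hcoord, AffineBasis.coord_apply_eq, AffineBasis.coord_apply_ne _ (by decide)]
      linarith
    · rw [hcoord, AffineBasis.coord_apply_eq, AffineBasis.coord_apply_ne _ (by decide)]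
      linarith
  have hxt : x ∈ convexHull ℝ (t : Set Plane) := by
    have h5 : x ∈ convexHull ℝ ({B 1, B 2, d} : Set Plane) := by
      rw [mem_convexHull_triple]
      have : 0 ≤ (1 - ε) * (1 / 2) := by linarith [h3.2]
      exact ⟨_, _, _, this, this, h3.1.le, hsum, rfl⟩
    refine convexHull_mono ?_ h5
    rintro y (rfl | rfl | rfl) <;> assumption
  -- Conformity now makes the third vertex of `s` a vertex of `t`, so the two triangles coincide.
  have hct := mem_of_coord_pos hs.1 hB ht.1 hxt hxs hx0
  have hcd : B 0 = d := by
    rcases (triangle_eq ht hat hbt hdt hab had hbd).1 hct with h | h | h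
    · exact absurd h.symm hac
    · exact absurd h.symm hbc
    · exact h
  refine hst (Finset.ext fun y => ?_)
  rw [triangle_eq hs has hbs hcs hab hac hbc, triangle_eq ht hat hbt hdt hab had hbd, hcd]

/-- The third vertex of a triangle. -/
lemma exists_third_vertex {t : Finset Plane} (ht : t ∈ triangles K) {a b : Plane} (ha : a ∈ t)
    (hb : b ∈ t) (hab : a ≠ b) : ∃ c ∈ t, a ≠ c ∧ b ≠ c := by
  obtain ⟨B, hB, rfl, rfl⟩ := exists_affineBasis ht ha hb hab
  exact ⟨B 0, basis_mem hB 0, basis_ne B (by decide), basis_ne B (by decide)⟩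

/-- An edge belongs to at most two triangles. -/
lemma eq_or_eq_of_edge {r s t : Finset Plane} (hr : r ∈ triangles K) (hs : s ∈ triangles K)
    (ht : t ∈ triangles K) (hrs : r ≠ s) {a b : Plane} (hab : a ≠ b) (har : a ∈ r) (hbr : b ∈ r)
    (has : a ∈ s) (hbs : b ∈ s) (hat : a ∈ t) (hbt : b ∈ t) : t = r ∨ t = s := by
  by_contra! h
  obtain ⟨c, hc, hac, hbc⟩ := exists_third_vertex hr har hbr hab
  obtain ⟨d, hd, had, hbd⟩ := exists_third_vertex hs has hbs hab
  obtain ⟨e, he, hae, hbe⟩ := exists_third_vertex ht hat hbt hab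
  have h1 := cross_mul_cross_neg hr hs hrs hab har hbr hc hac hbc has hbs hd had hbd
  have h2 := cross_mul_cross_neg ht hr h.1 hab hat hbt he hae hbe har hbr hc hac hbc
  have h3 := cross_mul_cross_neg ht hs h.2 hab hat hbt he hae hbe has hbs hd had hbd
  -- Three real numbers cannot have pairwise negative products.
  rcases mul_neg_iff.1 h1 with h | h <;> rcases mul_neg_iff.1 h2 with h' | h' <;>
    rcases mul_neg_iff.1 h3 with h'' | h'' <;> linarith [h.1, h.2, h'.1, h'.2, h''.1, h''.2]

variable (K) in
/-- The edge with endpoints `a` and `b` belongs to two triangles. -/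
def IsSharedEdge (a b : Plane) : Prop :=
  ∃ s ∈ triangles K, ∃ t ∈ triangles K, s ≠ t ∧ a ∈ s ∧ b ∈ s ∧ a ∈ t ∧ b ∈ t

end Complex

/-! ### Shared and exterior edges -/

section Mesh

variable {Ω : Set Plane} {K : Geometry.SimplicialComplex ℝ Plane} (hK : IsMacroMesh Ω K)
include hK

lemma IsMacroMesh.finite_triangles : (triangles K).Finite := hK.finite.subset fun _ h => h.1

lemma IsMacroMesh.mem_closure_iff {x : Plane} :
    x ∈ closure Ω ↔ ∃ t ∈ triangles K, x ∈ convexHull ℝ (t : Set Plane) := by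
  rw [← hK.space_eq, Geometry.SimplicialComplex.mem_space_iff]
  constructor
  · rintro ⟨s, hs, hx⟩
    obtain ⟨t, ht, hst⟩ := hK.pure s hs
    exact ⟨t, ht, convexHull_mono (Finset.coe_subset.2 hst) hx⟩
  · rintro ⟨t, ht, hx⟩
    exact ⟨t, ht.1, hx⟩

lemma IsMacroMesh.convexHull_subset {t : Finset Plane} (ht : t ∈ triangles K) :
    convexHull ℝ (t : Set Plane) ⊆ closure Ω :=
  fun _ hx => hK.mem_closure_iff.2 ⟨t, ht, hx⟩

lemma IsMacroMesh.interior_subset (hreg : interior (closure Ω) = Ω) {t : Finset Plane}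
    (ht : t ∈ triangles K) : interior (convexHull ℝ (t : Set Plane)) ⊆ Ω := by
  conv_rhs => rw [← hreg]
  exact interior_mono (hK.convexHull_subset ht)

/-- The two triangles lie on opposite sides of the edge, so together they cover a neighbourhood of
each point of the open edge; such a point is interior to the closure of `Ω`, which is `Ω` by
regularity. -/
lemma IsMacroMesh.openSegment_subset (hreg : interior (closure Ω) = Ω) {a b : Plane} (hab : a ≠ b)
    (h : IsSharedEdge K a b) : openSegment ℝ a b ⊆ Ω := by
  obtain ⟨s, hs, t, ht, hst, has, hbs, hat, hbt⟩ := h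
  intro x hx
  obtain ⟨B, hB, hB1, hB2⟩ := exists_affineBasis hs has hbs hab
  obtain ⟨C, hC, hC1, hC2⟩ := exists_affineBasis ht hat hbt hab
  have hneg := cross_mul_cross_neg hs ht hst hab has hbs (basis_mem hB 0)
    (hB1 ▸ basis_ne B (by decide)) (hB2 ▸ basis_ne B (by decide)) hat hbt (basis_mem hC 0)
    (hC1 ▸ basis_ne C (by decide)) (hC2 ▸ basis_ne C (by decide))
  have hBx := coord_of_mem_openSegment (B := B) (i := 1) (j := 2) (k := 0) (by decide) (by decide)
    (by decide) (by rwa [hB1, hB2])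
  have hCx := coord_of_mem_openSegment (B := C) (i := 1) (j := 2) (k := 0) (by decide) (by decide)
    (by decide) (by rwa [hC1, hC2])
  have hev : ∀ (B : AffineBasis (Fin 3) ℝ Plane) (i : Fin 3), 0 < B.coord i x →
      ∀ᶠ y in nhds x, 0 < B.coord i y := fun B i hi =>
    ((B.coord i).continuous_of_finiteDimensional.tendsto x).eventually (Ioi_mem_nhds hi)
  rw [← hreg, mem_interior_iff_mem_nhds]
  filter_upwards [hev B 1 hBx.1, hev B 2 hBx.2.1, hev C 1 hCx.1, hev C 2 hCx.2.1] with y h1 h2 h3 h4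
  rcases le_or_gt 0 (B.coord 0 y) with h0 | h0
  · refine hK.convexHull_subset hs ((mem_convexHull_iff_coord hB).2 fun i => ?_)
    rcases eq_zero_or i with rfl | rfl | rfl
    exacts [h0, h1.le, h2.le]
  · refine hK.convexHull_subset ht ((mem_convexHull_iff_coord hC).2 fun i => ?_)
    rcases eq_zero_or i with rfl | rfl | rfl
    · have e1 := cross_coord (B := B) y
      have e2 := cross_coord (B := C) y
      rw [hB1, hB2] at e1
      rw [hC1, hC2] at e2
      rw [e2] at e1
      by_contra! hlt
      rcases mul_neg_iff.1 hneg with h | h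
      · nlinarith [mul_neg_of_neg_of_pos h0 h.1, mul_pos_of_neg_of_neg hlt h.2]
      · nlinarith [mul_pos_of_neg_of_neg h0 h.1, mul_neg_of_neg_of_pos hlt h.2]
    exacts [h3.le, h4.le]

/-- If `x` were in `Ω`, points just beyond the edge would lie in some triangle. That triangle
contains `x`, hence both ends of the edge, so it is `t` itself, which lies on the other side. -/
lemma IsMacroMesh.openSegment_inter (hopen : IsOpen Ω) {a b : Plane}
    (hab : a ≠ b) {t : Finset Plane} (ht : t ∈ triangles K) (hat : a ∈ t) (hbt : b ∈ t)
    (h : ¬ IsSharedEdge K a b) {x : Plane} (hx : x ∈ openSegment ℝ a b) : x ∉ Ω := by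
  intro hxΩ
  obtain ⟨B, hB, rfl, rfl⟩ := exists_affineBasis ht hat hbt hab
  have hBx := coord_of_mem_openSegment (B := B) (i := 1) (j := 2) (k := 0) (by decide) (by decide)
    (by decide) hx
  -- The negative parameter moves away from the third vertex `B 0`, out of `t`.
  set y : ℝ → Plane := fun ε => AffineMap.lineMap x (B 0) (-ε) with hy
  have hycont : Continuous y := by
    simp only [hy, AffineMap.lineMap_apply]
    fun_prop
  have hy0 : y 0 = x := by simp [hy]
  have hev : ∀ᶠ ε in nhdsWithin (0 : ℝ) (Ioi 0), ∃ s ∈ triangles K,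
      y ε ∈ convexHull ℝ (s : Set Plane) := by
    have := (hycont.tendsto 0).mono_left (nhdsWithin_le_nhds (s := Ioi 0))
    rw [hy0] at this
    filter_upwards [this.eventually (hopen.mem_nhds hxΩ)] with ε hε
    exact hK.mem_closure_iff.1 (subset_closure hε)
  -- There are finitely many triangles, so one of them contains `y ε` for arbitrarily small positive
  -- `ε`.
  have hfreq : ∃ s ∈ triangles K, ∃ᶠ ε in nhdsWithin (0 : ℝ) (Ioi 0),
      y ε ∈ convexHull ℝ (s : Set Plane) := by
    by_contra! hcon
    have : ∀ᶠ ε in nhdsWithin (0 : ℝ) (Ioi 0), ∀ s ∈ triangles K,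
        y ε ∉ convexHull ℝ (s : Set Plane) := by
      rw [Filter.eventually_all_finite hK.finite_triangles]
      intro s hs
      simpa using hcon s hs
    obtain ⟨ε, ⟨s, hs, h1⟩, h2⟩ := (hev.and this).exists
    exact h2 s hs h1
  obtain ⟨s, hs, hfr⟩ := hfreq
  have hclosed : IsClosed (convexHull ℝ (s : Set Plane)) := s.finite_toSet.isCompact_convexHull ℝ |>.isClosed
  have hxs : x ∈ convexHull ℝ (s : Set Plane) := by
    have := (hycont.tendsto 0).mono_left (nhdsWithin_le_nhds (s := Ioi 0))
    rw [hy0] at this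
    exact hclosed.mem_of_frequently_of_tendsto hfr this
  have hxt : x ∈ convexHull ℝ (t : Set Plane) := by
    rw [mem_convexHull_iff_coord hB]
    intro i
    rcases eq_zero_or i with rfl | rfl | rfl
    exacts [hBx.2.2.ge, hBx.1.le, hBx.2.1.le]
  have h1 := mem_of_coord_pos ht.1 hB hs.1 hxs hxt hBx.1
  have h2 := mem_of_coord_pos ht.1 hB hs.1 hxs hxt hBx.2.1
  have hst : s = t := by
    by_contra hne
    exact h ⟨s, hs, t, ht, hne, h1, h2, hat, hbt⟩
  subst hst
  obtain ⟨ε, hε, hε0⟩ := (hfr.and_eventually self_mem_nhdsWithin).exists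
  have := (mem_convexHull_iff_coord hB).1 hε 0
  rw [hy] at this
  simp only [AffineMap.apply_lineMap, AffineBasis.coord_apply_eq, hBx.2.2] at this
  simp [AffineMap.lineMap_apply] at this
  linarith [show 0 < ε from hε0]

/-- Turns the topological notion of an exterior edge into a combinatorial one, on which all later
arguments rely. -/
lemma IsMacroMesh.segment_subset_frontier_iff (hopen : IsOpen Ω) (hreg : interior (closure Ω) = Ω)
    {a b : Plane} (hab : a ≠ b) {t : Finset Plane} (ht : t ∈ triangles K) (hat : a ∈ t)
    (hbt : b ∈ t) : segment ℝ a b ⊆ frontier Ω ↔ ¬ IsSharedEdge K a b := by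
  constructor
  · intro h hsh
    have hm : midpoint ℝ a b ∈ openSegment ℝ a b := by
      rw [openSegment_eq_image_lineMap]
      exact ⟨1 / 2, by norm_num, by simp [midpoint]⟩
    have h1 := hK.openSegment_subset hreg hab hsh hm
    have h2 := h (openSegment_subset_segment ℝ a b hm)
    rw [hopen.frontier_eq] at h2
    exact h2.2 h1
  · intro h
    have h1 : openSegment ℝ a b ⊆ frontier Ω := fun x hx => by
      rw [hopen.frontier_eq]
      refine ⟨hK.convexHull_subset ht ?_, hK.openSegment_inter hopen hab ht hat hbt h hx⟩
      exact segment_subset_convexHull hat hbt (openSegment_subset_segment ℝ a b hx)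
    rw [← closure_openSegment]
    exact closure_minimal h1 isClosed_frontier

end Mesh

/-! ### Incenters and split points -/

section Incenter

variable {K : Geometry.SimplicialComplex ℝ Plane} {t : Finset Plane}

lemma incenter_eq (ht : t ∈ triangles K) {a b c : Plane} (ha : a ∈ t)
    (hb : b ∈ t) (hc : c ∈ t) (hab : a ≠ b) (hac : a ≠ c) (hbc : b ≠ c) :
    incenter t = (dist b c + dist c a + dist a b)⁻¹ •
      (dist b c • a + dist c a • b + dist a b • c) := by
  classical
  have htri : ∀ x, x ∈ t ↔ x = a ∨ x = b ∨ x = c := fun x => triangle_eq ht ha hb hc hab hac hbc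
  have ht' : t = {a, b, c} := by ext x; simp [htri]
  have h1 : (t : Set Plane) \ {a} = {b, c} := by
    ext x; simp only [mem_sdiff, Finset.mem_coe, htri, mem_singleton_iff, mem_insert_iff]; grind
  have h2 : (t : Set Plane) \ {b} = {c, a} := by
    ext x; simp only [mem_sdiff, Finset.mem_coe, htri, mem_singleton_iff, mem_insert_iff]; grind
  have h3 : (t : Set Plane) \ {c} = {a, b} := by
    ext x; simp only [mem_sdiff, Finset.mem_coe, htri, mem_singleton_iff, mem_insert_iff]; grind
  have hs : ∀ {M : Type} [AddCommMonoid M] (F : Plane → M), ∑ x ∈ t, F x = F a + F b + F c := by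
    intro M _ F
    rw [ht', Finset.sum_insert (by simp [hab, hac]), Finset.sum_insert (by simp [hbc]),
      Finset.sum_singleton, add_assoc]
  simp only [incenter, Finset.centerMass, hs, Finset.coe_erase, h1, h2, h3, Metric.diam_pair, id]

lemma perimeter_pos {a b c : Plane} (hab : a ≠ b) : 0 < dist b c + dist c a + dist a b := by
  have := dist_pos.2 hab
  positivity

/-- The positive factor shows that the incenter is strictly on the same side of the edge as the
third vertex. -/
lemma cross_incenter (ht : t ∈ triangles K) {a b c : Plane} (ha : a ∈ t)
    (hb : b ∈ t) (hc : c ∈ t) (hab : a ≠ b) (hac : a ≠ c) (hbc : b ≠ c) :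
    cross (b - a) (incenter t - a) =
      dist a b / (dist b c + dist c a + dist a b) * cross (b - a) (c - a) := by
  have h := perimeter_pos (c := c) hab
  have e : incenter t - a = (dist b c + dist c a + dist a b)⁻¹ •
      (dist c a • (b - a) + dist a b • (c - a)) := by
    rw [incenter_eq ht ha hb hc hab hac hbc, eq_inv_smul_iff₀ h.ne', smul_sub,
      smul_inv_smul₀ h.ne']
    module
  rw [e, cross_smul_right, cross_add_right, cross_smul_right, cross_smul_right, cross_self]
  ring

lemma coord_incenter_pos (ht : t ∈ triangles K) {B : AffineBasis (Fin 3) ℝ Plane}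
    (hB : range B = (t : Set Plane)) (l : Fin 3) : 0 < B.coord l (incenter t) := by
  have h01 := basis_ne B (show (0 : Fin 3) ≠ 1 by decide)
  have h02 := basis_ne B (show (0 : Fin 3) ≠ 2 by decide)
  have h12 := basis_ne B (show (1 : Fin 3) ≠ 2 by decide)
  have h := perimeter_pos (c := B 2) h01
  have d01 := dist_pos.2 h01
  have d02 := dist_pos.2 h02.symm
  have d12 := dist_pos.2 h12
  rw [incenter_eq ht (basis_mem hB 0) (basis_mem hB 1) (basis_mem hB 2) h01 h02 h12, smul_add,
    smul_add, smul_smul, smul_smul, smul_smul, affineMap_combination]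
  · rcases eq_zero_or l with rfl | rfl | rfl
    · rw [AffineBasis.coord_apply_eq, AffineBasis.coord_apply_ne _ (by decide),
        AffineBasis.coord_apply_ne _ (by decide)]
      simp only [smul_eq_mul, mul_one, mul_zero, add_zero]
      positivity
    · rw [AffineBasis.coord_apply_eq, AffineBasis.coord_apply_ne _ (by decide),
        AffineBasis.coord_apply_ne _ (by decide)]
      simp only [smul_eq_mul, mul_one, mul_zero, add_zero, zero_add]
      positivity
    · rw [AffineBasis.coord_apply_eq, AffineBasis.coord_apply_ne _ (by decide),
        AffineBasis.coord_apply_ne _ (by decide)]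
      simp only [smul_eq_mul, mul_one, mul_zero, zero_add]
      positivity
  · rw [← mul_add, ← mul_add, inv_mul_cancel₀ h.ne']

lemma inner_sq_add_cross_sq (x y : Plane) : inner ℝ x y ^ 2 + cross x y ^ 2 = (‖x‖ * ‖y‖) ^ 2 := by
  have hx := real_inner_self_eq_norm_sq x
  have hy := real_inner_self_eq_norm_sq y
  rw [mul_pow, ← hx, ← hy]
  simp only [PiLp.inner_apply, Fin.sum_univ_two, cross, RCLike.inner_apply, conj_trivial]
  ring

/-- The angle at `a` between the edge and the incenter is half an angle of the triangle, hence
acute; analytically this is strict Cauchy–Schwarz. Used at both ends of a shared edge, it keeps the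
split point strictly between them. -/
lemma inner_incenter_pos (ht : t ∈ triangles K) {a b : Plane} (ha : a ∈ t)
    (hb : b ∈ t) (hab : a ≠ b) : 0 < inner ℝ (incenter t - a) (b - a) := by
  obtain ⟨c, hc, hac, hbc⟩ := exists_third_vertex ht ha hb hab
  have h := perimeter_pos (c := c) hab
  have e : incenter t - a = (dist b c + dist c a + dist a b)⁻¹ •
      (dist c a • (b - a) + dist a b • (c - a)) := by
    rw [incenter_eq ht ha hb hc hab hac hbc, eq_inv_smul_iff₀ h.ne', smul_sub,
      smul_inv_smul₀ h.ne']
    module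
  rw [e, real_inner_smul_left, inner_add_left, real_inner_smul_left, real_inner_smul_left]
  refine mul_pos (inv_pos.2 h) ?_
  have h1 := inner_sq_add_cross_sq (b - a) (c - a)
  have h2 := pow_pos (abs_pos.2 (cross_ne_zero ht ha hb hc hab hac hbc)) 2
  rw [sq_abs] at h2
  have h3 : |inner ℝ (b - a) (c - a)| < ‖b - a‖ * ‖c - a‖ :=
    abs_lt_of_sq_lt_sq (by linarith) (by positivity)
  have h4 := neg_lt_of_abs_lt h3
  rw [real_inner_self_eq_norm_sq, dist_eq_norm c a, dist_comm a b, dist_eq_norm b a,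
    real_inner_comm]
  have h5 : 0 < ‖b - a‖ := norm_pos_iff.2 (sub_ne_zero.2 hab.symm)
  nlinarith

end Incenter

lemma eq_smul_of_cross_eq_zero {e w : Plane} (he : e ≠ 0) (h : cross e w = 0) :
    w = (inner ℝ w e / inner ℝ e e) • e := by
  have hpos : inner ℝ e e ≠ 0 := by simpa using he
  have h0 : inner ℝ e e • w = inner ℝ w e • e := by
    simp only [PiLp.inner_apply, Fin.sum_univ_two, cross, RCLike.inner_apply, conj_trivial] at h ⊢
    ext i
    fin_cases i
    · simp only [Fin.zero_eta, PiLp.smul_apply, smul_eq_mul]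
      linear_combination (- e 1) * h
    · simp only [Fin.mk_one, PiLp.smul_apply, smul_eq_mul]
      linear_combination (e 0) * h
  rw [div_eq_inv_mul, mul_smul, ← h0, inv_smul_smul₀ hpos]

lemma cross_lineMap (e a x y : Plane) (τ : ℝ) : cross e (AffineMap.lineMap x y τ - a) =
    (1 - τ) * cross e (x - a) + τ * cross e (y - a) := by
  rw [AffineMap.lineMap_apply, vsub_eq_sub, vadd_eq_add]
  simp only [cross_sub_right, cross_add_right, cross_smul_right]
  ring

/-- Existence and uniqueness of the point at which an edge is split. -/
lemma exists_split {Ω : Set Plane} {K : Geometry.SimplicialComplex ℝ Plane} (hopen : IsOpen Ω)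
    (hreg : interior (closure Ω) = Ω) (hK : IsMacroMesh Ω K) {t : Finset Plane}
    (ht : t ∈ triangles K) {a b : Plane} (ha : a ∈ t) (hb : b ∈ t) (hab : a ≠ b) :
    ∃ σ : ℝ, 0 < σ ∧ σ < 1 ∧ (∀ p, IsSplitPoint Ω K a b p ↔ p = AffineMap.lineMap a b σ) ∧
      ∀ s ∈ triangles K, ∀ s' ∈ triangles K, a ∈ s → b ∈ s → a ∈ s' → b ∈ s' →
        cross (incenter s - AffineMap.lineMap a b σ) (incenter s' - AffineMap.lineMap a b σ) = 0 := by
  have hfr := hK.segment_subset_frontier_iff hopen hreg hab ht ha hb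
  by_cases hsh : IsSharedEdge K a b
  · have hnf : ¬ segment ℝ a b ⊆ frontier Ω := fun h => hfr.1 h hsh
    obtain ⟨s, hs, t, ht, hst, has, hbs, hat, hbt⟩ := hsh
    set X := incenter s with hX
    set Y := incenter t with hY
    set α := cross (b - a) (X - a) with hα
    set β := cross (b - a) (Y - a) with hβ
    have hαβ : α * β < 0 := by
      obtain ⟨c, hc, hac, hbc⟩ := exists_third_vertex hs has hbs hab
      obtain ⟨d, hd, had, hbd⟩ := exists_third_vertex ht hat hbt hab
      have h1 := cross_mul_cross_neg hs ht hst hab has hbs hc hac hbc hat hbt hd had hbd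
      rw [hα, hβ, cross_incenter hs has hbs hc hab hac hbc, cross_incenter ht hat hbt hd hab had hbd,
        mul_mul_mul_comm]
      refine mul_neg_of_pos_of_neg ?_ h1
      have := perimeter_pos (c := c) hab
      have := perimeter_pos (c := d) hab
      have := dist_pos.2 hab
      positivity
    have hne : α - β ≠ 0 := fun h => by
      rw [sub_eq_zero.1 h] at hαβ
      exact absurd hαβ (not_lt.2 (mul_self_nonneg β))
    have hτ : 0 < α / (α - β) ∧ α / (α - β) < 1 := by
      rcases mul_neg_iff.1 hαβ with ⟨h1, h2⟩ | ⟨h1, h2⟩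
      · have : 0 < α - β := by linarith
        exact ⟨by positivity, (div_lt_one this).2 (by linarith)⟩
      · have : α - β < 0 := by linarith
        exact ⟨div_pos_of_neg_of_neg h1 this, (div_lt_one_of_neg this).2 (by linarith)⟩
    -- `α` and `β` are proportional to the signed distances of the incenters from the edge, so this
    -- parameter gives the point at which the segment `XY` crosses the line of the edge.
    set p : Plane := AffineMap.lineMap X Y (α / (α - β)) with hp
    have hpc : cross (b - a) (p - a) = 0 := by
      rw [hp, cross_lineMap]
      field_simp
      ring
    have hba : b - a ≠ 0 := sub_ne_zero.2 hab.symm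
    have hpσ := eq_smul_of_cross_eq_zero hba hpc
    set σ := inner ℝ (p - a) (b - a) / inner ℝ (b - a) (b - a) with hσ
    have hpσ' : p = AffineMap.lineMap a b σ := by
      rw [AffineMap.lineMap_apply, vsub_eq_sub, vadd_eq_add, ← hpσ, sub_add_cancel]
    have hbb : 0 < inner ℝ (b - a) (b - a) := by
      rw [real_inner_self_eq_norm_sq]
      have := norm_pos_iff.2 hba
      positivity
    -- `p` is a convex combination of the incenters, so it inherits their positive inner products at
    -- `a` and at `b`; this gives `0 < σ < 1`.
    have hlm : ∀ (x e : Plane), inner ℝ (p - x) e =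
        (1 - α / (α - β)) * inner ℝ (X - x) e + α / (α - β) * inner ℝ (Y - x) e := by
      intro x e
      rw [hp, AffineMap.lineMap_apply, vsub_eq_sub, vadd_eq_add]
      simp only [inner_sub_left, inner_add_left, real_inner_smul_left]
      ring
    have h1 : 0 < inner ℝ (p - a) (b - a) := by
      rw [hlm]
      have h1 := mul_pos hτ.1 (inner_incenter_pos ht hat hbt hab)
      have h2 := mul_pos (sub_pos.2 hτ.2) (inner_incenter_pos hs has hbs hab)
      linarith
    have h2 : 0 < inner ℝ (p - b) (a - b) := by
      rw [hlm]
      have h1 := mul_pos hτ.1 (inner_incenter_pos ht hbt hat hab.symm)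
      have h2 := mul_pos (sub_pos.2 hτ.2) (inner_incenter_pos hs hbs has hab.symm)
      linarith
    have hσ0 : 0 < σ := div_pos h1 hbb
    have hσ1 : σ < 1 := by
      rw [hσ, div_lt_one hbb]
      have e : inner ℝ (p - b) (a - b) =
          inner ℝ (b - a) (b - a) - inner ℝ (p - a) (b - a) := by
        simp only [inner_sub_left, inner_sub_right]
        rw [real_inner_comm a b]
        ring
      linarith
    have hpXY : p ∈ segment ℝ X Y := by
      rw [segment_eq_image_lineMap]
      exact ⟨_, ⟨hτ.1.le, hτ.2.le⟩, rfl⟩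
    have hpab : p ∈ segment ℝ a b := by
      rw [segment_eq_image_lineMap]
      exact ⟨σ, ⟨hσ0.le, hσ1.le⟩, hpσ'.symm⟩
    have hcr : cross (X - p) (Y - p) = 0 := by
      rw [hp, AffineMap.lineMap_apply, vsub_eq_sub, vadd_eq_add]
      simp only [cross_sub_left, cross_sub_right, cross_add_left, cross_add_right,
        cross_smul_left, cross_smul_right, cross_self]
      rw [cross_comm Y X]
      ring
    refine ⟨σ, hσ0, hσ1, fun q => ⟨?_, ?_⟩, ?_⟩
    · rintro (⟨h, -⟩ | ⟨-, s', hs', t', ht', hst', has', hbs', hat', hbt', hq1, hq2⟩)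
      · exact absurd h hnf
      · have hq : q ∈ segment ℝ X Y := by
          rcases eq_or_eq_of_edge hs ht hs' hst hab has hbs hat hbt has' hbs' with rfl | rfl
          · rcases eq_or_eq_of_edge hs ht ht' hst hab has hbs hat hbt hat' hbt' with rfl | rfl
            · exact absurd rfl hst'
            · exact hq2
          · rcases eq_or_eq_of_edge hs ht ht' hst hab has hbs hat hbt hat' hbt' with rfl | rfl
            · rwa [segment_symm]
            · exact absurd rfl hst'
        rw [segment_eq_image_lineMap] at hq hq1
        obtain ⟨τ, -, rfl⟩ := hq
        obtain ⟨ρ, -, hρ⟩ := hq1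
        have e1 : cross (b - a) (AffineMap.lineMap X Y τ - a) = 0 := by
          rw [← hρ, cross_lineMap]
          simp [cross_self]
        rw [cross_lineMap, ← hα, ← hβ] at e1
        have : τ = α / (α - β) := by
          rw [eq_div_iff hne]; linarith
        rw [this, ← hp, hpσ']
    · rintro rfl
      rw [← hpσ']
      exact .inr ⟨hnf, s, hs, t, ht, hst, has, hbs, hat, hbt, hpab, hpXY⟩
    · intro r hr r' hr' har hbr har' hbr'
      rw [← hpσ']
      rcases eq_or_eq_of_edge hs ht hr hst hab has hbs hat hbt har hbr with rfl | rfl <;>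
      rcases eq_or_eq_of_edge hs ht hr' hst hab has hbs hat hbt har' hbr' with rfl | rfl
      · exact cross_self _
      · exact hcr
      · rw [cross_comm, hcr, neg_zero]
      · exact cross_self _
  · have hf := hfr.2 hsh
    refine ⟨1 / 2, by norm_num, by norm_num, fun p => ⟨?_, ?_⟩, ?_⟩
    · rintro (⟨-, rfl⟩ | ⟨h, -⟩)
      · simp [midpoint]
      · exact absurd hf h
    · rintro rfl
      exact .inl ⟨hf, by simp [midpoint]⟩
    · intro s hs s' hs' has hbs has' hbs'
      have : s = s' := by
        by_contra hne
        exact hsh ⟨s, hs, s', hs', hne, has, hbs, has', hbs'⟩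
      rw [this, cross_self]

/-! ### Weak derivatives of piecewise affine fields -/

/-- Component of an affine field, as a function with its derivative. -/
lemma hasFDerivAt_component (g : Plane →ᵃ[ℝ] Plane) (i : Fin 2) (x : Plane) :
    HasFDerivAt (fun y => g y i)
      ((EuclideanSpace.proj i : Plane →L[ℝ] ℝ).comp (LinearMap.toContinuousLinearMap g.linear)) x := by
  have h : HasFDerivAt g (LinearMap.toContinuousLinearMap g.linear) x := by
    have e : (g : Plane → Plane) = fun y => LinearMap.toContinuousLinearMap g.linear y + g 0 := by
      ext1 y
      exact congrFun g.decomp y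
    rw [e]
    exact (ContinuousLinearMap.hasFDerivAt _).add_const _
  exact (EuclideanSpace.proj i : Plane →L[ℝ] ℝ).hasFDerivAt.comp x h

lemma fderiv_component (g : Plane →ᵃ[ℝ] Plane) (i : Fin 2) (x w : Plane) :
    fderiv ℝ (fun y => g y i) x w = g.linear w i := by
  rw [(hasFDerivAt_component g i x).fderiv]
  rfl

lemma partialDeriv_eq_zero {φ : Plane → ℝ}
    {x : Plane} (hx : x ∉ tsupport φ) (j : Fin 2) : partialDeriv j φ x = 0 := by
  rw [partialDeriv, fderiv_of_notMem_tsupport ℝ hx]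
  rfl

lemma setIntegral_eq_integral_of_ae_eq {Ω : Set Plane} {f h : Plane → ℝ}
    (hfh : ∀ᵐ x ∂(volume.restrict Ω), f x = h x) (h0 : ∀ x, x ∉ Ω → h x = 0) :
    ∫ x in Ω, f x = ∫ x, h x :=
  (integral_congr_ae hfh).trans (setIntegral_eq_integral_of_forall_compl_eq_zero h0)

/-- On an open set on which a solenoidal field is affine, the divergence of the affine field
vanishes. -/
lemma divg_eq_zero_of_isSolenoidal {Ω U : Set Plane} {v : Plane → Plane} (hv : IsSolenoidal Ω v)
    (hU : IsOpen U) (hne : U.Nonempty) (hUΩ : U ⊆ Ω) {g : Plane →ᵃ[ℝ] Plane} (hg : EqOn v g U) :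
    divg g = 0 := by
  obtain ⟨G, hG, hG0⟩ := hv
  obtain ⟨x₀, hx₀⟩ := hne
  obtain ⟨r, hr, hball⟩ := Metric.isOpen_iff.1 hU x₀ hx₀
  -- Testing the weak divergence with a bump supported in `U` and integrating by parts there gives
  -- the constant divergence times the positive integral of the bump.
  let φ : ContDiffBump x₀ := ⟨r / 4, r / 2, by positivity, by linarith⟩
  have hsupp : tsupport φ ⊆ U := by
    rw [φ.tsupport_eq]
    exact (Metric.closedBall_subset_ball (by change r / 2 < r; linarith)).trans hball
  have hφ : IsTestFunction Ω φ := ⟨φ.contDiff, φ.hasCompactSupport, hsupp.trans hUΩ⟩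
  have hfd : ∀ i j, Continuous fun x => fderiv ℝ (fun y => g y i) x (EuclideanSpace.single j 1) := by
    intro i j
    simp only [fderiv_component]
    exact continuous_const
  have hgc : ∀ i, Continuous fun x => g x i := fun i =>
    continuous_iff_continuousAt.2 fun x => (hasFDerivAt_component g i x).continuousAt
  have hcomp : ∀ i : Fin 2, g.linear (EuclideanSpace.single i 1) i * ∫ x, φ x =
      ∫ x in Ω, G i i x * φ x := by
    intro i
    have h1 := hG.weak i i φ hφ
    have h2 : ∫ x in Ω, v x i * partialDeriv i φ x = ∫ x, g x i * partialDeriv i φ x := by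
      refine setIntegral_eq_integral_of_ae_eq (Filter.Eventually.of_forall fun x => ?_) ?_
      · by_cases hx : x ∈ tsupport φ
        · simp only [hg (hsupp hx)]
        · simp only [partialDeriv_eq_zero hx, mul_zero]
      · intro x hx
        rw [partialDeriv_eq_zero (fun h => hx (hUΩ (hsupp h))), mul_zero]
    have hpd : Continuous (partialDeriv i φ) :=
      (hφ.smooth.continuous_fderiv (by simp)).clm_apply continuous_const
    have h3 : ∫ x, g x i * partialDeriv i φ x =
        - ∫ x, fderiv ℝ (fun y => g y i) x (EuclideanSpace.single i 1) * φ x := by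
      refine integral_mul_fderiv_eq_neg_fderiv_mul_of_integrable ?_ ?_ ?_ ?_ ?_
      · exact ((hfd i i).mul φ.continuous).integrable_of_hasCompactSupport
          φ.hasCompactSupport.mul_left
      · exact ((hgc i).mul hpd).integrable_of_hasCompactSupport
          (φ.hasCompactSupport.fderiv_apply ℝ _).mul_left
      · exact ((hgc i).mul φ.continuous).integrable_of_hasCompactSupport
          φ.hasCompactSupport.mul_left
      · exact fun x _ => (hasFDerivAt_component g i x).differentiableAt
      · exact fun x _ => φ.contDiff.differentiable (n := 1) (by simp) x
    rw [h2, h3] at h1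
    simp only [fderiv_component, integral_const_mul] at h1
    linarith
  have hsum : divg g * ∫ x, φ x = 0 := by
    rw [divg, Finset.sum_mul]
    simp only [hcomp]
    have hint : ∀ i ∈ Finset.univ, Integrable (fun x => G i i x * φ x) (volume.restrict Ω) :=
      fun i _ => (hG.memLp_grad i i).integrable_mul hφ.memLp
    rw [← integral_finsetSum _ hint]
    rw [← integral_zero Plane ℝ (μ := volume.restrict Ω)]
    refine integral_congr_ae ?_
    filter_upwards [hG0] with x hx
    rw [← Finset.sum_mul, hx, zero_mul]
  exact (mul_eq_zero.1 hsum).resolve_right φ.integral_pos.ne'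

/-- A continuous function on an interval that is Lipschitz on each of finitely many closed sets that
cover the interval. -/
lemma norm_sub_le_of_finite_cover {E : Type*} [NormedAddCommGroup E] {f : ℝ → E}
    (hf : ContinuousOn f (Icc 0 1)) {𝒞 : Set (Set ℝ)} (hfin : 𝒞.Finite)
    (hclosed : ∀ C ∈ 𝒞, IsClosed C) (hcover : Icc 0 1 ⊆ ⋃₀ 𝒞) {L : ℝ}
    (hlip : ∀ C ∈ 𝒞, ∀ x ∈ C ∩ Icc 0 1, ∀ y ∈ C ∩ Icc 0 1, ‖f x - f y‖ ≤ L * |x - y|) :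
    ‖f 1 - f 0‖ ≤ L := by
  refine le_of_forall_pos_le_add fun ε hε => ?_
  -- A growth estimate that needs a slope bound only along some sequence from the right; `ε`
  -- supplies the strict inequality between the slopes.
  have key := image_norm_le_of_liminf_right_slope_norm_lt_deriv_boundary (a := 0) (b := 1)
    (f := fun t => f t - f 0) (f' := fun _ => L) (B := fun t => (L + ε) * t) (B' := fun _ => L + ε)
    (hf.sub continuousOn_const) ?_ (by simp) (by fun_prop) ?_ (fun _ _ _ => by linarith)
    (right_mem_Icc.2 zero_le_one)
  · simpa using key
  · intro x hx r hr
    have hev : ∀ᶠ z in nhdsWithin x (Ioi x), z ∈ Ioo x 1 := Ioo_mem_nhdsGT hx.2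
    -- One of the finitely many sets contains points arbitrarily close to `x` on the right, and,
    -- being closed, `x` itself; the slope is bounded by `L` along these points.
    have hfreq : ∃ C ∈ 𝒞, ∃ᶠ z in nhdsWithin x (Ioi x), z ∈ C := by
      by_contra! hcon
      have : ∀ᶠ z in nhdsWithin x (Ioi x), ∀ C ∈ 𝒞, z ∉ C := by
        rw [Filter.eventually_all_finite hfin]
        intro C hC
        simpa using hcon C hC
      obtain ⟨z, hz, hz'⟩ := (this.and hev).exists
      obtain ⟨C, hC, hzC⟩ := hcover ⟨hx.1.trans hz'.1.le, hz'.2.le⟩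
      exact hz C hC hzC
    obtain ⟨C, hC, hfr⟩ := hfreq
    have hxC : x ∈ C := (hclosed C hC).mem_of_frequently_of_tendsto hfr
      (Filter.tendsto_id.mono_left nhdsWithin_le_nhds)
    refine (hfr.and_eventually hev).mono fun z ⟨hzC, hz⟩ => lt_of_le_of_lt ?_ hr
    have hzx : 0 < z - x := sub_pos.2 hz.1
    rw [slope_def_field, div_le_iff₀ hzx]
    have h1 := hlip C hC z ⟨hzC, hx.1.trans hz.1.le, hz.2.le⟩ x ⟨hxC, hx.1, hx.2.le⟩
    rw [abs_of_pos hzx] at h1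
    refine le_trans ?_ h1
    have := norm_sub_norm_le (f z - f 0) (f x - f 0)
    simpa using this
  · intro x _
    simpa using ((hasDerivAt_id x).const_mul (L + ε)).hasDerivWithinAt

/-- Restriction to segments reduces this to an interval, without loss in the constant. It replaces
the usual cancellation of integrals over interfaces: a continuous piecewise affine function is
locally Lipschitz. -/
lemma lipschitzOnWith_of_finite_cover {E F : Type*} [NormedAddCommGroup E] [NormedSpace ℝ E]
    [NormedAddCommGroup F] {f : E → F} {D : Set E} (hD : Convex ℝ D)
    (hf : ContinuousOn f D) {𝒞 : Set (Set E)} (hfin : 𝒞.Finite) (hclosed : ∀ C ∈ 𝒞, IsClosed C)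
    (hcover : D ⊆ ⋃₀ 𝒞) {L : NNReal} (hlip : ∀ C ∈ 𝒞, LipschitzOnWith L f C) :
    LipschitzOnWith L f D := by
  refine LipschitzOnWith.of_dist_le_mul fun x hx y hy => ?_
  set γ : ℝ → E := ⇑(AffineMap.lineMap y x : ℝ →ᵃ[ℝ] E) with hγ
  have hγc : Continuous γ := AffineMap.lineMap_continuous
  have hγD : ∀ t ∈ Icc (0 : ℝ) 1, γ t ∈ D := fun t ht =>
    hD.segment_subset hy hx (by rw [segment_eq_image_lineMap]; exact ⟨t, ht, rfl⟩)
  have key := norm_sub_le_of_finite_cover (f := f ∘ γ) (𝒞 := (fun C => γ ⁻¹' C) '' 𝒞)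
    (L := L * dist x y) (hf.comp hγc.continuousOn hγD) (hfin.image _) ?_ ?_ ?_
  · simpa [hγ, dist_eq_norm] using key
  · rintro _ ⟨C, hC, rfl⟩
    exact (hclosed C hC).preimage hγc
  · intro t ht
    obtain ⟨C, hC, htC⟩ := hcover (hγD t ht)
    exact ⟨_, ⟨C, hC, rfl⟩, htC⟩
  · rintro _ ⟨C, hC, rfl⟩ s hs t ht
    have := (hlip C hC).dist_le_mul _ hs.1 _ ht.1
    rw [hγ, dist_lineMap_lineMap, dist_comm y x, Real.dist_eq, dist_eq_norm] at this
    simp only [Function.comp_apply, ← hγ] at this ⊢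
    linarith

lemma exists_bound_of_finite {α : Type*} {s : Set α} (hs : s.Finite) (f : α → NNReal) :
    ∃ L, ∀ a ∈ s, f a ≤ L := by
  obtain ⟨L, hL⟩ := (hs.image f).bddAbove
  exact ⟨L, fun a ha => hL ⟨a, ha, rfl⟩⟩

/-! ### Continuous piecewise affine fields and their weak gradients -/

section Piecewise

variable {Ω : Set Plane} {𝒯 : Set (Set Plane)} {v : Plane → Plane}
  {g : Set Plane → Plane →ᵃ[ℝ] Plane}

/-- Convex sets have null frontiers, so almost every point of `Ω` avoids all finitely many of them.
-/
lemma ae_mem_interior (hfin : 𝒯.Finite) (hconv : ∀ T ∈ 𝒯, Convex ℝ T) (hcover : Ω ⊆ ⋃₀ 𝒯)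
    (hΩ : MeasurableSet Ω) :
    ∀ᵐ x ∂(volume.restrict Ω), ∃ T ∈ 𝒯, x ∈ interior T := by
  have h : ∀ᵐ x ∂(volume : Measure Plane), ∀ T ∈ 𝒯, x ∉ frontier T := by
    rw [ae_ball_iff hfin.countable]
    intro T hT
    exact measure_eq_zero_iff_ae_notMem.1 ((hconv T hT).addHaar_frontier volume)
  filter_upwards [ae_restrict_of_ae h, ae_restrict_mem hΩ] with x hx hxΩ
  obtain ⟨T, hT, hxT⟩ := hcover hxΩ
  refine ⟨T, hT, ?_⟩
  by_contra hni
  exact hx T hT ⟨subset_closure hxT, hni⟩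

lemma eventuallyEq_component {T : Set Plane} (hg : EqOn v (g T) T) {x : Plane} (hx : x ∈ interior T)
    (i : Fin 2) : (fun y => v y i) =ᶠ[nhds x] fun y => g T y i := by
  filter_upwards [mem_interior_iff_mem_nhds.1 hx] with y hy
  rw [hg hy]

lemma exists_lipschitz_component (hfin : 𝒯.Finite) (hg : ∀ T ∈ 𝒯, EqOn v (g T) T) (i : Fin 2) :
    ∃ L : NNReal, ∀ T ∈ 𝒯, LipschitzOnWith L (fun y => v y i) T := by
  obtain ⟨L, hL⟩ := exists_bound_of_finite hfin fun T => ‖(EuclideanSpace.proj i : Plane →L[ℝ] ℝ).comp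
    (LinearMap.toContinuousLinearMap (g T).linear)‖₊
  refine ⟨L, fun T hT => ?_⟩
  have h : LipschitzWith L fun y => g T y i := by
    refine LipschitzWith.weaken ?_ (hL T hT)
    exact lipschitzWith_of_nnnorm_fderiv_le
      (fun x => (hasFDerivAt_component (g T) i x).differentiableAt)
      fun x => by rw [(hasFDerivAt_component (g T) i x).fderiv]
  intro x hx y hy
  simp only [hg T hT hx, hg T hT hy]
  exact h x y

/-- A continuous piecewise affine field has weak derivatives. -/
lemma hasWeakPartial_of_piecewise (hopen : IsOpen Ω) (hfin : 𝒯.Finite)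
    (hclosed : ∀ T ∈ 𝒯, IsClosed T) (hconv : ∀ T ∈ 𝒯, Convex ℝ T) (hcover : Ω ⊆ ⋃₀ 𝒯)
    (hv : ContinuousOn v Ω) (hg : ∀ T ∈ 𝒯, EqOn v (g T) T) (i j : Fin 2) :
    HasWeakPartial Ω j (fun x => v x i)
      (fun x => fderiv ℝ (fun y => v y i) x (EuclideanSpace.single j 1)) := by
  intro φ hφ
  obtain ⟨L, hL⟩ := exists_lipschitz_component hfin hg i
  have hvi : ContinuousOn (fun x => v x i) Ω :=
    (EuclideanSpace.proj i : Plane →L[ℝ] ℝ).continuous.comp_continuousOn hv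
  have hloc : LocallyLipschitzOn (tsupport φ) fun x => v x i := by
    intro x hx
    obtain ⟨r, hr, hball⟩ := Metric.isOpen_iff.1 hopen x (hφ.support hx)
    exact ⟨L, Metric.ball x r, mem_nhdsWithin_of_mem_nhds (Metric.ball_mem_nhds x hr),
      lipschitzOnWith_of_finite_cover (convex_ball x r) (hvi.mono hball) hfin hclosed
        (hball.trans hcover) hL⟩
  obtain ⟨C, hC⟩ := hloc.exists_lipschitzOnWith_of_compact hφ.compact
  -- A global Lipschitz extension from the compact support of `φ` allows integration by parts on the
  -- whole plane; it need not agree with the field elsewhere.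
  obtain ⟨f, hf, hfv⟩ := hC.extend_real
  obtain ⟨D, hD⟩ := hφ.smooth.lipschitzWith_of_hasCompactSupport hφ.compact (by simp)
  have key := hf.integral_lineDeriv_mul_eq (μ := volume) hD hφ.compact (EuclideanSpace.single j 1)
  have h1 : ∫ x in Ω, v x i * partialDeriv j φ x =
      - ∫ x, lineDeriv ℝ φ x (-EuclideanSpace.single j 1) * f x := by
    rw [← integral_neg]
    refine setIntegral_eq_integral_of_ae_eq (Filter.Eventually.of_forall fun x => ?_) ?_
    · have hd : DifferentiableAt ℝ φ x := hφ.smooth.differentiable (by simp) x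
      simp only [hd.lineDeriv_eq_fderiv, map_neg]
      change v x i * partialDeriv j φ x = -(-partialDeriv j φ x * f x)
      by_cases hx : x ∈ tsupport φ
      · rw [← hfv hx]; ring
      · rw [partialDeriv_eq_zero hx]; ring
    · intro x hx
      have hd : DifferentiableAt ℝ φ x := hφ.smooth.differentiable (by simp) x
      simp only [hd.lineDeriv_eq_fderiv, map_neg]
      change -(-partialDeriv j φ x * f x) = 0
      rw [partialDeriv_eq_zero (fun h => hx (hφ.support h))]; ring
  have h2 : ∫ x in Ω, fderiv ℝ (fun y => v y i) x (EuclideanSpace.single j 1) * φ x =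
      ∫ x, lineDeriv ℝ f x (EuclideanSpace.single j 1) * φ x := by
    refine setIntegral_eq_integral_of_ae_eq ?_ ?_
    · filter_upwards [ae_mem_interior hfin hconv hcover hopen.measurableSet] with x ⟨T, hT, hx⟩
      -- The extension coincides with the field near `x` only where `φ x ≠ 0`; at other points both
      -- integrands vanish.
      by_cases h0 : φ x = 0
      · rw [h0, mul_zero, mul_zero]
      have hev := eventuallyEq_component (hg T hT) hx i
      have hsupp : Function.support φ ∈ nhds x :=
        hφ.smooth.continuous.isOpen_support.mem_nhds h0
      have hfe : f =ᶠ[nhds x] fun y => g T y i := by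
        filter_upwards [hev, hsupp] with y hy hy'
        rw [← hy, ← hfv (subset_tsupport _ hy')]
      have hfd : HasFDerivAt f _ x := (hasFDerivAt_component (g T) i x).congr_of_eventuallyEq hfe
      rw [hfd.differentiableAt.lineDeriv_eq_fderiv, hev.fderiv_eq, hfe.fderiv_eq]
    · intro x hx
      have : φ x = 0 := by
        by_contra h
        exact hx (hφ.support (subset_tsupport _ h))
      rw [this, mul_zero]
  rw [h1, h2, key]

/-- The piecewise gradient takes finitely many values almost everywhere, so it is bounded and, `Ω`
having finite measure, square integrable; it is the weak gradient. -/
lemma isSolenoidal_of_piecewise (hopen : IsOpen Ω) (hbdd : Bornology.IsBounded Ω) (hfin : 𝒯.Finite)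
    (hclosed : ∀ T ∈ 𝒯, IsClosed T) (hconv : ∀ T ∈ 𝒯, Convex ℝ T) (hcover : Ω ⊆ ⋃₀ 𝒯)
    (hv : ContinuousOn v Ω) {C : ℝ} (hvC : ∀ x ∈ Ω, ‖v x‖ ≤ C) (hg : ∀ T ∈ 𝒯, EqOn v (g T) T)
    (hdiv : ∀ T ∈ 𝒯, divg (g T) = 0) : IsSolenoidal Ω v := by
  have : IsFiniteMeasure (volume.restrict Ω) := ⟨by simpa using hbdd.measure_lt_top⟩
  have hae := ae_mem_interior hfin hconv hcover hopen.measurableSet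
  refine ⟨fun i j x => fderiv ℝ (fun y => v y i) x (EuclideanSpace.single j 1),
    ⟨fun i => ?_, fun i j => ?_, fun i j =>
      hasWeakPartial_of_piecewise hopen hfin hclosed hconv hcover hv hg i j⟩, ?_⟩
  · refine MemLp.of_bound (ContinuousOn.aestronglyMeasurable ?_ hopen.measurableSet) C ?_
    · exact (EuclideanSpace.proj i : Plane →L[ℝ] ℝ).continuous.comp_continuousOn hv
    · filter_upwards [ae_restrict_mem hopen.measurableSet] with x hx
      exact (PiLp.norm_apply_le (v x) i).trans (hvC x hx)
  · obtain ⟨L, hL⟩ := exists_bound_of_finite hfin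
      fun T => ‖(g T).linear (EuclideanSpace.single j 1) i‖₊
    refine MemLp.of_bound (measurable_fderiv_apply_const ℝ _ _).aestronglyMeasurable L ?_
    filter_upwards [hae] with x ⟨T, hT, hx⟩
    rw [(eventuallyEq_component (hg T hT) hx i).fderiv_eq, fderiv_component]
    exact_mod_cast hL T hT
  · filter_upwards [hae] with x ⟨T, hT, hx⟩
    rw [← hdiv T hT, divg]
    refine Finset.sum_congr rfl fun i _ => ?_
    rw [(eventuallyEq_component (hg T hT) hx i).fderiv_eq, fderiv_component]

end Piecewise

/-! ### Topology of the macro-mesh -/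

lemma IsSharedEdge.symm {K : Geometry.SimplicialComplex ℝ Plane} {a b : Plane}
    (h : IsSharedEdge K a b) : IsSharedEdge K b a := by
  obtain ⟨s, hs, t, ht, hst, h1, h2, h3, h4⟩ := h
  exact ⟨s, hs, t, ht, hst, h2, h1, h4, h3⟩

/-- Two triangles with a common edge. -/
def EdgeAdjacent (K : Geometry.SimplicialComplex ℝ Plane) (s t : Finset Plane) : Prop :=
  s ∈ triangles K ∧ t ∈ triangles K ∧ ∃ a b, a ≠ b ∧ a ∈ s ∧ b ∈ s ∧ a ∈ t ∧ b ∈ t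

section Mesh

variable {Ω : Set Plane} {K : Geometry.SimplicialComplex ℝ Plane}

lemma isClosed_triangle (t : Finset Plane) : IsClosed (convexHull ℝ (t : Set Plane)) :=
  t.finite_toSet.isClosed_convexHull ℝ

lemma exists_mem_inter {s t : Finset Plane} (hs : s ∈ triangles K) (ht : t ∈ triangles K) {x : Plane}
    (hxs : x ∈ convexHull ℝ (s : Set Plane)) (hxt : x ∈ convexHull ℝ (t : Set Plane)) :
    ∃ z, z ∈ s ∧ z ∈ t := by
  have h := K.inter_subset_convexHull hs.1 ht.1 ⟨hxs, hxt⟩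
  obtain ⟨z, hz⟩ := convexHull_nonempty_iff.1 ⟨x, h⟩
  exact ⟨z, hz.1, hz.2⟩

lemma IsMacroMesh.finite_vertices (hK : IsMacroMesh Ω K) : K.vertices.Finite := by
  refine Finite.of_finite_image (f := fun x => ({x} : Finset Plane)) (hK.finite.subset ?_)
    (Finset.singleton_injective.injOn)
  rintro _ ⟨x, hx, rfl⟩
  exact hx

lemma IsMacroMesh.exists_triangle (hK : IsMacroMesh Ω K) {z : Plane} (hz : z ∈ K.vertices) :
    ∃ t ∈ triangles K, z ∈ t := by
  obtain ⟨t, ht, hzt⟩ := hK.pure _ hz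
  exact ⟨t, ht, by simpa using hzt⟩

/-- Functions on the triangles that agree on intersections can be glued. -/
lemma IsMacroMesh.exists_glue (hK : IsMacroMesh Ω K) {X : Type*} [TopologicalSpace X] (d : X)
    (f : Finset Plane → Plane → X)
    (hf : ∀ t ∈ triangles K, ContinuousOn (f t) (convexHull ℝ (t : Set Plane)))
    (hagree : ∀ s ∈ triangles K, ∀ t ∈ triangles K, ∀ x ∈ convexHull ℝ (s : Set Plane),
      x ∈ convexHull ℝ (t : Set Plane) → f s x = f t x) :
    ∃ g : Plane → X, ContinuousOn g (closure Ω) ∧ (∀ x, x ∉ closure Ω → g x = d) ∧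
      ∀ t ∈ triangles K, EqOn g (f t) (convexHull ℝ (t : Set Plane)) := by
  classical
  let g : Plane → X := fun x =>
    if h : ∃ t ∈ triangles K, x ∈ convexHull ℝ (t : Set Plane) then f h.choose x else d
  have hg : ∀ t ∈ triangles K, EqOn g (f t) (convexHull ℝ (t : Set Plane)) := by
    intro t ht x hx
    have h : ∃ t ∈ triangles K, x ∈ convexHull ℝ (t : Set Plane) := ⟨t, ht, hx⟩
    simp only [g, dif_pos h]
    exact hagree _ h.choose_spec.1 t ht x h.choose_spec.2 hx
  refine ⟨g, ?_, fun x hx => ?_, hg⟩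
  · have : Finite (triangles K) := hK.finite_triangles
    have hc : closure Ω = ⋃ t : triangles K, convexHull ℝ ((t : Finset Plane) : Set Plane) := by
      ext x
      simp [hK.mem_closure_iff]
    rw [hc]
    exact (locallyFinite_of_finite _).continuousOn_iUnion (fun t => isClosed_triangle _)
      fun t => (hf t t.2).congr (hg t t.2)
  · rw [hK.mem_closure_iff] at hx
    simp only [g, dif_neg hx]

lemma IsMacroMesh.star_edgeAdjacent (hK : IsMacroMesh Ω K) {z : Plane} {s t : Finset Plane}
    (hs : s ∈ triangles K) (ht : t ∈ triangles K) (hzs : z ∈ s) (hzt : z ∈ t) :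
    Relation.ReflTransGen (EdgeAdjacent K) s t := by
  refine Relation.ReflTransGen.mono ?_ _ _ (hK.star_connected z (vertex_mem hs hzs) s hs t ht hzs hzt)
  rintro a b ⟨ha, hb, hza, hzb, w, hw, hwa, hwb⟩
  exact ⟨ha, hb, z, w, hw.symm, hza, hwa, hzb, hwb⟩

/-- Any two triangles are joined by a chain of triangles in which consecutive ones share an edge. -/
lemma IsMacroMesh.edgeConnected (hK : IsMacroMesh Ω K) (hΩ : IsConnected Ω) {s t : Finset Plane}
    (hs : s ∈ triangles K) (ht : t ∈ triangles K) :
    Relation.ReflTransGen (EdgeAdjacent K) s t := by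
  by_contra hst
  let A : Set (Finset Plane) := {r ∈ triangles K | Relation.ReflTransGen (EdgeAdjacent K) s r}
  let A' : Set (Finset Plane) := {r ∈ triangles K | ¬ Relation.ReflTransGen (EdgeAdjacent K) s r}
  have hclosed : ∀ A : Set (Finset Plane), A ⊆ triangles K →
      IsClosed (⋃ r ∈ A, convexHull ℝ (r : Set Plane)) := fun A hA =>
    (hK.finite_triangles.subset hA).isClosed_biUnion fun r _ => isClosed_triangle r
  have hne : ∀ r ∈ triangles K, (closure Ω ∩ convexHull ℝ (r : Set Plane)).Nonempty := by
    intro r hr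
    obtain ⟨x, hx⟩ := K.nonempty_of_mem_faces hr.1
    have := subset_convexHull ℝ (r : Set Plane) (Finset.mem_coe.2 hx)
    exact ⟨x, hK.convexHull_subset hr this, this⟩
  -- The triangles reachable from `s` and the others form two closed sets that cover the connected
  -- closure of `Ω`. They meet, so two of their triangles share a vertex, and the star of this
  -- vertex joins them.
  obtain ⟨x, -, hxA, hxA'⟩ := isPreconnected_closed_iff.1 hΩ.closure.isPreconnected
    (⋃ r ∈ A, convexHull ℝ (r : Set Plane)) (⋃ r ∈ A', convexHull ℝ (r : Set Plane))
    (hclosed A fun r hr => hr.1) (hclosed A' fun r hr => hr.1)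
    (fun x hx => by
      obtain ⟨r, hr, hxr⟩ := hK.mem_closure_iff.1 hx
      by_cases h : Relation.ReflTransGen (EdgeAdjacent K) s r
      · exact .inl (mem_biUnion (show r ∈ A from ⟨hr, h⟩) hxr)
      · exact .inr (mem_biUnion (show r ∈ A' from ⟨hr, h⟩) hxr))
    ((hne s hs).mono (inter_subset_inter_right _
      (subset_biUnion_of_mem (u := fun r : Finset Plane => convexHull ℝ (r : Set Plane))
        (show s ∈ A from ⟨hs, .refl⟩))))
    ((hne t ht).mono (inter_subset_inter_right _
      (subset_biUnion_of_mem (u := fun r : Finset Plane => convexHull ℝ (r : Set Plane))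
        (show t ∈ A' from ⟨ht, hst⟩))))
  simp only [mem_iUnion] at hxA hxA'
  obtain ⟨r, hr, hxr⟩ := hxA
  obtain ⟨r', hr', hxr'⟩ := hxA'
  obtain ⟨z, hzr, hzr'⟩ := exists_mem_inter hr.1 hr'.1 hxr hxr'
  exact hr'.2 (hr.2.trans (hK.star_edgeAdjacent hr.1 hr'.1 hzr hzr'))

/-- A vertex all of whose edges belong to two triangles is in the domain. -/
lemma IsMacroMesh.exists_boundary_edge (hK : IsMacroMesh Ω K)
    (hreg : interior (closure Ω) = Ω) {z : Plane} (hz : z ∈ K.vertices) (hzΩ : z ∉ Ω) :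
    ∃ t ∈ triangles K, ∃ w ∈ t, z ∈ t ∧ z ≠ w ∧ ¬ IsSharedEdge K z w := by
  by_contra! hcon
  refine hzΩ ?_
  -- The part of the mesh away from `z` is closed and misses `z`; hence a small ball around `z`
  -- meets only simplices with vertex `z`.
  set C : Set Plane := ⋃ s ∈ {s ∈ K.faces | z ∉ s}, convexHull ℝ (s : Set Plane) with hC
  have hCclosed : IsClosed C :=
    (hK.finite.subset (fun s hs => hs.1)).isClosed_biUnion fun s _ => isClosed_triangle s
  have hmemC : ∀ s ∈ K.faces, z ∉ s → ∀ x ∈ convexHull ℝ (s : Set Plane), x ∈ C :=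
    fun s hs hzs x hx => mem_biUnion (show s ∈ {s ∈ K.faces | z ∉ s} from ⟨hs, hzs⟩) hx
  have hzC : z ∉ C := by
    intro h
    simp only [hC, mem_iUnion] at h
    obtain ⟨s, ⟨hs, hzs⟩, hx⟩ := h
    exact hzs ((Geometry.SimplicialComplex.vertex_mem_convexHull_iff hz hs).1 hx)
  obtain ⟨r, hr, hball⟩ := Metric.isOpen_iff.1 hCclosed.isOpen_compl z hzC
  obtain ⟨t₀, ht₀, hzt₀⟩ := hK.exists_triangle hz
  obtain ⟨w₀, hw₀, hw₀z⟩ := Finset.exists_mem_ne (by rw [ht₀.2]; norm_num : 1 < t₀.card) z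
  have hw₀r : r ≤ dist w₀ z := by
    by_contra! h
    exact hball (Metric.mem_ball.2 h) (hmemC {w₀} (vertex_mem ht₀ hw₀) (by simpa using hw₀z.symm) w₀
      (subset_convexHull ℝ _ (by simp)))
  -- A small circle around `z` meets the mesh only in interiors of triangles and in open shared
  -- edges, all inside `Ω`.
  have hsphere : ∀ ε, 0 < ε → ε < r → Metric.sphere z ε ⊆ Ω := by
    intro ε hε hεr
    have hin : ∀ x ∈ Metric.sphere z ε, x ∈ closure Ω → x ∈ Ω := by
      intro x hx hxc
      have hxC : x ∉ C := hball (by rw [Metric.mem_ball, Metric.mem_sphere.1 hx]; exact hεr)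
      have hxz : x ≠ z := by
        rintro rfl
        simp at hx
        linarith
      obtain ⟨t, ht, hxt⟩ := hK.mem_closure_iff.1 hxc
      obtain ⟨B, hB⟩ := exists_affineBasis' ht
      rcases mem_convexHull_cases hB hxt with h | ⟨i, j, k, hij, -, -, h⟩ | ⟨i, rfl⟩
      · exact hK.interior_subset hreg ht h
      · have hne := basis_ne B hij
        by_cases hi : B i = z
        · rw [hi] at h hne
          exact hK.openSegment_subset hreg hne
            (hcon t ht _ (basis_mem hB j) (hi ▸ basis_mem hB i) hne) h
        by_cases hj : B j = z
        · rw [hj] at h hne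
          exact hK.openSegment_subset hreg hne
            (hcon t ht _ (basis_mem hB i) (hj ▸ basis_mem hB j) hne.symm).symm h
        · refine absurd (hmemC {B i, B j} (edge_mem ht (basis_mem hB i) (basis_mem hB j)) ?_ x ?_) hxC
          · simp [Ne.symm hi, Ne.symm hj]
          · exact segment_subset_convexHull (by simp) (by simp)
              (openSegment_subset_segment ℝ _ _ h)
      · exact absurd (hmemC {B i} (vertex_mem ht (basis_mem hB i)) (by simpa using hxz.symm) _
          (subset_convexHull ℝ _ (by simp))) hxC
    have hrank : 1 < Module.rank ℝ Plane := by
      rw [← Module.finrank_eq_rank, finrank_euclideanSpace_fin]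
      norm_num
    have hΩo : IsOpen Ω := hreg ▸ isOpen_interior
    -- The connected circle lies in the union of the disjoint open sets `Ω` and the complement of
    -- its closure. It meets `Ω` on the edge from `z` to `w₀`, whose length is at least `r`.
    refine (isConnected_sphere hrank z hε.le).isPreconnected.subset_left_of_subset_union hΩo
      isClosed_closure.isOpen_compl (disjoint_compl_right.mono_left subset_closure) ?_ ?_
    · intro x hx
      by_cases h : x ∈ closure Ω
      · exact .inl (hin x hx h)
      · exact .inr h
    · have hd : 0 < dist w₀ z := dist_pos.2 hw₀z
      set x : Plane := AffineMap.lineMap z w₀ (ε / dist w₀ z) with hx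
      have hxs : x ∈ Metric.sphere z ε := by
        rw [Metric.mem_sphere, hx, dist_lineMap_left, Real.norm_eq_abs, abs_of_nonneg (by positivity),
          dist_comm z w₀, div_mul_cancel₀ _ hd.ne']
      refine ⟨x, hxs, hin x hxs (hK.convexHull_subset ht₀ ?_)⟩
      refine segment_subset_convexHull hzt₀ hw₀ ?_
      rw [segment_eq_image_lineMap]
      refine ⟨_, ⟨by positivity, ?_⟩, rfl⟩
      rw [div_le_one hd]
      linarith
  -- The circles fill a punctured ball, so `z` is interior to the closure of `Ω`.
  rw [← hreg, mem_interior_iff_mem_nhds]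
  refine Filter.mem_of_superset (Metric.ball_mem_nhds z hr) fun x hx => ?_
  rcases eq_or_ne x z with rfl | hxz
  · rw [← hK.space_eq]; exact Geometry.SimplicialComplex.vertices_subset_space hz
  · exact subset_closure (hsphere (dist x z) (dist_pos.2 hxz) (Metric.mem_ball.1 hx) rfl)

/-! ### Cocycles are coboundaries -/

/-- The values of `θ` on the edges of each triangle are consistent. -/
def IsCocycle {R : Type*} [Add R] (K : Geometry.SimplicialComplex ℝ Plane) (θ : Plane → Plane → R) :
    Prop :=
  ∀ t ∈ triangles K, ∀ a ∈ t, ∀ b ∈ t, ∀ c ∈ t, θ a b + θ b c = θ a c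

/-- Sums from a base vertex are interpolated affinely. Integrality at the vertices makes the
interpolants of different triangles agree modulo 1 on common faces. -/
lemma exists_affine_potential {θ : Plane → Plane → ℤ} (hθ : IsCocycle K θ) {t : Finset Plane}
    (ht : t ∈ triangles K) : ∃ f : Plane →ᵃ[ℝ] ℝ, (∀ a ∈ t, ∀ b ∈ t, f b - f a = θ a b) ∧
      ∀ a ∈ t, ∃ n : ℤ, f a = n := by
  obtain ⟨B, hB⟩ := exists_affineBasis' ht
  let f : Plane →ᵃ[ℝ] ℝ := ∑ i, (θ (B 0) (B i) : ℝ) • B.coord i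
  have hf : ∀ a ∈ t, f a = θ (B 0) a := by
    intro a ha
    obtain ⟨j, rfl⟩ := exists_basis_eq hB ha
    obtain ⟨i, k, hik, hij, hkj⟩ := exists_ne_ne j
    have : f (B j) = ∑ i, (θ (B 0) (B i) : ℝ) * B.coord i (B j) := by
      simp only [f, Fin.sum_univ_three]; rfl
    rw [this, sum_fin_three _ hik hij hkj, AffineBasis.coord_apply_eq,
      AffineBasis.coord_apply_ne _ hij, AffineBasis.coord_apply_ne _ hkj]
    ring
  refine ⟨f, fun a ha b hb => ?_, fun a ha => ⟨_, hf a ha⟩⟩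
  rw [hf a ha, hf b hb, ← hθ t ht (B 0) (basis_mem hB 0) a ha b hb]
  push_cast
  ring

lemma affine_sub_eq_of_mem_convexHull {f g : Plane →ᵃ[ℝ] ℝ} {s : Set Plane} {d : ℝ}
    (h : ∀ a ∈ s, f a - g a = d) {x : Plane} (hx : x ∈ convexHull ℝ s) : f x - g x = d := by
  have hconv : Convex ℝ {y : Plane | (f - g) y = d} :=
    (convex_singleton d).affine_preimage (f - g)
  exact convexHull_min (fun y hy => h y hy) hconv hx

/-- The set lies between the convex interior of the triangle and its closure. -/
lemma isPreconnected_triangle_inter (hreg : interior (closure Ω) = Ω) (hK : IsMacroMesh Ω K)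
    {t : Finset Plane} (ht : t ∈ triangles K) :
    IsPreconnected (convexHull ℝ (t : Set Plane) ∩ Ω) := by
  have hconv := convex_convexHull ℝ (t : Set Plane)
  refine hconv.interior.isPreconnected.subset_closure
    (fun x hx => ⟨interior_subset hx, hK.interior_subset hreg ht hx⟩) ?_
  have hne : (interior (convexHull ℝ (t : Set Plane))).Nonempty := by
    obtain ⟨B, hB⟩ := exists_affineBasis' ht
    exact ⟨incenter t, (mem_interior_iff_coord hB).2 (coord_incenter_pos ht hB)⟩
  rw [hconv.closure_interior_eq_closure_of_nonempty_interior hne]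
  exact fun x hx => subset_closure hx.1

lemma midpoint_mem_openSegment (a b : Plane) : midpoint ℝ a b ∈ openSegment ℝ a b := by
  rw [openSegment_eq_image_lineMap]
  exact ⟨1 / 2, by norm_num, by simp [midpoint]⟩

/-- The affine potentials of the triangles glue to a map from the closure of `Ω` to the circle of
length 1. Simple connectedness lifts it to the line over `Ω`. The lift differs from each affine
potential by a constant, and the corrected potentials agree at common vertices. As boundary vertices
are outside `Ω`, their values are compared through shared edges of their stars. -/
lemma exists_int_potential (hreg : interior (closure Ω) = Ω) (hsc : IsSimplyConnected Ω)
    (hK : IsMacroMesh Ω K) {θ : Plane → Plane → ℤ} (hθ : IsCocycle K θ) :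
    ∃ ψ : Plane → ℝ, ∀ t ∈ triangles K, ∀ a ∈ t, ∀ b ∈ t, ψ b - ψ a = θ a b := by
  choose! f hf hfint using fun t (ht : t ∈ triangles K) => exists_affine_potential hθ ht
  have hdiff : ∀ s ∈ triangles K, ∀ t ∈ triangles K, ∀ a ∈ s, a ∈ t → ∀ x,
      x ∈ convexHull ℝ (s : Set Plane) → x ∈ convexHull ℝ (t : Set Plane) →
        f s x - f t x = f s a - f t a := by
    intro s hs t ht a has hat x hxs hxt
    refine affine_sub_eq_of_mem_convexHull ?_ (K.inter_subset_convexHull hs.1 ht.1 ⟨hxs, hxt⟩)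
    intro b hb
    have h1 := hf s hs a has b hb.1
    have h2 := hf t ht a hat b hb.2
    linarith
  obtain ⟨g, hgc, -, hg⟩ := hK.exists_glue (0 : AddCircle (1 : ℝ))
    (fun t x => ((f t x : ℝ) : AddCircle (1 : ℝ)))
    (fun t _ => ((AddCircle.continuous_mk' (1 : ℝ)).comp
      (f t).continuous_of_finiteDimensional).continuousOn) (by
      intro s hs t ht x hxs hxt
      obtain ⟨a, has, hat⟩ := exists_mem_inter hs ht hxs hxt
      obtain ⟨n, hn⟩ := hfint s hs a has
      obtain ⟨m, hm⟩ := hfint t ht a hat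
      have := hdiff s hs t ht a has hat x hxs hxt
      rw [← sub_eq_zero, ← AddCircle.coe_sub, AddCircle.coe_eq_zero_iff]
      refine ⟨n - m, ?_⟩
      rw [this, hn, hm]
      simp)
  have hΩo : IsOpen Ω := hreg ▸ isOpen_interior
  have : SimplyConnectedSpace Ω := hsc.simplyConnectedSpace
  have : LocallyPathConnectedSpace Ω := hΩo.locallyPathConnectedSpace
  obtain ⟨x₀, hx₀⟩ := hsc.nonempty
  obtain ⟨e₀, he₀⟩ := QuotientAddGroup.mk_surjective (g x₀)
  obtain ⟨F, ⟨-, hF⟩, -⟩ := (AddCircle.isCoveringMap_coe (1 : ℝ)).existsUnique_continuousMap_lifts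
    ⟨fun x : Ω => g x, (hgc.mono subset_closure).domRestrict⟩ ⟨x₀, hx₀⟩ e₀ he₀
  have hF' : ∀ x : Ω, ((F x : ℝ) : AddCircle (1 : ℝ)) = g x := fun x => congrFun hF x
  have hconst : ∀ t ∈ triangles K, ∃ c : ℝ, ∀ x : Ω,
      (x : Plane) ∈ convexHull ℝ (t : Set Plane) → F x = f t x + c := by
    intro t ht
    have hpre : IsPreconnected {x : Ω | (x : Plane) ∈ convexHull ℝ (t : Set Plane)} := by
      rw [← Topology.IsInducing.subtypeVal.isPreconnected_image]
      have : Subtype.val '' {x : Ω | (x : Plane) ∈ convexHull ℝ (t : Set Plane)} =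
          convexHull ℝ (t : Set Plane) ∩ Ω := by
        ext x; simp
      rw [this]
      exact isPreconnected_triangle_inter hreg hK ht
    have hdisc : IsDiscrete (range ((↑) : ℤ → ℝ)) := 
      Int.isClosedEmbedding_coe_real.isEmbedding.isDiscrete_range
    obtain ⟨c, -, hc⟩ := hpre.eqOn_const_of_mapsTo hdisc (f := fun x => F x - f t x)
      (F.continuous.sub ((f t).continuous_of_finiteDimensional.comp
        continuous_subtype_val)).continuousOn (by
        intro x hx
        have h1 := hF' x
        rw [hg t ht hx, ← sub_eq_zero, ← AddCircle.coe_sub, AddCircle.coe_eq_zero_iff] at h1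
        obtain ⟨n, hn⟩ := h1
        exact ⟨n, by simpa using hn⟩) (range_nonempty _)
    refine ⟨c, fun x hx => ?_⟩
    have := hc hx
    simp only [Function.const_apply] at this
    linarith
  choose! c hc using hconst
  -- The midpoint of a shared edge is in `Ω`, where both corrected potentials equal the lift; the
  -- difference of two affine potentials is constant on the common face, so equality passes to its
  -- ends.
  have hedge : ∀ s ∈ triangles K, ∀ t ∈ triangles K, ∀ a ∈ s, ∀ b ∈ s, a ∈ t → b ∈ t → a ≠ b →
      f s a + c s = f t a + c t := by
    intro s hs t ht a has b hbs hat hbt hab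
    rcases eq_or_ne s t with rfl | hst
    · rfl
    have hm := midpoint_mem_openSegment a b
    have hmΩ := hK.openSegment_subset hreg hab ⟨s, hs, t, ht, hst, has, hbs, hat, hbt⟩ hm
    have hms := segment_subset_convexHull (𝕜 := ℝ) (Finset.mem_coe.2 has) (Finset.mem_coe.2 hbs)
      (openSegment_subset_segment ℝ a b hm)
    have hmt := segment_subset_convexHull (𝕜 := ℝ) (Finset.mem_coe.2 hat) (Finset.mem_coe.2 hbt)
      (openSegment_subset_segment ℝ a b hm)
    have h1 := hc s hs ⟨_, hmΩ⟩ hms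
    have h2 := hc t ht ⟨_, hmΩ⟩ hmt
    have h3 := hdiff s hs t ht a has hat _ hms hmt
    simp only at h1 h2
    linarith
  have hstar : ∀ z s t, s ∈ triangles K → t ∈ triangles K → z ∈ s → z ∈ t →
      f s z + c s = f t z + c t := by
    intro z s t hs ht hzs hzt
    induction hK.star_connected z (vertex_mem hs hzs) s hs t ht hzs hzt with
    | refl => rfl
    | tail _ h ih =>
      obtain ⟨ha, hb, hza, hzb, w, hw, hwa, hwb⟩ := h
      rw [ih ha hza]
      exact hedge _ ha _ hb z hza w hwa hzb hwb hw.symm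
  choose! τ hτ hτ' using fun z (hz : z ∈ K.vertices) => hK.exists_triangle hz
  refine ⟨fun z => f (τ z) z + c (τ z), fun t ht a ha b hb => ?_⟩
  have hva := vertex_mem ht ha
  have hvb := vertex_mem ht hb
  simp only [hstar a (τ a) t (hτ a hva) ht (hτ' a hva) ha,
    hstar b (τ b) t (hτ b hvb) ht (hτ' b hvb) hb]
  rw [← hf t ht a ha b hb]
  ring

/-- On a simply connected domain, every cocycle is a coboundary. -/
theorem exists_potential (hreg : interior (closure Ω) = Ω) (hsc : IsSimplyConnected Ω)
    (hK : IsMacroMesh Ω K) {θ : Plane → Plane → ℝ} (hθ : IsCocycle K θ) :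
    ∃ ψ : Plane → ℝ, ∀ t ∈ triangles K, ∀ a ∈ t, ∀ b ∈ t, ψ b - ψ a = θ a b := by
  classical
  -- The values generate a finitely generated torsion-free group, hence a free one; its coordinates
  -- split the real cocycle into finitely many integer cocycles.
  let G : Submodule ℤ ℝ := Submodule.span ℤ (image2 θ K.vertices K.vertices)
  have : Module.Finite ℤ G :=
    Module.Finite.span_of_finite ℤ (hK.finite_vertices.image2 θ hK.finite_vertices)
  let b := Module.Free.chooseBasis ℤ G
  -- Values outside `G` are irrelevant and sent to 0: all values of `θ` on edges of triangles lie in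
  -- `G`.
  let π : Module.Free.ChooseBasisIndex ℤ G → ℝ → ℤ := fun j x =>
    if h : x ∈ G then b.repr ⟨x, h⟩ j else 0
  have hmem : ∀ t ∈ triangles K, ∀ a ∈ t, ∀ b ∈ t, θ a b ∈ G := fun t ht a ha b hb =>
    Submodule.subset_span ⟨a, vertex_mem ht ha, b, vertex_mem ht hb, rfl⟩
  have hπ : ∀ x ∈ G, ∑ j, (π j x : ℝ) * (b j : ℝ) = x := by
    intro x hx
    have h := congrArg (Subtype.val) (b.sum_repr ⟨x, hx⟩)
    simp only [AddSubmonoidClass.coe_finsetSum, Submodule.coe_smul_of_tower, zsmul_eq_mul] at h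
    simpa only [π, dif_pos hx] using h
  have hint : ∀ j, IsCocycle K fun x y => π j (θ x y) := by
    intro j t ht x hx y hy z hz
    have h1 := hmem t ht x hx y hy
    have h2 := hmem t ht y hy z hz
    have h3 := hmem t ht x hx z hz
    simp only [π, dif_pos h1, dif_pos h2, dif_pos h3]
    have : (⟨θ x z, h3⟩ : G) = ⟨θ x y, h1⟩ + ⟨θ y z, h2⟩ :=
      Subtype.ext (hθ t ht x hx y hy z hz).symm
    rw [this, map_add, Finsupp.add_apply]
  choose ψ hψ using fun j => exists_int_potential hreg hsc hK (hint j)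
  refine ⟨fun z => ∑ j, ψ j z * (b j : ℝ), fun t ht x hx y hy => ?_⟩
  rw [← hπ _ (hmem t ht x hx y hy), ← Finset.sum_sub_distrib]
  refine Finset.sum_congr rfl fun j _ => ?_
  rw [← hψ j t ht x hx y hy]
  ring

end Mesh

/-! ### The boundary is connected -/

section Orientation

variable {K : Geometry.SimplicialComplex ℝ Plane}

open Classical in
/-- The sign of the edge from `a` to `b` in the positively oriented boundary of the triangle `t`. -/
def edgeSign (t : Finset Plane) (a b : Plane) : ℝ :=
  if a ∈ t ∧ b ∈ t then Real.sign (∑ c ∈ t, cross (b - a) (c - a)) else 0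

lemma edgeSign_of_notMem {t : Finset Plane} {a b : Plane} (h : ¬ (a ∈ t ∧ b ∈ t)) :
    edgeSign t a b = 0 := if_neg h

lemma edgeSign_comm (t : Finset Plane) (a b : Plane) : edgeSign t b a = - edgeSign t a b := by
  by_cases h : a ∈ t ∧ b ∈ t
  · rw [edgeSign, edgeSign, if_pos h, if_pos h.symm, ← Real.sign_neg, ← Finset.sum_neg_distrib]
    congr 1
    refine Finset.sum_congr rfl fun c _ => ?_
    simp only [cross, PiLp.sub_apply]
    ring
  · rw [edgeSign_of_notMem h, edgeSign_of_notMem (fun h' => h h'.symm), neg_zero]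

lemma edgeSign_self (t : Finset Plane) (a : Plane) : edgeSign t a a = 0 := by
  simp [edgeSign]

lemma sum_triangle {M : Type*} [AddCommMonoid M] {t : Finset Plane} (ht : t ∈ triangles K)
    {a b c : Plane} (ha : a ∈ t)
    (hb : b ∈ t) (hc : c ∈ t) (hab : a ≠ b) (hac : a ≠ c) (hbc : b ≠ c) (F : Plane → M) :
    ∑ x ∈ t, F x = F a + F b + F c := by
  classical
  have ht' : t = {a, b, c} := by ext x; simp [triangle_eq ht ha hb hc hab hac hbc]
  rw [ht', Finset.sum_insert (by simp [hab, hac]), Finset.sum_insert (by simp [hbc]),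
    Finset.sum_singleton, add_assoc]

lemma edgeSign_eq {t : Finset Plane} (ht : t ∈ triangles K) {a b c : Plane} (ha : a ∈ t)
    (hb : b ∈ t) (hc : c ∈ t) (hab : a ≠ b) (hac : a ≠ c) (hbc : b ≠ c) :
    edgeSign t a b = Real.sign (cross (b - a) (c - a)) := by
  rw [edgeSign, if_pos ⟨ha, hb⟩, sum_triangle ht ha hb hc hab hac hbc]
  simp [cross_self]

lemma edgeSign_ne_zero {t : Finset Plane} (ht : t ∈ triangles K) {a b : Plane} (ha : a ∈ t)
    (hb : b ∈ t) (hab : a ≠ b) : edgeSign t a b ≠ 0 := by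
  obtain ⟨c, hc, hac, hbc⟩ := exists_third_vertex ht ha hb hab
  rw [edgeSign_eq ht ha hb hc hab hac hbc, Ne, Real.sign_eq_zero_iff]
  exact cross_ne_zero ht ha hb hc hab hac hbc

lemma edgeSign_rotate {t : Finset Plane} (ht : t ∈ triangles K) {a b c : Plane} (ha : a ∈ t)
    (hb : b ∈ t) (hc : c ∈ t) (hab : a ≠ b) (hac : a ≠ c) (hbc : b ≠ c) :
    edgeSign t b c = edgeSign t a b := by
  rw [edgeSign_eq ht ha hb hc hab hac hbc, edgeSign_eq ht hb hc ha hbc hab.symm hac.symm]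
  congr 1
  simp only [cross, PiLp.sub_apply]
  ring

/-- Adjacent triangles are on different sides of the edge, so their positive orientations induce
opposite directions on it. -/
lemma edgeSign_add_eq_zero {s t : Finset Plane} (hs : s ∈ triangles K) (ht : t ∈ triangles K)
    (hst : s ≠ t) {a b : Plane} (hab : a ≠ b) (has : a ∈ s) (hbs : b ∈ s) (hat : a ∈ t)
    (hbt : b ∈ t) : edgeSign s a b + edgeSign t a b = 0 := by
  obtain ⟨c, hc, hac, hbc⟩ := exists_third_vertex hs has hbs hab
  obtain ⟨d, hd, had, hbd⟩ := exists_third_vertex ht hat hbt hab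
  rw [edgeSign_eq hs has hbs hc hab hac hbc, edgeSign_eq ht hat hbt hd hab had hbd]
  rcases mul_neg_iff.1 (cross_mul_cross_neg hs ht hst hab has hbs hc hac hbc hat hbt hd had hbd)
    with ⟨h1, h2⟩ | ⟨h1, h2⟩
  · rw [Real.sign_of_pos h1, Real.sign_of_neg h2]; norm_num
  · rw [Real.sign_of_neg h1, Real.sign_of_pos h2]; norm_num

/-- A function of an ordered edge, summed over a triangle with signs. -/
lemma sum_edgeSign_mul {t : Finset Plane} (ht : t ∈ triangles K) {a b c : Plane} (ha : a ∈ t)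
    (hb : b ∈ t) (hc : c ∈ t) (hab : a ≠ b) (hac : a ≠ c) (hbc : b ≠ c) (m : Plane → Plane → ℝ) :
    ∑ x ∈ t, ∑ y ∈ t, edgeSign t x y * m x y = edgeSign t a b *
      ((m a b - m b a) + (m b c - m c b) + (m c a - m a c)) := by
  simp only [sum_triangle ht ha hb hc hab hac hbc, edgeSign_self]
  have h1 := edgeSign_rotate ht ha hb hc hab hac hbc
  have h2 := edgeSign_rotate ht hb hc ha hbc hab.symm hac.symm
  have h3 := edgeSign_comm t a b
  have h4 := edgeSign_comm t b c
  have h5 := edgeSign_comm t c a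
  rw [h5, h2, h4, h1, h3]
  ring

/-- The boundary of a boundary is zero: one side of the oriented triangle enters the vertex and one
leaves it. -/
lemma sum_edgeSign {t : Finset Plane} (ht : t ∈ triangles K) (a : Plane) :
    ∑ b ∈ t, edgeSign t a b = 0 := by
  by_cases ha : a ∈ t
  · obtain ⟨b, hb, hba⟩ := Finset.exists_mem_ne (by rw [ht.2]; norm_num : 1 < t.card) a
    obtain ⟨c, hc, hac, hbc⟩ := exists_third_vertex ht ha hb hba.symm
    rw [sum_triangle ht ha hb hc hba.symm hac hbc, edgeSign_self, edgeSign_comm t c a,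
      edgeSign_rotate ht hb hc ha hbc hba hac.symm, edgeSign_rotate ht ha hb hc hba.symm hac hbc]
    ring
  · exact Finset.sum_eq_zero fun b _ => edgeSign_of_notMem fun h => ha h.1

end Orientation

/-! ### Chains of triangles and their boundaries -/

section Mesh

variable {Ω : Set Plane} {K : Geometry.SimplicialComplex ℝ Plane}

/-- The coefficient of a shared edge in the boundary of the chain with coefficients `c`: only two
triangles contribute, with opposite signs. -/
lemma sum_triangles_shared {T : Finset (Finset Plane)} (hT : ∀ t, t ∈ T ↔ t ∈ triangles K)
    {s t : Finset Plane} (hs : s ∈ triangles K) (ht : t ∈ triangles K)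
    (hst : s ≠ t) {a b : Plane} (hab : a ≠ b) (has : a ∈ s) (hbs : b ∈ s) (hat : a ∈ t)
    (hbt : b ∈ t) (c : Finset Plane → ℝ) :
    ∑ r ∈ T, c r * edgeSign r a b = (c s - c t) * edgeSign s a b := by
  classical
  have h : ∑ r ∈ T, c r * edgeSign r a b = ∑ r ∈ {s, t}, c r * edgeSign r a b := by
    symm
    refine Finset.sum_subset ?_ ?_
    · intro r hr
      simp only [Finset.mem_insert, Finset.mem_singleton] at hr
      rcases hr with rfl | rfl
      · exact (hT _).2 hs
      · exact (hT _).2 ht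
    · intro r hr hr'
      rw [edgeSign_of_notMem, mul_zero]
      rintro ⟨har, hbr⟩
      refine hr' ?_
      simpa using eq_or_eq_of_edge hs ht ((hT r).1 hr) hst hab has hbs hat hbt har hbr
  rw [h, Finset.sum_pair hst]
  have := edgeSign_add_eq_zero hs ht hst hab has hbs hat hbt
  rw [show edgeSign t a b = - edgeSign s a b by linarith]
  ring

lemma sum_triangles_boundary {T : Finset (Finset Plane)} (hT : ∀ t, t ∈ T ↔ t ∈ triangles K)
    {t : Finset Plane} (ht : t ∈ triangles K) {a b : Plane} (hat : a ∈ t)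
    (hbt : b ∈ t) (hab : ¬ IsSharedEdge K a b) (c : Finset Plane → ℝ) :
    ∑ r ∈ T, c r * edgeSign r a b = c t * edgeSign t a b := by
  refine Finset.sum_eq_single t (fun r hr hrt => ?_) (fun h => absurd ((hT t).2 ht) h)
  rw [edgeSign_of_notMem, mul_zero]
  rintro ⟨har, hbr⟩
  exact hab ⟨r, (hT r).1 hr, t, ht, hrt, har, hbr, hat, hbt⟩

lemma sum_subset_edgeSign {V t : Finset Plane} (htV : t ⊆ V) (m : Plane → Plane → ℝ) :
    ∑ a ∈ V, ∑ b ∈ V, edgeSign t a b * m a b = ∑ a ∈ t, ∑ b ∈ t, edgeSign t a b * m a b := by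
  rw [← Finset.sum_subset htV]
  · refine Finset.sum_congr rfl fun a _ => ?_
    rw [← Finset.sum_subset htV]
    intro b _ hb
    rw [edgeSign_of_notMem (fun h => hb h.2), zero_mul]
  · intro a _ ha
    exact Finset.sum_eq_zero fun b _ => by rw [edgeSign_of_notMem (fun h => ha h.1), zero_mul]

/-- Only arguments with finite support are considered, so a functional is given by its values on
indicator functions, even though the ambient space is infinite-dimensional. -/
lemma linearMap_apply_eq_sum (V : Finset Plane) (ℓ : (Plane → Plane → ℝ) →ₗ[ℝ] ℝ) :
    ∃ m : Plane → Plane → ℝ, ∀ F : Plane → Plane → ℝ, (∀ a b, ¬ (a ∈ V ∧ b ∈ V) → F a b = 0) →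
      ℓ F = ∑ a ∈ V, ∑ b ∈ V, F a b * m a b := by
  classical
  refine ⟨fun a b => ℓ (Pi.single a (Pi.single b 1)), fun F hF => ?_⟩
  have : F = ∑ a ∈ V, ∑ b ∈ V, F a b • Pi.single a (Pi.single b (1 : ℝ)) := by
    funext x y
    simp only [Finset.sum_apply, Pi.smul_apply, Pi.single_apply, smul_eq_mul]
    by_cases hxy : x ∈ V ∧ y ∈ V
    · rw [Finset.sum_eq_single x, Finset.sum_eq_single y]
      · simp
      · intro b _ hb
        simp [hb.symm]
      · exact fun h => absurd hxy.2 h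
      · intro a _ ha
        exact Finset.sum_eq_zero fun b _ => by simp [ha.symm]
      · exact fun h => absurd hxy.1 h
    · rw [hF x y hxy]
      symm
      refine Finset.sum_eq_zero fun a ha => Finset.sum_eq_zero fun b hb => ?_
      by_cases h1 : x = a
      · by_cases h2 : y = b
        · subst h1 h2
          exact absurd ⟨ha, hb⟩ hxy
        · simp [h1, h2]
      · simp [h1]
  conv_lhs => rw [this]
  simp only [map_sum, map_smul, smul_eq_mul]

/-- A set of vertices that contains both or no endpoints of each exterior edge contains the endpoints
of all exterior edges or none. -/
theorem exterior_edges_connected (hreg : interior (closure Ω) = Ω) (hsc : IsSimplyConnected Ω)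
    (hK : IsMacroMesh Ω K) {S : Set Plane}
    (hS : ∀ t ∈ triangles K, ∀ a ∈ t, ∀ b ∈ t, a ≠ b → ¬ IsSharedEdge K a b → a ∈ S → b ∈ S)
    {s t : Finset Plane} (hs : s ∈ triangles K) (ht : t ∈ triangles K) {a b a' b' : Plane}
    (ha : a ∈ s) (hb : b ∈ s) (hab : a ≠ b) (hab' : ¬ IsSharedEdge K a b) (haS : a ∈ S)
    (hat : a' ∈ t) (hbt : b' ∈ t) (hab2 : a' ≠ b') (hab2' : ¬ IsSharedEdge K a' b') : a' ∈ S := by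
  classical
  let T := hK.finite_triangles.toFinset
  have hT : ∀ t, t ∈ T ↔ t ∈ triangles K := fun t => by simp [T]
  let V := hK.finite_vertices.toFinset
  have hV : ∀ x, x ∈ V ↔ x ∈ K.vertices := fun x => by simp [V]
  have hTV : ∀ t ∈ triangles K, t ⊆ V := fun t ht x hx => (hV x).2 (vertex_mem ht hx)
  let χ : Plane → ℝ := fun x => if x ∈ S then 1 else 0
  -- The part of the boundary of the sum of all triangles that is carried by edges with both ends in
  -- `S`.
  let D : Plane → Plane → ℝ := fun x y => χ x * χ y * ∑ t ∈ T, edgeSign t x y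
  have hDcomm : ∀ x y, D y x = - D x y := fun x y => by
    simp only [D]
    rw [mul_comm (χ y), ← mul_neg, ← Finset.sum_neg_distrib]
    congr 1
    exact Finset.sum_congr rfl fun t _ => edgeSign_comm t x y
  have hshared : ∀ x y, x ≠ y → IsSharedEdge K x y → ∑ t ∈ T, edgeSign t x y = 0 := by
    rintro x y hxy ⟨s, hs, t, ht, hst, h1, h2, h3, h4⟩
    simpa using sum_triangles_shared hT hs ht hst hxy h1 h2 h3 h4 fun _ => 1
  have hD0 : ∀ x y, (¬ ∃ t ∈ triangles K, x ∈ t ∧ y ∈ t) → ∑ t ∈ T, edgeSign t x y = 0 := by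
    intro x y h
    refine Finset.sum_eq_zero fun t ht => edgeSign_of_notMem fun h' => h ⟨t, (hT t).1 ht, h'⟩
  have hDV : ∀ x y, ¬ (x ∈ V ∧ y ∈ V) → D x y = 0 := by
    intro x y h
    simp only [D]
    rw [hD0, mul_zero]
    rintro ⟨t, ht, h1, h2⟩
    exact h ⟨hTV t ht h1, hTV t ht h2⟩
  -- `D` is a cycle: no exterior edge leaves `S`, so at a vertex of `S` nothing is cut off from the
  -- full boundary, which is itself a cycle.
  have hDsum : ∀ x, ∑ y ∈ V, D x y = 0 := by
    intro x
    by_cases hx : x ∈ S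
    · have h1 : ∀ y ∈ V, D x y = ∑ t ∈ T, edgeSign t x y := by
        intro y _
        by_cases hy : y ∈ S
        · simp [D, χ, hx, hy]
        · have hxy : x ≠ y := by
            rintro rfl
            exact hy hx
          have : ∑ t ∈ T, edgeSign t x y = 0 := by
            by_cases hsh : IsSharedEdge K x y
            · exact hshared x y hxy hsh
            · refine hD0 x y ?_
              rintro ⟨t, ht, h1, h2⟩
              exact hy (hS t ht x h1 y h2 hxy hsh hx)
          simp only [D]
          rw [this, mul_zero]
      rw [Finset.sum_congr rfl h1, Finset.sum_comm]
      refine Finset.sum_eq_zero fun t ht => ?_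
      rw [← sum_edgeSign ((hT t).1 ht) x]
      symm
      refine Finset.sum_subset (hTV t ((hT t).1 ht)) fun y _ hy => ?_
      exact edgeSign_of_notMem fun h => hy h.2
    · exact Finset.sum_eq_zero fun y _ => by simp [D, χ, hx]
  -- Vanishing of the first homology, by duality. A functional that kills the boundaries of all
  -- triangles antisymmetrizes to a cocycle, hence to a coboundary, and a coboundary pairs to zero
  -- with the cycle `D`.
  have hmem : D ∈ Submodule.span ℝ (edgeSign '' T) := by
    by_contra hD
    obtain ⟨ℓ, hℓD, hℓ⟩ := Submodule.exists_le_ker_of_notMem hD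
    obtain ⟨m, hm⟩ := linearMap_apply_eq_sum V ℓ
    have hcyc : ∀ t ∈ triangles K, ∀ a ∈ t, ∀ b ∈ t, ∀ c ∈ t, a ≠ b → a ≠ c → b ≠ c →
        (m a b - m b a) + (m b c - m c b) + (m c a - m a c) = 0 := by
      intro t ht a ha b hb c hc hab hac hbc
      have h1 : ℓ (edgeSign t) = 0 :=
        hℓ (Submodule.subset_span ⟨t, (hT t).2 ht, rfl⟩)
      rw [hm _ fun x y h => edgeSign_of_notMem fun h' => h ⟨hTV t ht h'.1, hTV t ht h'.2⟩,
        sum_subset_edgeSign (hTV t ht), sum_edgeSign_mul ht ha hb hc hab hac hbc] at h1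
      exact (mul_eq_zero.1 h1).resolve_left (edgeSign_ne_zero ht ha hb hab)
    have hcoc : IsCocycle K fun x y => m x y - m y x := by
      intro t ht a ha b hb c hc
      simp only
      by_cases hab : a = b
      · subst hab; ring
      by_cases hbc : b = c
      · subst hbc; ring
      by_cases hac : a = c
      · subst hac; ring
      linarith [hcyc t ht a ha b hb c hc hab hac hbc]
    obtain ⟨ψ, hψ⟩ := exists_potential hreg hsc hK hcoc
    refine hℓD ?_
    have hψ' : ∀ x y, D x y * (m x y - m y x) = D x y * (ψ y - ψ x) := by
      intro x y
      by_cases h : ∃ t ∈ triangles K, x ∈ t ∧ y ∈ t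
      · obtain ⟨t, ht, hx, hy⟩ := h
        rw [hψ t ht x hx y hy]
      · have : D x y = 0 := by simp only [D]; rw [hD0 x y h, mul_zero]
        rw [this, zero_mul, zero_mul]
    have hanti : ∀ F : Plane → Plane → ℝ, ∑ x ∈ V, ∑ y ∈ V, D x y * F y x =
        - ∑ x ∈ V, ∑ y ∈ V, D x y * F x y := by
      intro F
      rw [Finset.sum_comm, ← Finset.sum_neg_distrib]
      refine Finset.sum_congr rfl fun x _ => ?_
      rw [← Finset.sum_neg_distrib]
      refine Finset.sum_congr rfl fun y _ => ?_
      rw [hDcomm x y]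
      ring
    have e1 : ∑ x ∈ V, ∑ y ∈ V, D x y * (m x y - m y x) =
        ∑ x ∈ V, ∑ y ∈ V, D x y * (ψ y - ψ x) := by simp only [hψ']
    simp only [mul_sub, Finset.sum_sub_distrib] at e1
    have e2 := hanti m
    have e3 := hanti fun x _ => ψ x
    have e4 : ∑ x ∈ V, ∑ y ∈ V, D x y * ψ x = 0 :=
      Finset.sum_eq_zero fun x _ => by rw [← Finset.sum_mul, hDsum, zero_mul]
    rw [hm D hDV]
    linarith
  obtain ⟨c, hc⟩ : ∃ c : Finset Plane → ℝ, ∑ t ∈ T, c t • edgeSign t = D :=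
    (Submodule.mem_span_image_finset_iff_exists_fun' ℝ).1 hmem
  have hc' : ∀ x y, D x y = ∑ t ∈ T, c t * edgeSign t x y := fun x y => by
    rw [← hc]
    simp
  -- `D` vanishes on shared edges, which forces equal coefficients on both sides.
  have hadj : ∀ r r', EdgeAdjacent K r r' → c r = c r' := by
    rintro r r' ⟨hr, hr', x, y, hxy, h1, h2, h3, h4⟩
    by_contra hne
    have hrr : r ≠ r' := fun h => hne (h ▸ rfl)
    have h := hc' x y
    rw [sum_triangles_shared hT hr hr' hrr hxy h1 h2 h3 h4] at h
    simp only [D] at h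
    rw [hshared x y hxy ⟨r, hr, r', hr', hrr, h1, h2, h3, h4⟩, mul_zero] at h
    rcases mul_eq_zero.1 h.symm with h | h
    · exact hne (sub_eq_zero.1 h)
    · exact edgeSign_ne_zero hr h1 h2 hxy h
  have hchain : ∀ r, Relation.ReflTransGen (EdgeAdjacent K) s r → c s = c r := by
    intro r h
    induction h with
    | refl => rfl
    | tail _ h ih => exact ih.trans (hadj _ _ h)
  have hcst := hchain t (hK.edgeConnected hsc.isPathConnected.isConnected hs ht)
  -- On an exterior edge both chains can be read off from the single triangle there; so the constant
  -- coefficient is 1 if the edge is in `S` and 0 if `a'` is not.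
  have hbd : ∀ t ∈ triangles K, ∀ x ∈ t, ∀ y ∈ t, x ≠ y → ¬ IsSharedEdge K x y →
      c t = χ x * χ y := by
    intro t ht x hx y hy hxy hsh
    have h := hc' x y
    rw [sum_triangles_boundary hT ht hx hy hsh] at h
    have h2 := sum_triangles_boundary hT ht hx hy hsh fun _ => 1
    simp only [one_mul] at h2
    simp only [D] at h
    rw [h2] at h
    exact (mul_right_cancel₀ (edgeSign_ne_zero ht hx hy hxy) h).symm
  have h1 := hbd s hs a ha b hb hab hab'
  have h2 := hbd t ht a' hat b' hbt hab2 hab2'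
  have hbS := hS s hs a ha b hb hab hab' haS
  by_contra hcon
  have h3 : c s = 1 := by rw [h1]; simp [χ, haS, hbS]
  have h4 : c t = 0 := by rw [h2]; simp [χ, hcon]
  linarith

end Mesh

/-! ### The discrete space -/

/-- The strict versions of the inequalities in `mem_micro_iff` define an open set that contains the
centroid of the part. An open set is needed to test the divergence. -/
lemma interior_micro_nonempty (b : AffineBasis (Fin 3) ℝ Plane) {c p : Plane} {i j k : Fin 3}
    (hij : i ≠ j) (hik : i ≠ k) (hjk : j ≠ k) (hc : ∀ l, 0 < b.coord l c) (hpk : b.coord k p = 0)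
    (hpi : 0 < b.coord i p) (hpj : 0 < b.coord j p) :
    (interior (convexHull ℝ {c, b i, p})).Nonempty := by
  have hcont : ∀ l, Continuous (b.coord l) := fun l => (b.coord l).continuous_of_finiteDimensional
  have hi := hcont i
  have hj := hcont j
  have hk := hcont k
  have h2 : Continuous fun x => b.coord j x * b.coord k c - b.coord j c * b.coord k x := by fun_prop
  have h3 : Continuous fun x =>
      (b.coord i x * b.coord k c - b.coord i c * b.coord k x) * b.coord j p -
      (b.coord j x * b.coord k c - b.coord j c * b.coord k x) * b.coord i p := by fun_prop
  have hU := (isOpen_lt (continuous_const (y := (0 : ℝ))) hk).inter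
    ((isOpen_lt (continuous_const (y := (0 : ℝ))) h2).inter
      (isOpen_lt (continuous_const (y := (0 : ℝ))) h3))
  refine Set.Nonempty.mono (interior_maximal (fun x hx => ?_) hU)
    ⟨(1 / 3 : ℝ) • c + (1 / 3 : ℝ) • b i + (1 / 3 : ℝ) • p, ?_⟩
  · obtain ⟨h1, h2, h3⟩ := hx
    rw [mem_micro_iff b hij hik hjk hc hpk hpi hpj]
    exact ⟨le_of_lt h1, le_of_lt h2, sub_nonneg.1 (le_of_lt h3)⟩
  · have e : ∀ l, b.coord l ((1 / 3 : ℝ) • c + (1 / 3 : ℝ) • b i + (1 / 3 : ℝ) • p) =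
        (1 / 3) * b.coord l c + (1 / 3) * b.coord l (b i) + (1 / 3) * b.coord l p := fun l => by
      rw [affineMap_combination _ (by norm_num)]; rfl
    have hjk' := mul_pos hpj (hc k)
    have hik' := mul_pos hpi (hc k)
    have := hc k
    simp only [mem_inter_iff, mem_ofPred_eq, e, hpk, AffineBasis.coord_apply_ne _ hik.symm,
      AffineBasis.coord_apply_ne _ hij.symm, AffineBasis.coord_apply_eq]
    refine ⟨by linarith, by linarith, by nlinarith⟩

/-- `a` and `b` are the endpoints of an edge. -/
def IsEdge (K : Geometry.SimplicialComplex ℝ Plane) (a b : Plane) : Prop :=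
  a ≠ b ∧ ∃ t ∈ triangles K, a ∈ t ∧ b ∈ t

lemma IsEdge.symm {K : Geometry.SimplicialComplex ℝ Plane} {a b : Plane} (h : IsEdge K a b) :
    IsEdge K b a := by
  obtain ⟨hab, t, ht, ha, hb⟩ := h
  exact ⟨hab.symm, t, ht, hb, ha⟩

/-- The point that divides the edge from `a` to `b` in the ratio `σ a b : 1 - σ a b`. -/
def splitPoint (σ : Plane → Plane → ℝ) (a b : Plane) : Plane := AffineMap.lineMap a b (σ a b)

/-- `σ` describes the split points of all edges. -/
structure IsSplitRatio (Ω : Set Plane) (K : Geometry.SimplicialComplex ℝ Plane)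
    (σ : Plane → Plane → ℝ) : Prop where
  pos : ∀ {a b}, IsEdge K a b → 0 < σ a b
  lt_one : ∀ {a b}, IsEdge K a b → σ a b < 1
  isSplitPoint_iff : ∀ {a b}, IsEdge K a b → ∀ p, IsSplitPoint Ω K a b p ↔ p = splitPoint σ a b
  cross_eq_zero : ∀ {a b}, IsEdge K a b → ∀ s ∈ triangles K, ∀ t ∈ triangles K, a ∈ s → b ∈ s →
    a ∈ t → b ∈ t → cross (incenter s - splitPoint σ a b) (incenter t - splitPoint σ a b) = 0

lemma exists_isSplitRatio {Ω : Set Plane} {K : Geometry.SimplicialComplex ℝ Plane} (hopen : IsOpen Ω)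
    (hreg : interior (closure Ω) = Ω) (hK : IsMacroMesh Ω K) : ∃ σ, IsSplitRatio Ω K σ := by
  have h : ∀ a b, IsEdge K a b → _ := fun a b ⟨hab, t, ht, ha, hb⟩ =>
    exists_split hopen hreg hK ht ha hb hab
  choose! σ h1 h2 h3 h4 using h
  exact ⟨σ, h1 _ _, h2 _ _, h3 _ _, h4 _ _⟩

lemma isSplitPoint_comm {Ω : Set Plane} {K : Geometry.SimplicialComplex ℝ Plane} {a b p : Plane}
    (h : IsSplitPoint Ω K a b p) : IsSplitPoint Ω K b a p := by
  rcases h with ⟨h, rfl⟩ | ⟨h, s, hs, t, ht, hst, h1, h2, h3, h4, h5, h6⟩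
  · exact .inl ⟨by rwa [segment_symm], midpoint_comm a b⟩
  · exact .inr ⟨by rwa [segment_symm], s, hs, t, ht, hst, h2, h1, h4, h3, by rwa [segment_symm], h6⟩

lemma edgeFlux_comm (σ : ℝ) (u v u' e : Plane) :
    edgeFlux (1 - σ) u' v u (-e) = - edgeFlux σ u v u' e := by
  simp only [edgeFlux, cross, PiLp.neg_apply, PiLp.add_apply, PiLp.smul_apply, smul_eq_mul]
  ring

/-- Separates the value at the split point from those at the ends: a given flux prescribes the
determinant of `v` with the edge. -/
lemma edgeFlux_eq (σ : ℝ) (u v u' e : Plane) :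
    2 * edgeFlux σ u v u' e = cross e v + cross e (σ • u + (1 - σ) • u') := by
  simp only [edgeFlux, cross, PiLp.add_apply, PiLp.smul_apply, smul_eq_mul]
  ring

namespace IsSplitRatio

variable {Ω : Set Plane} {K : Geometry.SimplicialComplex ℝ Plane} {σ : Plane → Plane → ℝ}
  (hσ : IsSplitRatio Ω K σ)
include hσ

lemma splitPoint_comm {a b : Plane} (h : IsEdge K a b) : splitPoint σ b a = splitPoint σ a b :=
  (hσ.isSplitPoint_iff h _).1 (isSplitPoint_comm ((hσ.isSplitPoint_iff h.symm _).2 rfl))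

lemma ratio_comm {a b : Plane} (h : IsEdge K a b) : σ b a = 1 - σ a b := by
  have h1 := hσ.splitPoint_comm h
  rw [splitPoint, splitPoint, ← AffineMap.lineMap_apply_one_sub] at h1
  have := AffineMap.lineMap_injective ℝ h.1 h1
  linarith

lemma splitPoint_mem {a b : Plane} (h : IsEdge K a b) : splitPoint σ a b ∈ segment ℝ a b := by
  rw [segment_eq_image_lineMap]
  exact ⟨_, ⟨(hσ.pos h).le, (hσ.lt_one h).le⟩, rfl⟩

lemma mem_fineTriangles_iff {T : Set Plane} : T ∈ fineTriangles Ω K ↔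
    ∃ t ∈ triangles K, ∃ a ∈ t, ∃ b ∈ t, a ≠ b ∧
      T = convexHull ℝ {incenter t, a, splitPoint σ a b} := by
  constructor
  · rintro ⟨t, ht, a, ha, b, hb, hab, p, hp, rfl⟩
    rw [hσ.isSplitPoint_iff ⟨hab, t, ht, ha, hb⟩] at hp
    exact ⟨t, ht, a, ha, b, hb, hab, by rw [hp]⟩
  · rintro ⟨t, ht, a, ha, b, hb, hab, rfl⟩
    exact ⟨t, ht, a, ha, b, hb, hab, _, (hσ.isSplitPoint_iff ⟨hab, t, ht, ha, hb⟩ _).2 rfl, rfl⟩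

lemma finite_fineTriangles (hK : IsMacroMesh Ω K) : (fineTriangles Ω K).Finite := by
  refine ((hK.finite_triangles.prod (hK.finite_vertices.prod hK.finite_vertices)).image
    fun q : Finset Plane × Plane × Plane =>
      convexHull ℝ {incenter q.1, q.2.1, splitPoint σ q.2.1 q.2.2}).subset fun T hT => ?_
  obtain ⟨t, ht, a, ha, b, hb, -, rfl⟩ := hσ.mem_fineTriangles_iff.1 hT
  exact ⟨(t, a, b), ⟨ht, vertex_mem ht ha, vertex_mem ht hb⟩, rfl⟩

lemma fineTriangle_convex {T : Set Plane} (hT : T ∈ fineTriangles Ω K) : Convex ℝ T := by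
  obtain ⟨t, ht, a, ha, b, hb, -, rfl⟩ := hσ.mem_fineTriangles_iff.1 hT
  exact convex_convexHull ℝ _

lemma fineTriangle_isClosed {T : Set Plane} (hT : T ∈ fineTriangles Ω K) : IsClosed T := by
  obtain ⟨t, ht, a, ha, b, hb, -, rfl⟩ := hσ.mem_fineTriangles_iff.1 hT
  exact (Set.toFinite {incenter t, a, splitPoint σ a b}).isClosed_convexHull ℝ

section Basis

variable {t : Finset Plane} {B : AffineBasis (Fin 3) ℝ Plane}

omit hσ in
lemma isEdge_basis (ht : t ∈ triangles K) (hB : range B = (t : Set Plane)) {i j : Fin 3}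
    (hij : i ≠ j) : IsEdge K (B i) (B j) :=
  ⟨basis_ne B hij, t, ht, basis_mem hB i, basis_mem hB j⟩

omit hσ in
lemma isEdge_succ (ht : t ∈ triangles K) (hB : range B = (t : Set Plane)) (k : Fin 3) :
    IsEdge K (B (k + 1)) (B (k + 2)) :=
  isEdge_basis ht hB (by simp)

lemma splitPoint_basis (ht : t ∈ triangles K) (hB : range B = (t : Set Plane)) {i j k : Fin 3}
    (hij : i ≠ j) (hik : i ≠ k) (hjk : j ≠ k) :
    splitPoint σ (B i) (B j) = splitPoint σ (B (k + 1)) (B (k + 2)) := by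
  rcases succ_eq_or hij hik hjk with ⟨rfl, rfl⟩ | ⟨rfl, rfl⟩
  · rfl
  · exact hσ.splitPoint_comm (isEdge_succ ht hB k)

lemma ratio_basis (ht : t ∈ triangles K) (hB : range B = (t : Set Plane)) (k : Fin 3) :
    0 < σ (B (k + 1)) (B (k + 2)) ∧ σ (B (k + 1)) (B (k + 2)) < 1 :=
  ⟨hσ.pos (isEdge_succ ht hB k), hσ.lt_one (isEdge_succ ht hB k)⟩

lemma mem_fineTriangles (ht : t ∈ triangles K) (hB : range B = (t : Set Plane)) {i k : Fin 3}
    (hik : i ≠ k) : convexHull ℝ {incenter t, B i, splitPoint σ (B (k + 1)) (B (k + 2))} ∈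
      fineTriangles Ω K := by
  obtain ⟨j, hij, hjk⟩ := exists_third hik
  rw [hσ.mem_fineTriangles_iff]
  exact ⟨t, ht, B i, basis_mem hB i, B j, basis_mem hB j, basis_ne B hij, by
    rw [hσ.splitPoint_basis ht hB hij hik hjk]⟩

end Basis

lemma fineTriangle_subset {t : Finset Plane} (ht : t ∈ triangles K) {a b : Plane}
    (ha : a ∈ t) (hb : b ∈ t) (hab : a ≠ b) :
    convexHull ℝ {incenter t, a, splitPoint σ a b} ⊆ convexHull ℝ (t : Set Plane) := by
  refine convexHull_min ?_ (convex_convexHull ℝ _)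
  rintro x (rfl | rfl | rfl)
  · obtain ⟨B, hB⟩ := exists_affineBasis' ht
    exact (mem_convexHull_iff_coord hB).2 fun i => (coord_incenter_pos ht hB i).le
  · exact subset_convexHull ℝ _ ha
  · exact segment_subset_convexHull (Finset.mem_coe.2 ha) (Finset.mem_coe.2 hb)
      (hσ.splitPoint_mem ⟨hab, t, ht, ha, hb⟩)

lemma exists_fineTriangle {t : Finset Plane} (ht : t ∈ triangles K) {x : Plane}
    (hx : x ∈ convexHull ℝ (t : Set Plane)) :
    ∃ a ∈ t, ∃ b ∈ t, a ≠ b ∧ x ∈ convexHull ℝ {incenter t, a, splitPoint σ a b} := by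
  obtain ⟨B, hB⟩ := exists_affineBasis' ht
  obtain ⟨k, i, hik, h⟩ := exists_mem_micro B (c := incenter t)
    (p := fun k => splitPoint σ (B (k + 1)) (B (k + 2))) (coord_incenter_pos ht hB)
    (coord_split_self B fun _ => rfl) (coord_split_pos B (hσ.ratio_basis ht hB) fun _ => rfl)
    ((mem_convexHull_iff_coord hB).1 hx)
  obtain ⟨j, hij, hjk⟩ := exists_third hik
  exact ⟨B i, basis_mem hB i, B j, basis_mem hB j, basis_ne B hij, by
    rwa [hσ.splitPoint_basis ht hB hij hik hjk]⟩

lemma closure_subset (hK : IsMacroMesh Ω K) : closure Ω ⊆ ⋃₀ fineTriangles Ω K := by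
  intro x hx
  obtain ⟨t, ht, hxt⟩ := hK.mem_closure_iff.1 hx
  obtain ⟨a, ha, b, hb, hab, h⟩ := hσ.exists_fineTriangle ht hxt
  exact ⟨_, hσ.mem_fineTriangles_iff.2 ⟨t, ht, a, ha, b, hb, hab, rfl⟩, h⟩

/-- A field in `Vh` is affine and divergence-free on each part of a triangle. -/
lemma exists_affine_of_mem_Vh (hreg : interior (closure Ω) = Ω) (hK : IsMacroMesh Ω K)
    {v : Plane → Plane} (hv : v ∈ Vh Ω K) {t : Finset Plane} (ht : t ∈ triangles K)
    {B : AffineBasis (Fin 3) ℝ Plane} (hB : range B = (t : Set Plane)) {i k : Fin 3} (hik : i ≠ k) :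
    ∃ g : Plane →ᵃ[ℝ] Plane, divg g = 0 ∧
      EqOn v g (convexHull ℝ {incenter t, B i, splitPoint σ (B (k + 1)) (B (k + 2))}) := by
  obtain ⟨g, hg⟩ := hv.1.2.2 _ (hσ.mem_fineTriangles ht hB hik)
  refine ⟨g, ?_, hg⟩
  obtain ⟨j, hij, hjk⟩ := exists_third hik
  have hppos := coord_split_pos B (hσ.ratio_basis ht hB)
    (p := fun k => splitPoint σ (B (k + 1)) (B (k + 2))) fun _ => rfl
  have hpk := coord_split_self B
    (p := fun k => splitPoint σ (B (k + 1)) (B (k + 2))) (fun _ => rfl) k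
  have hne := interior_micro_nonempty B hij hik hjk (coord_incenter_pos ht hB) hpk (hppos k i hik)
    (hppos k j hjk)
  have hsub := hσ.fineTriangle_subset ht (basis_mem hB i) (basis_mem hB j) (basis_ne B hij)
  rw [hσ.splitPoint_basis ht hB hij hik hjk] at hsub
  exact divg_eq_zero_of_isSolenoidal hv.2 isOpen_interior hne
    ((interior_mono (hsub.trans (hK.convexHull_subset ht))).trans hreg.subset)
    (hg.mono interior_subset)

lemma nodalDivFree_of_mem_Vh (hreg : interior (closure Ω) = Ω) (hK : IsMacroMesh Ω K)
    {v : Plane → Plane} (hv : v ∈ Vh Ω K) {t : Finset Plane} (ht : t ∈ triangles K)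
    {B : AffineBasis (Fin 3) ℝ Plane} (hB : range B = (t : Set Plane)) {k i : Fin 3} (hik : i ≠ k) :
    NodalDivFree B (incenter t) (fun k => splitPoint σ (B (k + 1)) (B (k + 2))) (fun i => v (B i))
      (fun k => v (splitPoint σ (B (k + 1)) (B (k + 2)))) (v (incenter t)) k i := by
  obtain ⟨g, hg0, hg⟩ := hσ.exists_affine_of_mem_Vh hreg hK hv ht hB hik
  exact (divg_eq_zero_iff (u := fun i => v (B i)) (coord_incenter_pos ht hB) (hσ.ratio_basis ht hB)
    (p := fun k => splitPoint σ (B (k + 1)) (B (k + 2))) (v := fun k => v (splitPoint σ (B (k + 1))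
    (B (k + 2)))) (fun _ => rfl) hik (hg (subset_convexHull ℝ _ (Or.inl rfl))).symm
    (hg (subset_convexHull ℝ _ (Or.inr (Or.inl rfl)))).symm
    (hg (subset_convexHull ℝ _ (Or.inr (Or.inr rfl)))).symm).1 hg0

end IsSplitRatio

/-! ### Fluxes of discrete fields -/

lemma integral_of_affine {F : ℝ → ℝ} {x y α β : ℝ} (hxy : x ≤ y)
    (h : ∀ t ∈ Icc x y, F t = α + β * t) :
    IntervalIntegrable F volume x y ∧ ∫ t in x..y, F t = (y - x) * (F x + F y) / 2 := by
  have hc : Continuous fun t : ℝ => α + β * t := by fun_prop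
  have e : EqOn F (fun t => α + β * t) (uIcc x y) := fun t ht => h t (by rwa [uIcc_of_le hxy] at ht)
  refine ⟨(hc.intervalIntegrable x y).congr (fun t ht => (e (uIoc_subset_uIcc ht)).symm), ?_⟩
  rw [intervalIntegral.integral_congr e, h x (left_mem_Icc.2 hxy), h y (right_mem_Icc.2 hxy),
    intervalIntegral.integral_add (continuous_const.intervalIntegrable x y)
      ((continuous_const_mul β).intervalIntegrable x y), intervalIntegral.integral_const_mul,
    integral_id, intervalIntegral.integral_const, smul_eq_mul]
  ring

lemma cross_affine_lineMap (e a b : Plane) (g : Plane →ᵃ[ℝ] Plane) (t : ℝ) :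
    cross e (g (AffineMap.lineMap a b t)) = cross e (g a) + cross e (g b - g a) * t := by
  rw [AffineMap.apply_lineMap, AffineMap.lineMap_apply, vsub_eq_sub, vadd_eq_add, cross_add_right,
    cross_smul_right]
  ring

lemma lineMap_mem_segment_left {a b : Plane} {s t : ℝ} (h0 : 0 ≤ t) (hts : t ≤ s) :
    AffineMap.lineMap a b t ∈ segment ℝ a (AffineMap.lineMap a b s) := by
  rw [segment_eq_image_lineMap]
  rcases h0.eq_or_lt with rfl | h0
  · exact ⟨0, by simp, by simp⟩
  · have hs : 0 < s := h0.trans_le hts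
    refine ⟨t / s, ⟨by positivity, (div_le_one hs).2 hts⟩, ?_⟩
    rw [AffineMap.lineMap_lineMap_right, div_mul_cancel₀ _ hs.ne']

lemma lineMap_mem_segment_right {a b : Plane} {s t : ℝ} (hst : s ≤ t) (h1 : t ≤ 1) :
    AffineMap.lineMap a b t ∈ segment ℝ b (AffineMap.lineMap a b s) := by
  rw [← AffineMap.lineMap_apply_one_sub b a s, ← AffineMap.lineMap_apply_one_sub b a t]
  exact lineMap_mem_segment_left (by linarith) (by linarith)

/-- The integrand is affine on each of the two parts, where the trapezoidal rule is exact. -/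
lemma flux_eq_edgeFlux {v : Plane → Plane} {a b : Plane} {s : ℝ} (hs0 : 0 ≤ s) (hs1 : s ≤ 1)
    {g h : Plane →ᵃ[ℝ] Plane} (hg : EqOn v g (segment ℝ a (AffineMap.lineMap a b s)))
    (hh : EqOn v h (segment ℝ b (AffineMap.lineMap a b s))) :
    flux v a b = edgeFlux s (v a) (v (AffineMap.lineMap a b s)) (v b) (b - a) := by
  have h1 := integral_of_affine (F := fun t => cross (b - a) (v (AffineMap.lineMap a b t))) hs0
    fun t ht => by
      simp only [hg (lineMap_mem_segment_left ht.1 ht.2)]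
      exact cross_affine_lineMap _ _ _ _ _
  have h2 := integral_of_affine (F := fun t => cross (b - a) (v (AffineMap.lineMap a b t))) hs1
    fun t ht => by
      simp only [hh (lineMap_mem_segment_right ht.1 ht.2)]
      exact cross_affine_lineMap _ _ _ _ _
  simp only [flux, inner_rot]
  rw [← intervalIntegral.integral_add_adjacent_intervals h1.1 h2.1, h1.2, h2.2]
  simp only [AffineMap.lineMap_apply_zero, AffineMap.lineMap_apply_one, edgeFlux, cross_add_right,
    cross_smul_right]
  ring

/-- The flux through an edge of a field that is affine on its two parts. -/
def fluxMap (σ : Plane → Plane → ℝ) (a b : Plane) : (Plane → Plane) →ₗ[ℝ] ℝ where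
  toFun v := edgeFlux (σ a b) (v a) (v (splitPoint σ a b)) (v b) (b - a)
  map_add' v w := by
    simp only [edgeFlux, Pi.add_apply, cross_add_right, cross_smul_right]
    ring
  map_smul' c v := by
    simp only [edgeFlux, Pi.smul_apply, cross_add_right, cross_smul_right, RingHom.id_apply,
      smul_eq_mul]
    ring

lemma fluxMap_apply (σ : Plane → Plane → ℝ) (a b : Plane) (v : Plane → Plane) :
    fluxMap σ a b v = edgeFlux (σ a b) (v a) (v (splitPoint σ a b)) (v b) (b - a) := rfl

lemma fluxMap_self (σ : Plane → Plane → ℝ) (a : Plane) (v : Plane → Plane) : fluxMap σ a a v = 0 := by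
  rw [fluxMap_apply, sub_self, edgeFlux, cross_zero_left, zero_div]

namespace IsSplitRatio

variable {Ω : Set Plane} {K : Geometry.SimplicialComplex ℝ Plane} {σ : Plane → Plane → ℝ}
  (hσ : IsSplitRatio Ω K σ)
include hσ

lemma fluxMap_comm {a b : Plane} (h : IsEdge K a b) (v : Plane → Plane) :
    fluxMap σ b a v = - fluxMap σ a b v := by
  rw [fluxMap_apply, fluxMap_apply, ← edgeFlux_comm, hσ.ratio_comm h, hσ.splitPoint_comm h, neg_sub]

/-- A field in `Xh` is affine on the two parts of an edge. -/
lemma exists_affine_of_mem_Xh {v : Plane → Plane} (hv : v ∈ Xh Ω K) {a b : Plane}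
    (h : IsEdge K a b) : ∃ g : Plane →ᵃ[ℝ] Plane, EqOn v g (segment ℝ a (splitPoint σ a b)) := by
  obtain ⟨hab, t, ht, ha, hb⟩ := h
  obtain ⟨g, hg⟩ := hv.2.2 _ (hσ.mem_fineTriangles_iff.2 ⟨t, ht, a, ha, b, hb, hab, rfl⟩)
  exact ⟨g, hg.mono (segment_subset_convexHull (Or.inr (Or.inl rfl)) (Or.inr (Or.inr rfl)))⟩

lemma flux_eq {v : Plane → Plane} (hv : v ∈ Xh Ω K) {a b : Plane} (h : IsEdge K a b) :
    flux v a b = fluxMap σ a b v := by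
  obtain ⟨g, hg⟩ := hσ.exists_affine_of_mem_Xh hv h
  obtain ⟨g', hg'⟩ := hσ.exists_affine_of_mem_Xh hv h.symm
  rw [hσ.splitPoint_comm h] at hg'
  exact flux_eq_edgeFlux (hσ.pos h).le (hσ.lt_one h).le hg hg'

/-- The fluxes of a solenoidal field through the edges come from a potential. -/
lemma exists_fluxMap_potential (hreg : interior (closure Ω) = Ω) (hsc : IsSimplyConnected Ω)
    (hK : IsMacroMesh Ω K) {v : Plane → Plane} (hv : v ∈ Vh Ω K) :
    ∃ ψ : Plane → ℝ, ∀ a b, IsEdge K a b → fluxMap σ a b v = ψ a - ψ b := by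
  -- For three distinct vertices the cocycle condition is the divergence theorem on the triangle,
  -- after one edge is reversed.
  have hθ : IsCocycle K fun a b => fluxMap σ a b v := by
    intro t ht a ha b hb c hc
    by_cases hab : a = b
    · subst hab
      simp [fluxMap_self]
    by_cases hbc : b = c
    · subst hbc
      simp [fluxMap_self]
    by_cases hac : a = c
    · subst hac
      simp only [hσ.fluxMap_comm ⟨hab, t, ht, ha, hb⟩, fluxMap_self, add_neg_cancel]
    obtain ⟨B, hB, rfl, rfl⟩ := exists_affineBasis ht ha hb hab
    obtain ⟨l, rfl⟩ := exists_basis_eq hB hc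
    have hl : l = 0 := by
      rcases eq_zero_or l with rfl | rfl | rfl
      · rfl
      · exact absurd rfl hac
      · exact absurd rfl hbc
    subst hl
    have := sum_edgeFlux_eq_zero (p := fun k => splitPoint σ (B (k + 1)) (B (k + 2)))
      (fun _ => rfl) fun k i hik => hσ.nodalDivFree_of_mem_Vh hreg hK hv ht hB hik
    rw [Fin.sum_univ_three] at this
    change fluxMap σ (B 1) (B 2) v + fluxMap σ (B 2) (B 0) v + fluxMap σ (B 0) (B 1) v = 0 at this
    rw [hσ.fluxMap_comm (isEdge_basis ht hB (by decide : (1 : Fin 3) ≠ 0)) v] at this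
    linarith
  obtain ⟨ψ, hψ⟩ := exists_potential hreg hsc hK hθ
  -- The sign is chosen so that the third local function has the indicator of its vertex as
  -- potential.
  refine ⟨fun x => - ψ x, fun a b ⟨_, t, ht, ha, hb⟩ => ?_⟩
  have := hψ t ht a ha b hb
  linarith

/-- Zero flux makes the value parallel to the edge, and zero divergence makes it parallel to the
line to the incenter. These directions are independent. -/
lemma splitPoint_value_eq_zero (hreg : interior (closure Ω) = Ω) (hK : IsMacroMesh Ω K)
    {v : Plane → Plane} (hv : v ∈ Vh Ω K) {a b : Plane} (h : IsEdge K a b) (ha0 : v a = 0)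
    (hb0 : v b = 0) (hf : fluxMap σ a b v = 0) : v (splitPoint σ a b) = 0 := by
  obtain ⟨hab, t, ht, ha, hb⟩ := h
  obtain ⟨B, hB, rfl, rfl⟩ := exists_affineBasis ht ha hb hab
  have h1 := ((nodalDivFree_iff (p := fun k => splitPoint σ (B (k + 1)) (B (k + 2)))
    (fun _ => rfl)).1 fun i (hi : i ≠ 0) => hσ.nodalDivFree_of_mem_Vh hreg hK hv ht hB hi).1
  have h2 := cross_edge_ne_zero (p := fun k => splitPoint σ (B (k + 1)) (B (k + 2)))
    (coord_incenter_pos ht hB) (fun _ => rfl) 0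
  simp only [zero_add, ha0, hb0, AffineMap.lineMap_same_apply, sub_zero] at h1 h2
  have h3 := edgeFlux_eq (σ (B 1) (B 2)) (v (B 1)) (v (splitPoint σ (B 1) (B 2))) (v (B 2))
    (B 2 - B 1)
  rw [← fluxMap_apply, hf, ha0, hb0] at h3
  simp only [mul_zero, smul_zero, add_zero, cross_zero_right] at h3
  exact eq_zero_of_cross h2 h3.symm (by rw [cross_comm, h1, neg_zero])

lemma eq_zero_on_edge (hreg : interior (closure Ω) = Ω) (hK : IsMacroMesh Ω K)
    {v : Plane → Plane} (hv : v ∈ Vh Ω K) {a b : Plane} (h : IsEdge K a b) (ha0 : v a = 0)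
    (hb0 : v b = 0) (hf : fluxMap σ a b v = 0) : ∀ x ∈ segment ℝ a b, v x = 0 := by
  have hp := hσ.splitPoint_value_eq_zero hreg hK hv h ha0 hb0 hf
  have key : ∀ c d, IsEdge K c d → v c = 0 → v (splitPoint σ c d) = 0 →
      ∀ x ∈ segment ℝ c (splitPoint σ c d), v x = 0 := by
    intro c d hcd hc0 hd0 x hx
    obtain ⟨g, hg⟩ := hσ.exists_affine_of_mem_Xh hv.1 hcd
    rw [hg (left_mem_segment ..)] at hc0
    rw [hg (right_mem_segment ..)] at hd0
    rw [hg hx]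
    rw [segment_eq_image_lineMap] at hx
    obtain ⟨τ, -, rfl⟩ := hx
    rw [AffineMap.apply_lineMap, hc0, hd0, AffineMap.lineMap_same_apply]
  intro x hx
  rw [segment_eq_image_lineMap] at hx
  obtain ⟨τ, hτ, rfl⟩ := hx
  rcases le_total τ (σ a b) with h1 | h1
  · exact key a b h ha0 hp _ (lineMap_mem_segment_left hτ.1 h1)
  · refine key b a h.symm hb0 (by rwa [hσ.splitPoint_comm h]) _ ?_
    rw [hσ.splitPoint_comm h]
    exact lineMap_mem_segment_right h1 hτ.2

lemma eq_zero_on_triangle (hreg : interior (closure Ω) = Ω) (hK : IsMacroMesh Ω K)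
    {v : Plane → Plane} (hv : v ∈ Vh Ω K) {t : Finset Plane} (ht : t ∈ triangles K)
    (h0 : ∀ a ∈ t, v a = 0) (hf : ∀ a ∈ t, ∀ b ∈ t, a ≠ b → fluxMap σ a b v = 0) :
    ∀ x ∈ convexHull ℝ (t : Set Plane), v x = 0 := by
  have hp : ∀ a ∈ t, ∀ b ∈ t, a ≠ b → v (splitPoint σ a b) = 0 := fun a ha b hb hab =>
    hσ.splitPoint_value_eq_zero hreg hK hv ⟨hab, t, ht, ha, hb⟩ (h0 a ha) (h0 b hb) (hf a ha b hb hab)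
  have hc : v (incenter t) = 0 := by
    obtain ⟨B, hB⟩ := exists_affineBasis' ht
    refine inner_value_eq_zero (b := B) (c := incenter t)
      (p := fun k => splitPoint σ (B (k + 1)) (B (k + 2))) (fun _ => rfl) fun k i hik => ?_
    have := hσ.nodalDivFree_of_mem_Vh hreg hK hv ht hB hik
    convert this using 1
    · funext i
      exact (h0 _ (basis_mem hB i)).symm
    · funext k
      exact (hp _ (basis_mem hB _) _ (basis_mem hB _) (isEdge_succ ht hB k).1).symm
  intro x hx
  obtain ⟨a, ha, b, hb, hab, hx⟩ := hσ.exists_fineTriangle ht hx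
  obtain ⟨g, hg⟩ := hv.1.2.2 _ (hσ.mem_fineTriangles_iff.2 ⟨t, ht, a, ha, b, hb, hab, rfl⟩)
  rw [hg hx]
  have h1 := hp a ha b hb hab
  have h2 := h0 a ha
  rw [hg (subset_convexHull ℝ _ (Or.inr (Or.inr rfl)))] at h1
  rw [hg (subset_convexHull ℝ _ (Or.inr (Or.inl rfl)))] at h2
  rw [hg (subset_convexHull ℝ _ (Or.inl rfl))] at hc
  obtain ⟨α, β, γ, -, -, -, h, rfl⟩ := mem_convexHull_triple.1 hx
  rw [affineMap_combination g h, h1, h2, hc]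
  simp

lemma eq_zero_on_face (hreg : interior (closure Ω) = Ω) (hK : IsMacroMesh Ω K)
    {v : Plane → Plane} (hv : v ∈ Vh Ω K) {s : Finset Plane} (hs : s ∈ K.faces)
    (h0 : ∀ a ∈ s, v a = 0) (hf : ∀ a ∈ s, ∀ b ∈ s, a ≠ b → fluxMap σ a b v = 0) :
    ∀ x ∈ convexHull ℝ (s : Set Plane), v x = 0 := by
  classical
  obtain ⟨t, ht, hst⟩ := hK.pure s hs
  have hcard := Finset.card_le_card hst
  rw [ht.2] at hcard
  have hpos := Finset.card_pos.2 (K.nonempty_of_mem_faces hs)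
  obtain h | h | h : s.card = 1 ∨ s.card = 2 ∨ s.card = 3 := by omega
  · obtain ⟨a, rfl⟩ := Finset.card_eq_one.1 h
    simpa using h0
  · obtain ⟨a, b, hab, rfl⟩ := Finset.card_eq_two.1 h
    rw [Finset.coe_pair, convexHull_pair]
    exact hσ.eq_zero_on_edge hreg hK hv ⟨hab, t, ht, hst (by simp), hst (by simp)⟩ (h0 a (by simp))
      (h0 b (by simp)) (hf a (by simp) b (by simp) hab)
  · exact hσ.eq_zero_on_triangle hreg hK hv ⟨hs, h⟩ h0 hf

/-- A field in `Vh` is determined by the values at the vertices and the fluxes through the edges. -/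
lemma eq_of_mem_Vh (hreg : interior (closure Ω) = Ω) (hK : IsMacroMesh Ω K) {v w : Plane → Plane}
    (hv : v ∈ Vh Ω K) (hw : w ∈ Vh Ω K) (h0 : ∀ z ∈ K.vertices, v z = w z)
    (hf : ∀ a b, IsEdge K a b → fluxMap σ a b v = fluxMap σ a b w) : v = w := by
  have hd := Submodule.sub_mem _ hv hw
  funext x
  by_cases hx : x ∈ closure Ω
  · obtain ⟨t, ht, hxt⟩ := hK.mem_closure_iff.1 hx
    have := hσ.eq_zero_on_face hreg hK hd ht.1
      (fun a ha => sub_eq_zero.2 (h0 a (vertex_mem ht ha)))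
      (fun a ha b hb hab => by rw [map_sub, hf a b ⟨hab, t, ht, ha, hb⟩, sub_self]) x hxt
    exact sub_eq_zero.1 this
  · rw [hv.1.2.1 x hx, hw.1.2.1 x hx]

end IsSplitRatio

/-! ### Interpolation -/

lemma IsMacroMesh.isCompact_closure {Ω : Set Plane} {K : Geometry.SimplicialComplex ℝ Plane}
    (hK : IsMacroMesh Ω K) : IsCompact (closure Ω) := by
  have : closure Ω = ⋃ s ∈ K.faces, convexHull ℝ (s : Set Plane) := by
    rw [← hK.space_eq]
    rfl
  rw [this]
  exact hK.finite.isCompact_biUnion fun s _ => s.finite_toSet.isCompact_convexHull ℝ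

lemma lineMap_mem_segment_or {a b : Plane} {s τ : ℝ} (hτ : τ ∈ Icc (0 : ℝ) 1) :
    AffineMap.lineMap a b τ ∈ segment ℝ a (AffineMap.lineMap a b s) ∨
      AffineMap.lineMap a b τ ∈ segment ℝ b (AffineMap.lineMap a b s) :=
  (le_total τ s).imp (lineMap_mem_segment_left hτ.1) fun h => lineMap_mem_segment_right h hτ.2

lemma segment_subset_convexHull_triple (p q r : Plane) : segment ℝ q r ⊆ convexHull ℝ {p, q, r} :=
  segment_subset_convexHull (Or.inr (Or.inl rfl)) (Or.inr (Or.inr rfl))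

/-- The condition on the value `V` at the split point of an edge, given the values `u` at the vertices
and the potential `ψ` of the fluxes. -/
structure IsEdgeValue (K : Geometry.SimplicialComplex ℝ Plane) (σ : Plane → Plane → ℝ)
    (u : Plane → Plane) (ψ : Plane → ℝ) (a b V : Plane) : Prop where
  cross_eq_zero : ∀ t ∈ triangles K, a ∈ t → b ∈ t →
    cross (V - AffineMap.lineMap (u a) (u b) (σ a b)) (incenter t - splitPoint σ a b) = 0
  flux_eq : edgeFlux (σ a b) (u a) V (u b) (b - a) = ψ a - ψ b

namespace IsSplitRatio

variable {Ω : Set Plane} {K : Geometry.SimplicialComplex ℝ Plane} {σ : Plane → Plane → ℝ}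
  (hσ : IsSplitRatio Ω K σ)
include hσ

omit hσ in
lemma cross_incenter_sub_ne_zero {t : Finset Plane} (ht : t ∈ triangles K) {a b : Plane}
    (ha : a ∈ t) (hb : b ∈ t) (hab : a ≠ b) : cross (b - a) (incenter t - splitPoint σ a b) ≠ 0 := by
  obtain ⟨B, hB, rfl, rfl⟩ := exists_affineBasis ht ha hb hab
  exact cross_edge_ne_zero (p := fun k => splitPoint σ (B (k + 1)) (B (k + 2)))
    (coord_incenter_pos ht hB) (fun _ => rfl) 0

/-- Two independent linear equations in the plane are solvable for one triangle. For a second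
triangle at the edge nothing new is required, because its incenter is collinear with the split point
and the first incenter; this is why the edges are split there. -/
lemma exists_isEdgeValue (u : Plane → Plane) (ψ : Plane → ℝ) {a b : Plane} (h : IsEdge K a b) :
    ∃ V, IsEdgeValue K σ u ψ a b V := by
  have h' := h
  obtain ⟨hab, t, ht, ha, hb⟩ := h'
  have hne := cross_incenter_sub_ne_zero (σ := σ) ht ha hb hab
  set L := AffineMap.lineMap (u a) (u b) (σ a b) with hL
  obtain ⟨w, h1, h2⟩ := exists_cross_eq hne
    (2 * (ψ a - ψ b) - cross (b - a) (σ a b • u a + (1 - σ a b) • u b) - cross (b - a) L) 0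
  refine ⟨L + w, fun s hs has hbs => ?_, ?_⟩
  · rw [← hL, add_sub_cancel_left, eq_smul_of_cross_eq_zero (fun h0 => hne (by rw [h0, cross_zero_right]))
      (hσ.cross_eq_zero h t ht s hs ha hb has hbs), cross_smul_right, cross_comm, h2, neg_zero, mul_zero]
  · have := edgeFlux_eq (σ a b) (u a) (L + w) (u b) (b - a)
    rw [cross_add_right, h1] at this
    linarith

omit hσ in
-- Values are chosen separately for the two orientations of an edge; with `isEdgeValue_symm`,
-- uniqueness makes them agree.
lemma isEdgeValue_unique {u : Plane → Plane} {ψ : Plane → ℝ} {a b V W : Plane} (h : IsEdge K a b)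
    (hV : IsEdgeValue K σ u ψ a b V) (hW : IsEdgeValue K σ u ψ a b W) : V = W := by
  obtain ⟨hab, t, ht, ha, hb⟩ := h
  refine sub_eq_zero.1
    (eq_zero_of_cross (cross_incenter_sub_ne_zero (σ := σ) ht ha hb hab) ?_ ?_)
  · have h1 := edgeFlux_eq (σ a b) (u a) V (u b) (b - a)
    have h2 := edgeFlux_eq (σ a b) (u a) W (u b) (b - a)
    rw [hV.flux_eq] at h1
    rw [hW.flux_eq] at h2
    rw [cross_sub_right]
    linarith
  · have h1 := hV.cross_eq_zero t ht ha hb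
    have h2 := hW.cross_eq_zero t ht ha hb
    rw [cross_comm, neg_eq_zero]
    rw [cross_sub_left] at h1 h2 ⊢
    linarith

lemma isEdgeValue_symm {u : Plane → Plane} {ψ : Plane → ℝ} {a b V : Plane} (h : IsEdge K a b)
    (hV : IsEdgeValue K σ u ψ a b V) : IsEdgeValue K σ u ψ b a V := by
  refine ⟨fun t ht hb ha => ?_, ?_⟩
  · rw [hσ.splitPoint_comm h, hσ.ratio_comm h, AffineMap.lineMap_apply_one_sub]
    exact hV.cross_eq_zero t ht ha hb
  · rw [hσ.ratio_comm h, ← neg_sub b a, edgeFlux_comm, hV.flux_eq, neg_sub]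

/-- The interpolation problem on a triangle. -/
lemma exists_triangle_field {u : Plane → Plane} {ψ : Plane → ℝ} {V : Plane → Plane → Plane}
    (hV : ∀ a b, IsEdge K a b → IsEdgeValue K σ u ψ a b (V a b)) {t : Finset Plane}
    (ht : t ∈ triangles K) :
    ∃ f : Plane → Plane, Continuous f ∧ ∀ a ∈ t, ∀ b ∈ t, a ≠ b → ∃ g : Plane →ᵃ[ℝ] Plane,
      EqOn f g (convexHull ℝ {incenter t, a, splitPoint σ a b}) ∧ divg g = 0 ∧ g a = u a ∧
        g (splitPoint σ a b) = V a b := by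
  obtain ⟨B, hB⟩ := exists_affineBasis' ht
  have hVB := fun k => hV _ _ (isEdge_succ ht hB k)
  obtain ⟨f, hf, hg⟩ := exists_local_field (b := B) (coord_incenter_pos ht hB) (hσ.ratio_basis ht hB)
    (p := fun k => splitPoint σ (B (k + 1)) (B (k + 2))) (fun _ => rfl) (u := fun i => u (B i))
    (v := fun k => V (B (k + 1)) (B (k + 2)))
    (fun k => (hVB k).cross_eq_zero t ht (basis_mem hB _) (basis_mem hB _)) (by
      -- Fluxes with a potential telescope around the triangle, which is the compatibility condition
      -- for the value at the incenter.
      simp only [(hVB _).flux_eq, Fin.sum_univ_three]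
      change ψ (B 1) - ψ (B 2) + (ψ (B 2) - ψ (B 0)) + (ψ (B 0) - ψ (B 1)) = 0
      ring)
  refine ⟨f, hf, fun a ha b hb hab => ?_⟩
  obtain ⟨i, rfl⟩ := exists_basis_eq hB ha
  obtain ⟨j, rfl⟩ := exists_basis_eq hB hb
  have hij : i ≠ j := fun h => hab (by rw [h])
  obtain ⟨k, hik, hkj⟩ := exists_third hij
  have e : V (B i) (B j) = V (B (k + 1)) (B (k + 2)) := by
    rcases succ_eq_or hij hik hkj.symm with ⟨rfl, rfl⟩ | ⟨rfl, rfl⟩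
    · rfl
    · have := isEdge_succ ht hB k
      exact isEdgeValue_unique this.symm (hV _ _ this.symm) (hσ.isEdgeValue_symm this (hVB k))
  rw [hσ.splitPoint_basis ht hB hij hik hkj.symm, e]
  exact hg k i hik

/-- Fields on two triangles that solve the interpolation problem agree on the intersection. -/
lemma eq_of_mem_inter (u : Plane → Plane) (V : Plane → Plane → Plane)
    {f : Finset Plane → Plane → Plane}
    (hf : ∀ t ∈ triangles K, ∀ a ∈ t, ∀ b ∈ t, a ≠ b → ∃ g : Plane →ᵃ[ℝ] Plane,
      EqOn (f t) g (convexHull ℝ {incenter t, a, splitPoint σ a b}) ∧ divg g = 0 ∧ g a = u a ∧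
        g (splitPoint σ a b) = V a b) {s t : Finset Plane} (hs : s ∈ triangles K)
    (ht : t ∈ triangles K) {x : Plane} (hxs : x ∈ convexHull ℝ (s : Set Plane))
    (hxt : x ∈ convexHull ℝ (t : Set Plane)) : f s x = f t x := by
  classical
  have hvert : ∀ r ∈ triangles K, ∀ a ∈ r, f r a = u a := by
    intro r hr a ha
    obtain ⟨b, hb, hba⟩ := Finset.exists_mem_ne (by rw [hr.2]; norm_num) a
    obtain ⟨g, h1, -, h2, -⟩ := hf r hr a ha b hb hba.symm
    rw [h1 (subset_convexHull ℝ _ (Or.inr (Or.inl rfl))), h2]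
  have hseg : ∀ a b, a ∈ s → a ∈ t → b ∈ s → b ∈ t → a ≠ b →
      ∀ y ∈ segment ℝ a (splitPoint σ a b), f s y = f t y := by
    intro a b has hat hbs hbt hab y hy
    obtain ⟨g, h1, -, h2, h3⟩ := hf s hs a has b hbs hab
    obtain ⟨g', h1', -, h2', h3'⟩ := hf t ht a hat b hbt hab
    rw [h1 (segment_subset_convexHull_triple _ _ _ hy),
      h1' (segment_subset_convexHull_triple _ _ _ hy)]
    rw [segment_eq_image_lineMap] at hy
    obtain ⟨τ, -, rfl⟩ := hy
    rw [AffineMap.apply_lineMap, AffineMap.apply_lineMap, h2, h3, h2', h3']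
  have hx := K.inter_subset_convexHull hs.1 ht.1 ⟨hxs, hxt⟩
  rw [← Finset.coe_inter] at hx
  have hne : (s ∩ t).Nonempty := Finset.coe_nonempty.1 (convexHull_nonempty_iff.1 ⟨x, hx⟩)
  have hpos := Finset.card_pos.2 hne
  have hcard := Finset.card_le_card (Finset.inter_subset_left : s ∩ t ⊆ s)
  rw [hs.2] at hcard
  have hmem : ∀ a ∈ s ∩ t, a ∈ s ∧ a ∈ t := fun a => Finset.mem_inter.1
  obtain h | h | h : (s ∩ t).card = 1 ∨ (s ∩ t).card = 2 ∨ (s ∩ t).card = 3 := by omega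
  · obtain ⟨a, ha⟩ := Finset.card_eq_one.1 h
    have := hmem a (by simp [ha])
    rw [ha, Finset.coe_singleton, convexHull_singleton] at hx
    rw [mem_singleton_iff.1 hx, hvert s hs a this.1, hvert t ht a this.2]
  · obtain ⟨a, b, hab, hr⟩ := Finset.card_eq_two.1 h
    obtain ⟨has, hat⟩ := hmem a (by simp [hr])
    obtain ⟨hbs, hbt⟩ := hmem b (by simp [hr])
    rw [hr, Finset.coe_pair, convexHull_pair, segment_eq_image_lineMap] at hx
    obtain ⟨τ, hτ, rfl⟩ := hx
    rcases lineMap_mem_segment_or (s := σ a b) hτ with h1 | h1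
    · exact hseg a b has hat hbs hbt hab _ h1
    · refine hseg b a hbs hbt has hat hab.symm _ ?_
      rwa [hσ.splitPoint_comm ⟨hab, s, hs, has, hbs⟩]
  · have h1 : s ∩ t = s := Finset.eq_of_subset_of_card_le Finset.inter_subset_left (by rw [hs.2, h])
    have h2 : s ∩ t = t := Finset.eq_of_subset_of_card_le Finset.inter_subset_right (by rw [ht.2, h])
    rw [← h1, h2]

/-- A field that is affine and divergence-free on the parts of the triangles is solenoidal. -/
lemma mem_Vh_of_piecewise (hopen : IsOpen Ω) (hK : IsMacroMesh Ω K) {v : Plane → Plane}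
    (hv : ContinuousOn v (closure Ω)) (hv0 : ∀ x, x ∉ closure Ω → v x = 0)
    (hg : ∀ T ∈ fineTriangles Ω K, ∃ g : Plane →ᵃ[ℝ] Plane, EqOn v g T ∧ divg g = 0) :
    v ∈ Vh Ω K := by
  refine ⟨⟨hv, hv0, fun T hT => (hg T hT).imp fun _ h => h.1⟩, ?_⟩
  choose! g hg hdiv using hg
  obtain ⟨C, hC⟩ := (hK.isCompact_closure.image_of_continuousOn hv).isBounded.exists_norm_le
  exact isSolenoidal_of_piecewise hopen (hK.isCompact_closure.isBounded.subset subset_closure)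
    (hσ.finite_fineTriangles hK) (fun T => hσ.fineTriangle_isClosed) (fun T => hσ.fineTriangle_convex)
    (subset_closure.trans (hσ.closure_subset hK)) (hv.mono subset_closure)
    (fun x hx => hC _ ⟨x, subset_closure hx, rfl⟩) hg hdiv

/-- Existence of a solenoidal field with given values at the vertices and fluxes with a given
potential. -/
lemma exists_mem_Vh (hopen : IsOpen Ω) (hK : IsMacroMesh Ω K) (u : Plane → Plane) (ψ : Plane → ℝ) :
    ∃ v ∈ Vh Ω K, (∀ z ∈ K.vertices, v z = u z) ∧
      ∀ a b, IsEdge K a b → fluxMap σ a b v = ψ a - ψ b := by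
  have hV := fun a b (h : IsEdge K a b) => hσ.exists_isEdgeValue u ψ h
  choose! V hV using hV
  choose! f hfc hf using fun t (ht : t ∈ triangles K) => hσ.exists_triangle_field hV ht
  obtain ⟨v, hvc, hv0, hv⟩ := hK.exists_glue (0 : Plane) f (fun t ht => (hfc t ht).continuousOn)
    fun s hs t ht x hxs hxt => hσ.eq_of_mem_inter u V hf hs ht hxs hxt
  have hloc : ∀ t ∈ triangles K, ∀ a ∈ t, ∀ b ∈ t, a ≠ b → ∃ g : Plane →ᵃ[ℝ] Plane,
      EqOn v g (convexHull ℝ {incenter t, a, splitPoint σ a b}) ∧ divg g = 0 ∧ g a = u a ∧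
        g (splitPoint σ a b) = V a b := by
    intro t ht a ha b hb hab
    obtain ⟨g, h1, h2⟩ := hf t ht a ha b hb hab
    exact ⟨g, fun x hx => by rw [hv t ht (hσ.fineTriangle_subset ht ha hb hab hx), h1 hx], h2⟩
  have hvert : ∀ z ∈ K.vertices, v z = u z := by
    intro a ha
    obtain ⟨t, ht, ha⟩ := hK.exists_triangle ha
    obtain ⟨b, hb, hba⟩ := Finset.exists_mem_ne (by rw [ht.2]; norm_num) a
    obtain ⟨g, h1, -, h2, -⟩ := hloc t ht a ha b hb hba.symm
    rw [h1 (subset_convexHull ℝ _ (Or.inr (Or.inl rfl))), h2]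
  refine ⟨v, hσ.mem_Vh_of_piecewise hopen hK hvc hv0 fun T hT => ?_, hvert, fun a b h => ?_⟩
  · obtain ⟨t, ht, a, ha, b, hb, hab, rfl⟩ := hσ.mem_fineTriangles_iff.1 hT
    obtain ⟨g, h1, h2, -⟩ := hloc t ht a ha b hb hab
    exact ⟨g, h1, h2⟩
  · have h' := h
    obtain ⟨hab, t, ht, ha, hb⟩ := h'
    obtain ⟨g, h1, -, -, h2⟩ := hloc t ht a ha b hb hab
    rw [fluxMap_apply, hvert a (vertex_mem ht ha), hvert b (vertex_mem ht hb),
      h1 (subset_convexHull ℝ _ (Or.inr (Or.inr rfl))), h2, (hV a b h).flux_eq]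

end IsSplitRatio

/-! ### The local functions -/

variable {Ω : Set Plane} {K : Geometry.SimplicialComplex ℝ Plane} {σ : Plane → Plane → ℝ}

open Classical in
lemma IsLocalFunction.value_apply {z : Plane} {i : Fin 3} {v : Plane → Plane}
    (h : IsLocalFunction Ω K z i v) {x : Plane} (hx : x ∈ K.vertices) :
    v x = if x = z then (![!₂[1, 0], !₂[0, 1], !₂[0, 0]] : Fin 3 → Plane) i else 0 := by
  split_ifs with hxz
  · rw [hxz, h.value]
  · exact h.supported.2 {x} hx (by simpa using Ne.symm hxz) x (by simp)

lemma IsEdge.mem_faces [DecidableEq Plane] {a b : Plane} (h : IsEdge K a b) :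
    ({a, b} : Finset Plane) ∈ K.faces := by
  obtain ⟨-, t, ht, ha, hb⟩ := h
  convert edge_mem ht ha hb

lemma IsEdge.left_mem {a b : Plane} (h : IsEdge K a b) : a ∈ K.vertices := by
  obtain ⟨-, t, ht, ha, -⟩ := h
  exact vertex_mem ht ha

namespace IsSplitRatio

variable (hσ : IsSplitRatio Ω K σ)
include hσ

lemma fluxMap_eq_zero_of_segment {a b : Plane} (h : IsEdge K a b) {v : Plane → Plane}
    (hv : ∀ x ∈ segment ℝ a b, v x = 0) : fluxMap σ a b v = 0 := by
  rw [fluxMap_apply, hv _ (left_mem_segment ..), hv _ (right_mem_segment ..),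
    hv _ (hσ.splitPoint_mem h)]
  simp [edgeFlux]

-- The flux potential is the indicator of `z` for the third function and zero for the others: edges
-- at `z` carry the prescribed flux, and on all other edges the function vanishes.
open Classical in
lemma fluxMap_local {z : Plane} {i : Fin 3} {v : Plane → Plane} (h : IsLocalFunction Ω K z i v)
    {a b : Plane} (hab : IsEdge K a b) : fluxMap σ a b v =
      (if a = z then (![0, 0, 1] : Fin 3 → ℝ) i else 0) -
      (if b = z then (![0, 0, 1] : Fin 3 → ℝ) i else 0) := by
  have key : ∀ w, IsEdge K z w → fluxMap σ z w v = (![0, 0, 1] : Fin 3 → ℝ) i := fun w hw => by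
    rw [← hσ.flux_eq h.supported.1.1 hw]
    exact h.flux_eq {z, w} hw.mem_faces (Finset.card_pair hw.1) (by simp) w (by simp) hw.1.symm
  by_cases ha : a = z
  · subst ha
    rw [if_pos rfl, if_neg hab.1.symm, sub_zero, key b hab]
  by_cases hb : b = z
  · subst hb
    rw [if_neg ha, if_pos rfl, zero_sub, hσ.fluxMap_comm hab.symm, key a hab.symm]
  · rw [if_neg ha, if_neg hb, sub_zero]
    refine hσ.fluxMap_eq_zero_of_segment hab fun x hx => ?_
    refine h.supported.2 {a, b} hab.mem_faces (by simp [Ne.symm ha, Ne.symm hb]) x ?_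
    rwa [Finset.coe_pair, convexHull_pair]

lemma isLocalFunction_unique (hreg : interior (closure Ω) = Ω) (hK : IsMacroMesh Ω K) {z : Plane}
    {i : Fin 3} {v w : Plane → Plane} (hv : IsLocalFunction Ω K z i v)
    (hw : IsLocalFunction Ω K z i w) : v = w :=
  hσ.eq_of_mem_Vh hreg hK hv.supported.1 hw.supported.1
    (fun x hx => by rw [hv.value_apply hx, hw.value_apply hx])
    fun a b hab => by rw [hσ.fluxMap_local hv hab, hσ.fluxMap_local hw hab]

/-- Interpolation with values and potential concentrated at `z`. On a face without `z` all vertex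
values and fluxes vanish, so the field does too. -/
lemma exists_isLocalFunction (hopen : IsOpen Ω) (hreg : interior (closure Ω) = Ω)
    (hK : IsMacroMesh Ω K) {z : Plane} (hz : z ∈ K.vertices) (i : Fin 3) :
    ∃ v, IsLocalFunction Ω K z i v := by
  classical
  obtain ⟨v, hv, h0, hf⟩ := hσ.exists_mem_Vh hopen hK
    (fun x => if x = z then (![!₂[1, 0], !₂[0, 1], !₂[0, 0]] : Fin 3 → Plane) i else 0)
    (fun x => if x = z then (![0, 0, 1] : Fin 3 → ℝ) i else 0)
  refine ⟨v, ⟨hv, fun s hs hzs => ?_⟩, by rw [h0 z hz, if_pos rfl], fun e he _ hze w hwe hwz => ?_⟩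
  · obtain ⟨t, ht, hst⟩ := hK.pure s hs
    have hne : ∀ a ∈ s, a ≠ z := fun a ha haz => hzs (haz ▸ ha)
    refine hσ.eq_zero_on_face hreg hK hv hs (fun a ha => ?_) fun a ha b hb hab => ?_
    · rw [h0 a (vertex_mem ht (hst ha)), if_neg (hne a ha)]
    · rw [hf a b ⟨hab, t, ht, hst ha, hst hb⟩, if_neg (hne a ha), if_neg (hne b hb), sub_zero]
  · obtain ⟨t, ht, hst⟩ := hK.pure e he
    have hzw : IsEdge K z w := ⟨hwz.symm, t, ht, hst hze, hst hwe⟩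
    rw [hσ.flux_eq hv.1 hzw, hf z w hzw, if_pos rfl, if_neg hwz, sub_zero]

end IsSplitRatio

/-- The local functions at interior vertices vanish on the boundary. -/
lemma isLocalFunction_mem_Vh0 (hopen : IsOpen Ω) (hreg : interior (closure Ω) = Ω)
    (hK : IsMacroMesh Ω K) {z : Plane} (hz : z ∈ Ω) {i : Fin 3} {v : Plane → Plane}
    (hv : IsLocalFunction Ω K z i v) : v ∈ Vh0 Ω K := by
  classical
  refine ⟨hv.supported.1, fun x hx => ?_⟩
  have hxΩ : x ∉ Ω := fun h => by
    rw [hopen.frontier_eq] at hx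
    exact hx.2 h
  obtain ⟨t, ht, hxt⟩ := hK.mem_closure_iff.1 (frontier_subset_closure hx)
  obtain ⟨B, hB⟩ := exists_affineBasis' ht
  rcases mem_convexHull_cases hB hxt with h | ⟨i, j, -, hij, -, -, h⟩ | ⟨i, rfl⟩
  · exact absurd (hK.interior_subset hreg ht h) hxΩ
  · have hne := basis_ne B hij
    have hsh : ¬ IsSharedEdge K (B i) (B j) := fun hsh =>
      hxΩ (hK.openSegment_subset hreg hne hsh h)
    have hfr := (hK.segment_subset_frontier_iff hopen hreg hne ht (basis_mem hB i)
      (basis_mem hB j)).2 hsh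
    rw [hopen.frontier_eq] at hfr
    refine hv.supported.2 {B i, B j} (IsSplitRatio.isEdge_basis ht hB hij).mem_faces ?_ x ?_
    · simp only [Finset.mem_insert, Finset.mem_singleton, not_or]
      exact ⟨fun e => (hfr (left_mem_segment ..)).2 (e ▸ hz),
        fun e => (hfr (right_mem_segment ..)).2 (e ▸ hz)⟩
    · rw [Finset.coe_pair, convexHull_pair]
      exact openSegment_subset_segment ℝ _ _ h
  · exact hv.supported.2 {B i} (vertex_mem ht (basis_mem hB i))
      (by simpa using fun e : z = B i => hxΩ (e ▸ hz)) _ (by simp)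

/-! ### Bases -/

/-- Gives uniqueness of potentials up to a constant; a chain of adjacent triangles carries the value
from one vertex to the other. -/
lemma IsMacroMesh.eq_of_edge_eq (hK : IsMacroMesh Ω K) (hΩ : IsConnected Ω) {X : Type*}
    {ψ : K.vertices → X} (h : ∀ a b : K.vertices, IsEdge K a b → ψ a = ψ b) (a b : K.vertices) :
    ψ a = ψ b := by
  have htri : ∀ t ∈ triangles K, ∀ x y : K.vertices, (x : Plane) ∈ t → (y : Plane) ∈ t →
      ψ x = ψ y := by
    intro t ht x y hx hy
    by_cases hxy : x = y
    · rw [hxy]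
    · exact h x y ⟨fun e => hxy (Subtype.ext e), t, ht, hx, hy⟩
  obtain ⟨s, hs, has⟩ := hK.exists_triangle a.2
  obtain ⟨t, ht, hbt⟩ := hK.exists_triangle b.2
  have key : ∀ r, Relation.ReflTransGen (EdgeAdjacent K) s r →
      ∀ x : K.vertices, (x : Plane) ∈ r → ψ a = ψ x := by
    intro r hr
    induction hr with
    | refl => exact fun x hx => htri s hs a x has hx
    | tail _ hadj ih =>
      obtain ⟨hr, hr', c, -, -, hc, -, hc', -⟩ := hadj
      exact fun x hx => (ih ⟨c, vertex_mem hr hc⟩ hc).trans (htri _ hr' ⟨c, vertex_mem hr hc⟩ x hc' hx)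
  exact key t (hK.edgeConnected hΩ hs ht) b hbt

/-- The combination of the local functions with coefficients `c`. -/
def combination [Fintype K.vertices] (Φ : K.vertices → Fin 3 → Plane → Plane)
    (c : K.vertices × Fin 3 → ℝ) : Plane → Plane := ∑ p, c p • Φ p.1 p.2

/-! ### Coefficients as vertex values and flux potential -/

section Combination

variable [Fintype K.vertices] {Φ : K.vertices → Fin 3 → Plane → Plane}
  (hΦ : ∀ (z : K.vertices) i, IsLocalFunction Ω K z i (Φ z i))
include hΦ

lemma combination_mem (c : K.vertices × Fin 3 → ℝ) : combination Φ c ∈ Vh Ω K :=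
  Submodule.sum_mem _ fun p _ => Submodule.smul_mem _ _ (hΦ p.1 p.2).supported.1

lemma combination_apply (c : K.vertices × Fin 3 → ℝ) (z : K.vertices) :
    combination Φ c z = !₂[c (z, 0), c (z, 1)] := by
  classical
  simp only [combination, Finset.sum_apply, Pi.smul_apply, (hΦ _ _).value_apply z.2,
    Fintype.sum_prod_type]
  rw [Finset.sum_eq_single z (fun w _ hw => by simp [Subtype.coe_inj, hw.symm]) (by simp)]
  ext j
  fin_cases j <;> simp [Fin.sum_univ_three]

/-- The coefficients with index 2 are a flux potential, as each third local function contributes the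
indicator of its vertex. -/
lemma IsSplitRatio.fluxMap_combination (hσ : IsSplitRatio Ω K σ) (c : K.vertices × Fin 3 → ℝ)
    (a b : K.vertices) (hab : IsEdge K a b) :
    fluxMap σ a b (combination Φ c) = c (a, 2) - c (b, 2) := by
  classical
  have key : ∀ z : K.vertices, ∑ w : K.vertices, ∑ i : Fin 3,
      c (w, i) * (if (z : Plane) = w then (![0, 0, 1] : Fin 3 → ℝ) i else 0) = c (z, 2) := by
    intro z
    rw [Finset.sum_eq_single z (fun w _ hw => by simp [Subtype.coe_inj, hw.symm]) (by simp)]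
    simp [Fin.sum_univ_three]
  simp only [combination, map_sum, map_smul, hσ.fluxMap_local (hΦ _ _) hab, smul_eq_mul,
    Fintype.sum_prod_type, mul_sub, Finset.sum_sub_distrib, key]

/-- Every field in `Vh` is a combination of the local functions. -/
lemma IsSplitRatio.exists_combination_eq (hσ : IsSplitRatio Ω K σ)
    (hreg : interior (closure Ω) = Ω) (hsc : IsSimplyConnected Ω) (hK : IsMacroMesh Ω K)
    (z₀ : K.vertices) {v : Plane → Plane} (hv : v ∈ Vh Ω K) :
    ∃ c, c (z₀, 2) = 0 ∧ combination Φ c = v := by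
  obtain ⟨ψ, hψ⟩ := hσ.exists_fluxMap_potential hreg hsc hK hv
  -- Subtracting `ψ z₀` leaves the fluxes unchanged and makes the coefficient at `(z₀, 2)` zero.
  refine ⟨fun p => (![v p.1 0, v p.1 1, ψ p.1 - ψ z₀] : Fin 3 → ℝ) p.2, by simp, ?_⟩
  refine hσ.eq_of_mem_Vh hreg hK (combination_mem hΦ _) hv (fun z hz => ?_) fun a b hab => ?_
  · rw [combination_apply hΦ _ ⟨z, hz⟩]
    ext j
    fin_cases j <;> simp
  · rw [hσ.fluxMap_combination hΦ _ ⟨a, hab.left_mem⟩ ⟨b, hab.symm.left_mem⟩ hab, hψ a b hab]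
    simp

/-- The local functions are independent up to a constant potential. -/
lemma IsSplitRatio.eq_zero_of_combination_eq_zero (hσ : IsSplitRatio Ω K σ) (hΩ : IsConnected Ω)
    (hK : IsMacroMesh Ω K) {z₀ : K.vertices} {c : K.vertices × Fin 3 → ℝ} (h0 : c (z₀, 2) = 0)
    (hc : combination Φ c = 0) : c = 0 := by
  have h1 : ∀ z : K.vertices, !₂[c (z, 0), c (z, 1)] = (0 : Plane) := fun z => by
    rw [← combination_apply hΦ, hc]; rfl
  have h2 : ∀ a b : K.vertices, IsEdge K a b → c (a, 2) = c (b, 2) := fun a b hab => by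
    have := hσ.fluxMap_combination hΦ c a b hab
    rw [hc, map_zero] at this
    linarith
  funext ⟨z, i⟩
  rcases eq_zero_or i with rfl | rfl | rfl
  · simpa using congrArg (fun x : Plane => x 0) (h1 z)
  · simpa using congrArg (fun x : Plane => x 1) (h1 z)
  · exact (hK.eq_of_edge_eq hΩ (ψ := fun z => c (z, 2)) h2 z z₀).trans h0

/-- A criterion for a part of the local functions to be a basis of a subspace of `Vh`. -/
lemma IsSplitRatio.isBasisOf (hσ : IsSplitRatio Ω K σ) (hreg : interior (closure Ω) = Ω)
    (hsc : IsSimplyConnected Ω) (hK : IsMacroMesh Ω K) (z₀ : K.vertices) {ι : Type*} [Fintype ι]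
    {e : ι → K.vertices × Fin 3} (he : Function.Injective e) (hz₀ : (z₀, 2) ∉ range e)
    {W : Submodule ℝ (Plane → Plane)} (hWV : W ≤ Vh Ω K) (hmem : ∀ i, Φ (e i).1 (e i).2 ∈ W)
    (hspan : ∀ c, c (z₀, 2) = 0 → combination Φ c ∈ W → ∀ p ∉ range e, c p = 0) :
    IsBasisOf (fun i => Φ (e i).1 (e i).2) W := by
  refine ⟨Fintype.linearIndependent_iff.2 fun g hg i => ?_, le_antisymm ?_ fun v hv => ?_⟩
  · have hext : ∀ p ∉ range e, Function.extend e g 0 p = 0 := fun p hp =>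
      Function.extend_apply' _ _ _ hp
    have hzero : combination Φ (Function.extend e g 0) = 0 := by
      rw [← hg]
      exact (Fintype.sum_of_injective e he _ _ (fun p hp => by rw [hext p hp, zero_smul])
        fun i => by rw [he.extend_apply]).symm
    have := hσ.eq_zero_of_combination_eq_zero hΦ hsc.isPathConnected.isConnected hK (hext _ hz₀) hzero
    rw [← he.extend_apply g 0 i, this]
    rfl
  · rw [Submodule.span_le]
    rintro _ ⟨i, rfl⟩
    exact hmem i
  · obtain ⟨c, h0, rfl⟩ := hσ.exists_combination_eq hΦ hreg hsc hK z₀ (hWV hv)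
    have hc := hspan c h0 hv
    have : combination Φ c = ∑ i, c (e i) • Φ (e i).1 (e i).2 :=
      (Fintype.sum_of_injective e he _ _ (fun p hp => by rw [hc p hp, zero_smul]) fun i => rfl).symm
    rw [this]
    exact Submodule.sum_mem _ fun i _ => Submodule.smul_mem _ _ (Submodule.subset_span ⟨i, rfl⟩)

/-- The coefficients at boundary vertices of a combination that vanishes on the boundary are zero. -/
lemma IsSplitRatio.coeff_eq_zero_of_mem_Vh0 (hσ : IsSplitRatio Ω K σ) (hopen : IsOpen Ω)
    (hreg : interior (closure Ω) = Ω) (hsc : IsSimplyConnected Ω) (hK : IsMacroMesh Ω K)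
    {z₀ : K.vertices} (hz₀ : (z₀ : Plane) ∉ Ω) {c : K.vertices × Fin 3 → ℝ} (h0 : c (z₀, 2) = 0)
    (hc : combination Φ c ∈ Vh0 Ω K) {z : K.vertices} (hz : (z : Plane) ∉ Ω) (i : Fin 3) :
    c (z, i) = 0 := by
  have h1 : !₂[c (z, 0), c (z, 1)] = (0 : Plane) := by
    obtain ⟨t, ht, hzt⟩ := hK.exists_triangle z.2
    rw [← combination_apply hΦ]
    refine hc.2 _ ?_
    rw [hopen.frontier_eq]
    exact ⟨hK.convexHull_subset ht (subset_convexHull ℝ _ hzt), hz⟩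
  rcases eq_zero_or i with rfl | rfl | rfl
  · simpa using congrArg (fun x : Plane => x 0) h1
  · simpa using congrArg (fun x : Plane => x 1) h1
  -- The third coefficient is a potential and there is no flux through exterior edges, so its zero
  -- set is closed under passing along them. It contains `z₀`, and connectedness of the exterior
  -- edges carries it to `z`.
  obtain ⟨s, hs, a, has, hzs, hza, hsh⟩ := hK.exists_boundary_edge hreg z₀.2 hz₀
  obtain ⟨t, ht, b, hbt, hzt, hzb, hsh'⟩ := hK.exists_boundary_edge hreg z.2 hz
  obtain ⟨_, h⟩ := exterior_edges_connected hreg hsc hK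
    (S := {x | ∃ h : x ∈ K.vertices, c (⟨x, h⟩, 2) = 0}) (fun t ht a ha b hb hab hsh hS => by
      obtain ⟨_, hS⟩ := hS
      refine ⟨vertex_mem ht hb, ?_⟩
      have hedge : IsEdge K a b := ⟨hab, t, ht, ha, hb⟩
      have hfr := (hK.segment_subset_frontier_iff hopen hreg hab ht ha hb).2 hsh
      have h2 := hσ.fluxMap_eq_zero_of_segment hedge fun x hx => hc.2 x (hfr hx)
      have h3 := hσ.fluxMap_combination hΦ c ⟨a, vertex_mem ht ha⟩ ⟨b, vertex_mem ht hb⟩ hedge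
      rw [h2, hS] at h3
      linarith)
    hs ht hzs has hza hsh ⟨z₀.2, h0⟩ hzt hbt hzb hsh'
  exact h

end Combination

end PowellSabin

end

/-! ### The basis theorem -/

theorem theorem1 (Ω : Set PowellSabin.Plane) (hopen : IsOpen Ω)
    (hreg : interior (closure Ω) = Ω) (hsc : IsSimplyConnected Ω)
    (K : Geometry.SimplicialComplex ℝ PowellSabin.Plane) (hK : PowellSabin.IsMacroMesh Ω K)
    (z₀ : K.vertices) (hz₀ : (z₀ : PowellSabin.Plane) ∈ frontier Ω) :
    ∃ Φ : K.vertices → Fin 3 → PowellSabin.Plane → PowellSabin.Plane,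
      (∀ (z : K.vertices) (i : Fin 3) (φ : PowellSabin.Plane → PowellSabin.Plane),
        PowellSabin.IsLocalFunction Ω K z i φ ↔ φ = Φ z i) ∧
      PowellSabin.IsBasisOf
        (fun p : {p : K.vertices × Fin 3 // p ≠ (z₀, 2)} => Φ p.1.1 p.1.2)
        (PowellSabin.Vh Ω K) ∧
      Module.finrank ℝ (PowellSabin.Vh Ω K) + 1 = 3 * K.vertices.ncard ∧
      PowellSabin.IsBasisOf
        (fun p : {z : K.vertices // (z : PowellSabin.Plane) ∈ Ω} × Fin 3 => Φ p.1.1 p.2)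
        (PowellSabin.Vh0 Ω K) := by
  classical
  have : Fintype K.vertices := hK.finite_vertices.fintype
  obtain ⟨σ, hσ⟩ := PowellSabin.exists_isSplitRatio hopen hreg hK
  choose Φ hΦ using fun (z : K.vertices) i => hσ.exists_isLocalFunction hopen hreg hK z.2 i
  have hz₀' : (z₀ : PowellSabin.Plane) ∉ Ω := by
    rw [hopen.frontier_eq] at hz₀
    exact hz₀.2
  have hbasis : PowellSabin.IsBasisOf
      (fun p : {p : K.vertices × Fin 3 // p ≠ (z₀, 2)} => Φ p.1.1 p.1.2) (PowellSabin.Vh Ω K) := by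
    refine hσ.isBasisOf hΦ hreg hsc hK z₀ (e := Subtype.val) Subtype.val_injective (by simp) le_rfl
      (fun p => (hΦ _ _).supported.1) fun c h0 _ p hp => ?_
    rw [Subtype.range_coe_subtype] at hp
    have : p = (z₀, 2) := by simpa using hp
    rw [this, h0]
  refine ⟨Φ, fun z i φ => ⟨fun h => hσ.isLocalFunction_unique hreg hK h (hΦ z i),
    fun h => h ▸ hΦ z i⟩, hbasis, ?_, ?_⟩
  · have hcard := finrank_span_eq_card hbasis.1
    rw [hbasis.2] at hcard
    -- Positivity makes the truncated subtraction of the one removed index reversible.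
    have hpos : 0 < Fintype.card (K.vertices × Fin 3) := Fintype.card_pos_iff.2 ⟨(z₀, 2)⟩
    have h1 : Fintype.card {p : K.vertices × Fin 3 // p ≠ (z₀, 2)} =
        Fintype.card (K.vertices × Fin 3) - 1 := Set.card_ne_eq _
    rw [hcard, h1, Nat.sub_add_cancel hpos, Fintype.card_prod, Fintype.card_fin, mul_comm,
      ← Nat.card_coe_set_eq, Nat.card_eq_fintype_card]
  · have hinj : Function.Injective
        fun p : {z : K.vertices // (z : PowellSabin.Plane) ∈ Ω} × Fin 3 => (p.1.1, p.2) :=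
      Subtype.val_injective.prodMap Function.injective_id
    refine hσ.isBasisOf hΦ hreg hsc hK z₀ hinj ?_ (W := PowellSabin.Vh0 Ω K) (fun v hv => And.left hv)
      (fun p => PowellSabin.isLocalFunction_mem_Vh0 hopen hreg hK p.1.2 (hΦ _ _)) fun c h0 hc p hp => ?_
    · rintro ⟨⟨⟨a, ha⟩, i⟩, h⟩
      exact hz₀' ((congrArg (fun q : K.vertices × Fin 3 => (q.1 : PowellSabin.Plane)) h) ▸ ha)
    · exact hσ.coeff_eq_zero_of_mem_Vh0 hΦ hopen hreg hsc hK hz₀' h0 hc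
        (fun hz => hp ⟨(⟨p.1, hz⟩, p.2), rfl⟩) p.2
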